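/- Let $0<q<1$. For $n\in\mathbb N=\{0,1,2,\dots\}$ let $J_n(x;q)=x^{n/2}\frac{(q^{n+1};q)_\infty}{(q;q)_\infty}\,{}_1\varphi_1(0;q^{n+1};q,qx)$ and $J_{-n}(x;q)=(-1)^nq^{n/2}J_n(xq^n;q)$ (Jackson's third $q$-Bessel function). For $\nu=(\nu_0,\dots,\nu_{d+1})\in\mathbb Z^{d+2}$ and $x,\lambda\in\mathbb Z^d$ let $$J_\nu(x,\lambda;q)=\prod_{j=1}^dJ_{\nu_j-x_{j+1}-\lambda_{j-1}}\big(q^{x_j-x_{j+1}+\lambda_j-\lambda_{j-1}};q\big),\qquad \lambda_0=\nu_0,\ x_{d+1}=\nu_{d+1},$$ and for $\mathbf n\in\mathbb Z^{k+2}$ put $\nu(x,\mathbf n)=(n_1,x+n_2,\dots,x+n_{k+1},n_{k+2})$. For a vector $\mathbf v$ let $|\mathbf v|$ be the sum of its components and $\mathbf v'$ the vector $\mathbf v$ without its first component. *Clebsch–Gordan coefficients.* With the Wall polynomials $p_n(q^x;a;q)={}_2\varphi_1(q^{-n},0;aq;q,q^{x+1})$ let $$\bar p_n(q^x;a;q)=(-1)^{n+x}\sqrt{\frac{(aq)^{x-n}(aq;q)_\infty(aq;q)_n}{(q;q)_n(q;q)_x}}\;p_n(q^x;a;q),$$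 and $C_{x,m,n}=\bar p_{\min(m,n)}(q^{2x};q^{2|n-m|};q^2)$ for $x,m,n\in\mathbb N$, $C_{x,m,n}=0$ if one of the integers $x,m,n$ is negative. *Coupled vectors.* Let $e_n$ ($n\in\mathbb N$) be the standard basis of $\ell^2(\mathbb N)$. For $x,p,r\in\mathbb Z$ put $e_{x,p}=\sum_{m,n\in\mathbb N,\,n-m=p}C_{x,m,n}\,e_m\otimes e_n$, and for a family $f=(f_{y,p})_{y,p\in\mathbb Z}$ of vectors in $\ell^2(\mathbb N)^{\otimes d}$ let $$(\Lambda_rf)_{x,p}=\sum_{n\in\mathbb N}C_{x,n,n+p}\,e_n\otimes f_{n+p,\,x-n-r},\qquad(\mathrm P_rf)_{x,p}=\sum_{k\in\mathbb N}C_{x,k-p,k}\,f_{k-p,\,r-x+k}\otimes e_k .$$ To a binary tree with integer labels at its nodes belongs the integer $p$ = (label of the right child of the root) − (label of the left child of the root), and, if at each inner node at least one of the children is a leaf, a family: the family $(e_{y,p})$ for a tree with two leaves; the family $\Lambda_rf$ with $r=x-n-p'$ for the tree with root $x$, left child a leaf $n$ and right child the root of a subtree with family $f$ and integer $p'$; the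 family $\mathrm P_rf$ with $r=p'+x-n$ for the tree with root $x$, left child the root of a subtree with family $f$ and integer $p'$ and right child a leaf $n$. The vector of the tree at level $y\in\mathbb N$ is the member of its family with indices $y$ and $p$ (the integer of the tree); for a tree with root $x\in\mathbb N$ the vector represented by the tree is the one at level $x$. *The $3nj$-symbols.* Let $k\ge1$, $x\in\mathbb Z$, $\mathbf n\in\mathbb Z^{k+2}$, $\mathbf r,\mathbf s\in\mathbb Z^k$. Consider three trees with root $x$ and leaves $n_1,\dots,n_{k+2}$ (children are listed left, right). Right tree of $\mathbf r$: the root has children $n_1,r_1$; $r_j$ has children $n_{j+1},r_{j+1}$ for $1\le j\le k$, $r_{k+1}=n_{k+2}$. Left tree of $\mathbf s$: $s_j$ has children $s_{j-1},n_{j+1}$ for $1\le j\le k$, $s_0=n_1$, and the root has children $s_k,n_{k+2}$. Mixed tree of $\mathbf r$: the root has children $n_1,r_k$; $r_j$ has children $r_{j-1},n_{j+2}$ for $1\le j\le k$, $r_0=n_2$. Let $R^{x,\mathbf n}_{\mathbf r,\mathbf s}$ (respectively $S^{x,\mathbf n}_{\mathbf r,\mathbf s}$) be the inner product in $\ell^2(\mathbb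 N)^{\otimes(k+2)}$ of the vectors of the right tree of $\mathbf r$ (respectively of the mixed tree of $\mathbf r$) and of the left tree of $\mathbf s$, both at level $\max(x,0)$. (These inner products do not depend on the level $y\in\mathbb N$; the convention only serves to define the symbols also for $x<0$.) **Theorem.** Let $k\ge2$, $x\in\mathbb Z$, $\mathbf r,\mathbf s\in\mathbb Z^k$, $\mathbf n\in\mathbb Z^{k+2}$. Then $$R^{x,\mathbf n}_{\mathbf r,\mathbf s}=\sum_{\mathbf t\in\mathbb Z^{k-1}}S^{x,\mathbf n}_{(\mathbf t,r_1),\mathbf s}\,R^{r_1,\mathbf n'}_{\mathbf r',\mathbf t},$$ and, in terms of multivariate $q$-Bessel functions, $$J_{\nu(x,\mathbf n)}(\mathbf r,\mathbf s;q)=\sum_{\mathbf t\in\mathbb Z^{k-1}}A_{\mathbf t}\,J_{\nu(r_1,\mathbf n')}(\mathbf r',\mathbf t;q),$$ $$A_{\mathbf t}=(-q^{1/2})^{|\mathbf t|+|\mathbf s|-|\mathbf n|-(k-2)n_1-s_k+r_2+t_{k-1}}\prod_{j=1}^kJ_{s_{j+1}-n_1+t_{j-1}-n_{j+2}}\big(q^{s_j+t_j-n_1-n_{j+2}};q\big),$$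 where $\mathbf t=(t_1,\dots,t_{k-1})$, $t_0=n_2$, $t_k=r_1$, $s_{k+1}=x$. Both sums converge unconditionally. -/

import Mathlib

namespace QBessel

noncomputable section

/-! ### Basic hypergeometric notation -/

/-- The `q`-shifted factorial `(a;q)_n`. -/
def qPoch (a q : ℝ) (n : ℕ) : ℝ := ∏ i ∈ Finset.range n, (1 - a * q ^ i)

/-- The infinite `q`-shifted factorial `(a;q)_∞`. -/
def qPochInf (a q : ℝ) : ℝ := ∏' i : ℕ, (1 - a * q ^ i)

/-- The basic hypergeometric series `₂φ₁(a, b; c; q, z)`. -/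
def phi21 (a b c q z : ℝ) : ℝ :=
  ∑' k : ℕ, qPoch a q k * qPoch b q k / (qPoch c q k * qPoch q q k) * z ^ k

/-- The basic hypergeometric series `₁φ₁(a; b; q, z)`. -/
def phi11 (a b q z : ℝ) : ℝ :=
  ∑' k : ℕ, qPoch a q k / (qPoch b q k * qPoch q q k) * ((-1) ^ k * q ^ (k.choose 2)) * z ^ k

/-! ### `q`-Bessel functions -/

/-- Jackson's third (Hahn-Exton) `q`-Bessel function `J_n(x;q)` for a natural number `n`. -/
def besselJNat (n : ℕ) (x q : ℝ) : ℝ :=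
  x ^ ((n : ℝ) / 2) * (qPochInf (q ^ (n + 1)) q / qPochInf q q) * phi11 0 (q ^ (n + 1)) q (q * x)

/-- The `q`-Bessel function `J_ν(x;q)` of integer order `ν`; for negative order it is defined by
`J_{-n}(x;q) = (-1)^n q^{n/2} J_n(x q^n;q)`. -/
def besselJ (ν : ℤ) (x q : ℝ) : ℝ :=
  if 0 ≤ ν then besselJNat ν.toNat x q
  else (-1) ^ ν.natAbs * q ^ ((ν.natAbs : ℝ) / 2) * besselJNat ν.natAbs (x * q ^ ν.natAbs) q

/-- The multivariate `q`-Bessel function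
`J_ν(x,λ;q) = ∏_{j=1}^d J_{ν_j - x_{j+1} - λ_{j-1}}(q^{x_j - x_{j+1} + λ_j - λ_{j-1}};q)`, where
`ν = (ν_0,…,ν_{d+1})`, `x = (x_1,…,x_d)`, `λ = (λ_1,…,λ_d)`, `λ_0 = ν_0` and `x_{d+1} = ν_{d+1}`. -/
def besselJMulti {d : ℕ} (ν : Fin (d + 2) → ℤ) (x l : Fin d → ℤ) (q : ℝ) : ℝ :=
  let X : Fin (d + 1) → ℤ := Fin.snoc x (ν (Fin.last (d + 1)))
  let L : Fin (d + 1) → ℤ := Fin.cons (ν 0) l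
  ∏ j : Fin d, besselJ (ν j.succ.castSucc - X j.succ - L j.castSucc)
    (q ^ (X j.castSucc - X j.succ + L j.succ - L j.castSucc)) q

/-- The vector `(n_1, x + n_2, …, x + n_{k+1}, n_{k+2})`. -/
def nuVec {k : ℕ} (x : ℤ) (n : Fin (k + 2) → ℤ) : Fin (k + 2) → ℤ := fun i =>
  if i = 0 ∨ i = Fin.last (k + 1) then n i else x + n i

/-! ### Clebsch-Gordan coefficients -/

/-- The Wall polynomial `p_n(q^x;a;q) = ₂φ₁(q^{-n}, 0; aq; q, q^{x+1})`. -/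
def wall (n x : ℕ) (a q : ℝ) : ℝ := phi21 (q ^ (-(n : ℤ))) 0 (a * q) q (q ^ (x + 1))

/-- The normalized Wall functions, orthonormal on `ℕ` as functions of `x` and as functions of
`n`. -/
def wallBar (n x : ℕ) (a q : ℝ) : ℝ :=
  (-1) ^ (n + x) *
    √((a * q) ^ ((x : ℤ) - n) * qPochInf (a * q) q * qPoch (a * q) q n /
      (qPoch q q n * qPoch q q x)) * wall n x a q

/-- The Clebsch-Gordan coefficient `C_{x,m,n}`: the normalized Wall function in base `q²` of
degree `min m n` with parameter `q^{2|n-m|}` at `q^{2x}`, and `0` if one of the labels is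
negative. -/
def clebsch (q : ℝ) (x m n : ℤ) : ℝ :=
  if 0 ≤ x ∧ 0 ≤ m ∧ 0 ≤ n then
    wallBar (min m n).toNat x.toNat ((q ^ 2) ^ (n - m).natAbs) (q ^ 2)
  else 0

/-! ### Coupled eigenvectors

A vector of the `d`-fold tensor product `ℓ²(ℕ)^{⊗ d} = ℓ²(ℕ^d)` is given by its coordinates, a
function of `m : Fin d → ℕ`. A family of vectors `f y p`, with `p : ℤ` and level `y` (where
`f y p = 0` if `y < 0`), stands for vectors on which the generators of the quantum algebra act as
on `e_{y,p}^{12}`: `α f_{y,p} = √(1-q^{2y}) f_{y-1,p}`, `β f_{y,p} = -q^{y+1} f_{y,p+1}`,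
`γ f_{y,p} = q^y f_{y,p-1}`, `δ f_{y,p} = √(1-q^{2y+2}) f_{y+1,p}`. -/

/-- `e_{x,p}^{12} = ∑_{n-m=p} C_{x,m,n} e_m ⊗ e_n`. -/
def pairVec (q : ℝ) (x p : ℤ) (m : Fin 2 → ℕ) : ℝ :=
  if (m 1 : ℤ) - m 0 = p then clebsch q x (m 0) (m 1) else 0

/-- The coupling `∑_n C_{x,n,n+p} e_n ⊗ f_{n+p,x-n-r}`; for `f = e^{23}` this is
`e_{x,p,r}^{1(23)}`. -/
def coupleLeft (q : ℝ) {d : ℕ} (r : ℤ) (f : ℤ → ℤ → (Fin d → ℕ) → ℝ) (x p : ℤ)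
    (m : Fin (d + 1) → ℕ) : ℝ :=
  clebsch q x (m 0) (m 0 + p) * f (m 0 + p) (x - m 0 - r) (Fin.tail m)

/-- The coupling `∑_k C_{x,k-p,k} f_{k-p,r-x+k} ⊗ e_k`; for `f = e^{12}` this is
`e_{x,p,r}^{(12)3}`. -/
def coupleRight (q : ℝ) {d : ℕ} (r : ℤ) (f : ℤ → ℤ → (Fin d → ℕ) → ℝ) (x p : ℤ)
    (m : Fin (d + 1) → ℕ) : ℝ :=
  clebsch q x (m (Fin.last d) - p) (m (Fin.last d)) *
    f (m (Fin.last d) - p) (r - x + m (Fin.last d)) (Fin.init m)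

/-! ### Binary trees

To a binary tree whose nodes carry integer labels belongs the label `p` of its root, the label of
the right child of the root minus the label of its left child. A leaf `n₁` coupled on the left with
a subtree with label `p'` to a tree with root `x` is `coupleLeft` with `r = x - n₁ - p'`; a subtree
with label `p'` coupled on the right with a leaf `n` is `coupleRight` with `r = p' + x - n`. (For
three leaves `n₁, n₂, n₃` both give `r = x - n₁ + n₂ - n₃`.) -/

/-- The label `p = r_1 - n_1` (with `r_{k+1} = n_{k+2}`) of a tree with leaves `n` and inner nodes
`r` on the right edge. -/
def rightLabel {k : ℕ} (r : Fin k → ℤ) (n : Fin (k + 2) → ℤ) : ℤ :=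
  (Fin.snoc r (n (Fin.last (k + 1))) : Fin (k + 1) → ℤ) 0 - n 0

/-- The label `p = n_{k+2} - s_k` (with `s_0 = n_1`) of a tree with leaves `n` and inner nodes `s`
on the left edge. -/
def leftLabel {k : ℕ} (s : Fin k → ℤ) (n : Fin (k + 2) → ℤ) : ℤ :=
  n (Fin.last (k + 1)) - (Fin.cons (n 0) s : Fin (k + 1) → ℤ) (Fin.last k)

/-- The family of the tree with root `x`, leaves `n_1,…,n_{k+2}` and inner nodes `r_1,…,r_k` on the
right edge, from the root downwards: `x` has children `n_1, r_1`; `r_j` has children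
`n_{j+1}, r_{j+1}`; `r_k` has children `n_{k+1}, n_{k+2}`. -/
def rightFamily (q : ℝ) : (k : ℕ) → ℤ → (Fin k → ℤ) → (Fin (k + 2) → ℤ) →
    ℤ → ℤ → (Fin (k + 2) → ℕ) → ℝ
  | 0, _, _, _ => pairVec q
  | k + 1, x, r, n =>
      coupleLeft q (x - n 0 - rightLabel (Fin.tail r) (Fin.tail n))
        (rightFamily q k (r 0) (Fin.tail r) (Fin.tail n))

/-- The family of the tree with root `x`, leaves `n_1,…,n_{k+2}` and inner nodes `s_1,…,s_k` on the
left edge, from the bottom upwards: `s_1` has children `n_1, n_2`; `s_j` has children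
`s_{j-1}, n_{j+1}`; `x` has children `s_k, n_{k+2}`. -/
def leftFamily (q : ℝ) : (k : ℕ) → ℤ → (Fin k → ℤ) → (Fin (k + 2) → ℤ) →
    ℤ → ℤ → (Fin (k + 2) → ℕ) → ℝ
  | 0, _, _, _ => pairVec q
  | k + 1, x, s, n =>
      coupleRight q (leftLabel (Fin.init s) (Fin.init n) + x - n (Fin.last (k + 2)))
        (leftFamily q k (s (Fin.last k)) (Fin.init s) (Fin.init n))

/-- The vector of the right tree with root `x`, leaves `n` and inner nodes `r`, at level `y`. -/
def rightTree (q : ℝ) {k : ℕ} (x : ℤ) (r : Fin k → ℤ) (n : Fin (k + 2) → ℤ) (y : ℤ) :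
    (Fin (k + 2) → ℕ) → ℝ :=
  rightFamily q k x r n y (rightLabel r n)

/-- The vector of the left tree with root `x`, leaves `n` and inner nodes `s`, at level `y`. -/
def leftTree (q : ℝ) {k : ℕ} (x : ℤ) (s : Fin k → ℤ) (n : Fin (k + 2) → ℤ) (y : ℤ) :
    (Fin (k + 2) → ℕ) → ℝ :=
  leftFamily q k x s n y (leftLabel s n)

/-- The vector, at level `y`, of the tree whose root `x` has as left child the leaf `n_1` and as
right child the left tree with root `r_k`, leaves `n_2,…,n_{k+2}` and inner nodes
`r_1,…,r_{k-1}`. -/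
def mixedTree (q : ℝ) {k : ℕ} (x : ℤ) (r : Fin (k + 1) → ℤ) (n : Fin (k + 3) → ℤ) (y : ℤ) :
    (Fin (k + 3) → ℕ) → ℝ :=
  coupleLeft q (x - n 0 - leftLabel (Fin.init r) (Fin.tail n))
    (leftFamily q k (r (Fin.last k)) (Fin.init r) (Fin.tail n)) y (r (Fin.last k) - n 0)

/-- The inner product of `ℓ²(ℕ^d)`, for vectors with real coordinates. -/
def coupling {d : ℕ} (v w : (Fin d → ℕ) → ℝ) : ℝ := ∑' m : Fin d → ℕ, v m * w m

/-- The `3nj`-symbol `R_{r,s}^{x,n}`: the coupling coefficient between the right tree and the left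
tree. The coupling coefficients are the same at all levels `y ∈ ℕ`. For `x ≥ 0` the level is the
root label `x`, as it should be; for `x < 0`, where the vectors of level `x` vanish, the symbol is
the common value, taken at level `0`. -/
def symbolR (q : ℝ) {k : ℕ} (x : ℤ) (n : Fin (k + 2) → ℤ) (r s : Fin k → ℤ) : ℝ :=
  coupling (rightTree q x r n (max x 0)) (leftTree q x s n (max x 0))

/-- The `3nj`-symbol `S_{r,s}^{x,n}`: the coupling coefficient between the mixed tree and the left
tree, with the same convention for the level. -/
def symbolS (q : ℝ) {k : ℕ} (x : ℤ) (n : Fin (k + 3) → ℤ) (r s : Fin (k + 1) → ℤ) : ℝ :=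
  coupling (mixedTree q x r n (max x 0)) (leftTree q x s n (max x 0))

/-- The coefficient of the expansion of `k`-variable `q`-Bessel functions, `k = d + 2`:
`(-q^{1/2})^{|t|+|s|-|n|-(k-2)n_1-s_k+r_2+t_{k-1}}
  ∏_{j=1}^k J_{s_{j+1}-n_1+t_{j-1}-n_{j+2}}(q^{s_j+t_j-n_1-n_{j+2}};q)`
with `t = (t_1,…,t_{k-1})`, `t_0 = n_2`, `t_k = r_1`, `s_{k+1} = x`. -/
def coeffA (q : ℝ) {d : ℕ} (x : ℤ) (n : Fin (d + 4) → ℤ) (r s : Fin (d + 2) → ℤ)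
    (t : Fin (d + 1) → ℤ) : ℝ :=
  let T : Fin (d + 3) → ℤ := Fin.cons (n 1) (Fin.snoc t (r 0) : Fin (d + 2) → ℤ)
  let S : Fin (d + 3) → ℤ := Fin.snoc s x
  (-√q) ^ ((∑ i, t i) + (∑ i, s i) - (∑ i, n i) - d * n 0 - s (Fin.last (d + 1)) + r 1
      + t (Fin.last d)) *
    ∏ j : Fin (d + 2), besselJ (S j.succ - n 0 + T j.castSucc - n j.succ.succ)
      (q ^ (S j.castSucc + T j.succ - n 0 - n j.succ.succ)) q

end

end QBessel

/-! Both symbols are finite products of one-variable functions, and the two expansions are one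
identity between such products. The building block is `recCoeff q r u`, that is
$(-q)^uJ_r(q^{2u};q^2)$; `symbolS_eq` and `symbolR_eq` give $S$ as `prodS` and $R$ as `prodR`, and
`hasSum_prodS_mul_prodR` is the identity. The first sum is this identity in base $q$; the second is
the same identity at $\sqrt q$, after a power of $-\sqrt q$ is divided out.

The analysis rests on a sum `cgSum` symmetric in three integers, which is the Clebsch–Gordan
coefficient up to normalization (`clebsch_eq_cg`). Its contiguous relations are proved by
telescoping. They yield orthonormality in the summed pair of labels (`hasSum_cg_mul_cg`) and the
star-triangle relation (`hasSum_cg_star`): a sum over an inner triangle of three coefficients is one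
coefficient times a factor `recSum`. When all three labels tend to infinity together, the
coefficient converges to `recSum`, and, computed from its reduced form, to a $q$-Bessel function;
hence `recSum` is `recCoeff`. The same limit turns orthonormality into $\sum_u$ `recCoeff q r u ^ 2`
$=1$, and the star-triangle relation into the pentagon relation `hasSum_recCoeff_pentagon`.

For trees, a Wigner–Eckart argument is used. The inner product of a subtree vector with a slice of a
larger left tree is a Clebsch–Gordan coefficient times a reduced element; coupling a further leaf on
the right multiplies the reduced element by one `recCoeff`, by the star-triangle relation. This
gives the product for $S$. Since the squares of these products sum to 1 over the inner nodes, a left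
tree is the sum of its projections on the orthonormal mixed trees. Pairing with a right tree leaves
only the mixed trees with $t_k=r_1$, and induction gives the product for $R$, provided that the
products themselves satisfy the expansion. That is an induction on the number of nodes: the
innermost sum is a pentagon relation, and the rest is the identity for the tree in which the last
two leaves are replaced by their parent. -/

open Filter Topology

namespace QBessel

noncomputable section

variable {q : ℝ}

/-! ### The `q²`-factorial on the integers -/

/-- `(q²;q²)_n`, extended by `1` to negative `n`. -/
def qFac (q : ℝ) (n : ℤ) : ℝ := qPoch (q ^ 2) (q ^ 2) n.toNat

/-- `1/(q²;q²)_n`, which is `0` for negative `n`. -/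
def qFacInv (q : ℝ) (n : ℤ) : ℝ := if 0 ≤ n then (qFac q n)⁻¹ else 0

/-- `(q²;q²)_∞`. -/
def qFacInf (q : ℝ) : ℝ := qPochInf (q ^ 2) (q ^ 2)


lemma qPoch_succ (a q : ℝ) (n : ℕ) : qPoch a q (n + 1) = qPoch a q n * (1 - a * q ^ n) :=
  Finset.prod_range_succ _ _

lemma qPoch_zero (a q : ℝ) : qPoch a q 0 = 1 := rfl

lemma one_sub_pos_of_pow (h0 : 0 < q) (h1 : q < 1) (n : ℕ) : 0 < 1 - q ^ 2 * (q ^ 2) ^ n := by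
  have : q ^ 2 * (q ^ 2) ^ n = q ^ (2 * n + 2) := by ring
  rw [this]
  have := pow_lt_one₀ h0.le h1 (n := 2 * n + 2) (by omega)
  linarith

lemma qFac_pos (h0 : 0 < q) (h1 : q < 1) (n : ℤ) : 0 < qFac q n := by
  unfold qFac qPoch
  exact Finset.prod_pos fun i _ => one_sub_pos_of_pow h0 h1 i

lemma qFac_zero : qFac q 0 = 1 := rfl

lemma qFac_add_one {n : ℤ} (hn : 0 ≤ n) : qFac q (n + 1) = (1 - (q ^ (n + 1)) ^ 2) * qFac q n := by
  lift n to ℕ using hn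
  have h1 : ((n : ℤ) + 1).toNat = n + 1 := by omega
  have h2 : (n : ℤ).toNat = n := by omega
  rw [qFac, qFac, h1, h2, qPoch_succ, mul_comm]
  congr 2
  norm_cast
  ring

lemma qFac_eq {n : ℤ} (hn : 1 ≤ n) : qFac q n = (1 - (q ^ n) ^ 2) * qFac q (n - 1) := by
  have := qFac_add_one (q := q) (n := n - 1) (by omega)
  simpa using this

lemma qFacInv_of_neg {n : ℤ} (hn : n < 0) : qFacInv q n = 0 := by simp [qFacInv, hn]

lemma qFacInv_of_nonneg {n : ℤ} (hn : 0 ≤ n) : qFacInv q n = (qFac q n)⁻¹ := by simp [qFacInv, hn]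

lemma qFacInv_zero : qFacInv q 0 = 1 := by simp [qFacInv, qFac_zero]

lemma qFacInv_nonneg (h0 : 0 < q) (h1 : q < 1) (n : ℤ) : 0 ≤ qFacInv q n := by
  unfold qFacInv
  split_ifs
  · exact (inv_pos.2 (qFac_pos h0 h1 n)).le
  · exact le_rfl

lemma qFac_mul_qFacInv (h0 : 0 < q) (h1 : q < 1) {n : ℤ} (hn : 0 ≤ n) :
    qFac q n * qFacInv q n = 1 := by
  rw [qFacInv_of_nonneg hn, mul_inv_cancel₀ (qFac_pos h0 h1 n).ne']

lemma one_sub_sq_pos (h0 : 0 < q) (h1 : q < 1) {n : ℤ} (hn : 1 ≤ n) : 0 < 1 - (q ^ n) ^ 2 := by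
  have h : q ^ n < 1 := zpow_lt_one₀ h0 h1 (by omega)
  have h' : 0 < q ^ n := zpow_pos h0 n
  nlinarith

/-- This holds at every integer, since at $n=0$ the factor $1-q^{2n}$ vanishes. Sums can therefore
run over all of $\mathbb Z$ and be telescoped termwise without boundary cases. -/
lemma qFacInv_sub_one (h0 : 0 < q) (h1 : q < 1) (n : ℤ) :
    qFacInv q (n - 1) = (1 - (q ^ n) ^ 2) * qFacInv q n := by
  rcases lt_trichotomy n 0 with h | h | h
  · rw [qFacInv_of_neg h, qFacInv_of_neg (by omega), mul_zero]
  · subst h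
    simp [qFacInv_of_neg]
  · rw [qFacInv_of_nonneg (by omega), qFacInv_of_nonneg (by omega), qFac_eq (n := n) (by omega)]
    have := (one_sub_sq_pos h0 h1 (n := n) (by omega)).ne'
    have := (qFac_pos h0 h1 (n - 1)).ne'
    field_simp

lemma summable_sq_pow (h0 : 0 < q) (h1 : q < 1) : Summable fun n : ℕ => q ^ 2 * (q ^ 2) ^ n :=
  (summable_geometric_of_lt_one (by positivity) (by nlinarith)).mul_left _

lemma tendsto_qFac (h0 : 0 < q) (h1 : q < 1) :
    Tendsto (fun n : ℕ => qPoch (q ^ 2) (q ^ 2) n) atTop (𝓝 (qFacInf q)) := by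
  have hm : Multipliable fun n : ℕ => 1 + -(q ^ 2 * (q ^ 2) ^ n) :=
    Real.multipliable_one_add_of_summable (summable_sq_pow h0 h1).neg
  have := hm.tendsto_prod_tprod_nat
  simpa only [qPoch, qFacInf, qPochInf, sub_eq_add_neg] using this

lemma qFacInf_ne_zero (h0 : 0 < q) (h1 : q < 1) : qFacInf q ≠ 0 := by
  have := tprod_one_add_ne_zero_of_summable (f := fun n : ℕ => -(q ^ 2 * (q ^ 2) ^ n))
    (fun n => by have := one_sub_pos_of_pow h0 h1 n; rw [← sub_eq_add_neg]; exact this.ne')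
    (by simpa using (summable_sq_pow h0 h1).norm)
  simpa only [qFacInf, qPochInf, sub_eq_add_neg] using this

lemma qFacInf_le (h0 : 0 < q) (h1 : q < 1) (n : ℤ) : qFacInf q ≤ qFac q n := by
  refine (antitone_nat_of_succ_le fun n => ?_).le_of_tendsto (tendsto_qFac h0 h1) n.toNat
  rw [qPoch_succ]
  have h : 0 < qPoch (q ^ 2) (q ^ 2) n := Finset.prod_pos fun i _ => one_sub_pos_of_pow h0 h1 i
  have : 0 ≤ q ^ 2 * (q ^ 2) ^ n := by positivity
  nlinarith

lemma qFacInf_pos (h0 : 0 < q) (h1 : q < 1) : 0 < qFacInf q := by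
  refine lt_of_le_of_ne ?_ (qFacInf_ne_zero h0 h1).symm
  exact ge_of_tendsto' (tendsto_qFac h0 h1) fun n =>
    Finset.prod_nonneg fun i _ => (one_sub_pos_of_pow h0 h1 i).le

lemma qFac_le_one (h0 : 0 < q) (h1 : q < 1) (n : ℤ) : qFac q n ≤ 1 := by
  unfold qFac qPoch
  exact Finset.prod_le_one (fun i _ => (one_sub_pos_of_pow h0 h1 i).le) fun i _ => by
    have : 0 ≤ q ^ 2 * (q ^ 2) ^ i := by positivity
    linarith

lemma qFacInv_le (h0 : 0 < q) (h1 : q < 1) (n : ℤ) : qFacInv q n ≤ (qFacInf q)⁻¹ := by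
  unfold qFacInv
  split_ifs
  · exact inv_anti₀ (qFacInf_pos h0 h1) (qFacInf_le h0 h1 n)
  · exact (inv_pos.2 (qFacInf_pos h0 h1)).le

lemma tendsto_add_natCast_atTop (a : ℤ) : Tendsto (fun N : ℕ => a + (N : ℤ)) atTop atTop :=
  tendsto_atTop_add_const_left _ _ tendsto_natCast_atTop_atTop

lemma tendsto_qFac_int (h0 : 0 < q) (h1 : q < 1) :
    Tendsto (fun n : ℤ => qFac q n) atTop (𝓝 (qFacInf q)) :=
  (tendsto_qFac h0 h1).comp (tendsto_atTop.2 fun b => by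
    filter_upwards [eventually_ge_atTop (b : ℤ)] with n hn
    omega)

lemma tendsto_qFacInv (h0 : 0 < q) (h1 : q < 1) :
    Tendsto (fun n : ℤ => qFacInv q n) atTop (𝓝 (qFacInf q)⁻¹) := by
  refine ((tendsto_qFac_int h0 h1).inv₀ (qFacInf_ne_zero h0 h1)).congr' ?_
  filter_upwards [eventually_ge_atTop 0] with n hn
  rw [qFacInv_of_nonneg hn]

/-! ### Sums over the integers -/

lemma summable_of_zero_outside {f : ℤ → ℝ} (a b : ℤ) (hf : ∀ t, t < a ∨ b < t → f t = 0) :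
    Summable f := by
  refine summable_of_ne_finset_zero (s := Finset.Icc a b) fun t ht => hf t ?_
  simp only [Finset.mem_Icc, not_and_or, not_le] at ht
  exact ht

lemma tsum_shift (f : ℤ → ℝ) (k : ℤ) : ∑' t, f (t + k) = ∑' t, f t :=
  (Equiv.addRight k).tsum_eq f

lemma summable_shift {f : ℤ → ℝ} (hf : Summable f) (k : ℤ) : Summable fun t => f (t + k) :=
  (Equiv.addRight k).summable_iff.2 hf

/-! ### The symmetric form of the Clebsch-Gordan coefficients -/

/-- The summand of `cgSum`. -/
def cgTerm (q : ℝ) (x m n i : ℤ) : ℝ :=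
  (-q) ^ (-i) * q ^ ((x - i) * (m - i) + (x - i) * (n - i) + (m - i) * (n - i)) *
    (qFacInv q i * qFacInv q (x - i) * qFacInv q (m - i) * qFacInv q (n - i))

/-- The symmetric function of three integers that is a Clebsch-Gordan coefficient up to a simple
factor. -/
def cgSum (q : ℝ) (x m n : ℤ) : ℝ := ∑' i : ℤ, cgTerm q x m n i

lemma cgTerm_swap (q : ℝ) (x m n i : ℤ) : cgTerm q x n m i = cgTerm q x m n i := by
  unfold cgTerm
  rw [show (x - i) * (n - i) + (x - i) * (m - i) + (n - i) * (m - i)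
    = (x - i) * (m - i) + (x - i) * (n - i) + (m - i) * (n - i) by ring]
  ring

lemma cgTerm_swap' (q : ℝ) (x m n i : ℤ) : cgTerm q m x n i = cgTerm q x m n i := by
  unfold cgTerm
  rw [show (m - i) * (x - i) + (m - i) * (n - i) + (x - i) * (n - i)
    = (x - i) * (m - i) + (x - i) * (n - i) + (m - i) * (n - i) by ring]
  ring

lemma cgSum_swap (q : ℝ) (x m n : ℤ) : cgSum q x n m = cgSum q x m n :=
  tsum_congr fun i => cgTerm_swap q x m n i

lemma cgSum_swap' (q : ℝ) (x m n : ℤ) : cgSum q m x n = cgSum q x m n :=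
  tsum_congr fun i => cgTerm_swap' q x m n i

lemma cgTerm_of_neg (q : ℝ) (x m n : ℤ) {i : ℤ} (hi : i < 0) : cgTerm q x m n i = 0 := by
  simp [cgTerm, qFacInv_of_neg hi]

lemma cgTerm_of_lt (q : ℝ) {x m n i : ℤ} (hi : x < i ∨ m < i ∨ n < i) :
    cgTerm q x m n i = 0 := by
  unfold cgTerm
  rcases hi with h | h | h
  · simp [qFacInv_of_neg (q := q) (n := x - i) (by omega)]
  · simp [qFacInv_of_neg (q := q) (n := m - i) (by omega)]
  · simp [qFacInv_of_neg (q := q) (n := n - i) (by omega)]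

lemma summable_cgTerm (q : ℝ) (x m n : ℤ) : Summable (cgTerm q x m n) :=
  summable_of_zero_outside 0 x fun _ ht => ht.elim (cgTerm_of_neg q x m n)
    fun h => cgTerm_of_lt q (Or.inl h)

lemma cgSum_of_neg (q : ℝ) {x m n : ℤ} (h : x < 0 ∨ m < 0 ∨ n < 0) : cgSum q x m n = 0 := by
  unfold cgSum
  rw [show cgTerm q x m n = fun _ => 0 from funext fun i => ?_, tsum_zero]
  by_cases hi : i < 0
  · exact cgTerm_of_neg q x m n hi
  · exact cgTerm_of_lt q (by omega)

lemma cgSum_zero_left (q : ℝ) (m n : ℤ) :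
    cgSum q 0 m n = q ^ (m * n) * (qFacInv q m * qFacInv q n) := by
  unfold cgSum
  rw [tsum_eq_single 0]
  · simp [cgTerm, qFacInv_zero]
  · intro i hi
    rcases lt_or_gt_of_ne hi with h | h
    · exact cgTerm_of_neg q 0 m n h
    · exact cgTerm_of_lt q (Or.inl h)

/-- The contiguous relation that raises the last argument and lowers the middle one. -/
lemma cgSum_contiguous (h0 : 0 < q) (h1 : q < 1) (x m n : ℤ) :
    q ^ m * (1 - (q ^ (n + 1)) ^ 2) * cgSum q x m (n + 1) + q ^ n * cgSum q x (m - 1) n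
      = q ^ x * cgSum q x m n := by
  -- Telescoping certificate: the summand at $(x,m,n+1)$ with $1/(q^2;q^2)_{i-1}$ in place of
  -- $1/(q^2;q^2)_i$, times $q^{m+2(n+1-i)}$. Once the shifted `qFacInv` are expanded, all terms
  -- share a common factor and the identity is rational in the powers of $q$.
  set H : ℤ → ℝ := fun i => q ^ m * (q ^ (n + 1 - i)) ^ 2 * ((-q) ^ (-i) *
    q ^ ((x - i) * (m - i) + (x - i) * (n + 1 - i) + (m - i) * (n + 1 - i)) *
    (qFacInv q (i - 1) * qFacInv q (x - i) * qFacInv q (m - i) * qFacInv q (n + 1 - i))) with hH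
  have hterm : ∀ i, q ^ m * (1 - (q ^ (n + 1)) ^ 2) * cgTerm q x m (n + 1) i
      + q ^ n * cgTerm q x (m - 1) n i - q ^ x * cgTerm q x m n i = H i - H (i + 1) := by
    intro i
    obtain ⟨a, rfl⟩ : ∃ a, x = a + i := ⟨x - i, by ring⟩
    obtain ⟨b, rfl⟩ : ∃ b, m = b + i := ⟨m - i, by ring⟩
    obtain ⟨c, rfl⟩ : ∃ c, n = c + i := ⟨n - i, by ring⟩
    simp only [hH, cgTerm]
    have hq : q ≠ 0 := h0.ne'
    have hnq : -q ≠ 0 := neg_ne_zero.2 hq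
    rw [show a + i - i = a by ring, show b + i - i = b by ring, show c + i - i = c by ring,
      show c + i + 1 - i = c + 1 by ring, show b + i - 1 - i = b - 1 by ring,
      show a + i - (i + 1) = a - 1 by ring, show b + i - (i + 1) = b - 1 by ring,
      show c + i + 1 - (i + 1) = c by ring, show i + 1 - 1 = i by ring]
    rw [qFacInv_sub_one h0 h1 i, qFacInv_sub_one h0 h1 a, qFacInv_sub_one h0 h1 b]
    have hc := qFacInv_sub_one h0 h1 (c + 1)
    rw [show c + 1 - 1 = c by ring] at hc
    rw [hc]
    rw [show a * b + a * (c + 1) + b * (c + 1) = (a * b + a * c + b * c) + a + b by ring,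
      show a * (b - 1) + a * c + (b - 1) * c = (a * b + a * c + b * c) - a - c by ring,
      show (a - 1) * (b - 1) + (a - 1) * c + (b - 1) * c
        = (a * b + a * c + b * c) - a - b - c - c + 1 by ring,
      show -(i + 1) = -i - 1 by ring, show c + i + 1 = c + 1 + i by ring]
    generalize a * b + a * c + b * c = e
    simp only [zpow_add₀ hq, zpow_sub₀ hq, zpow_sub₀ hnq, zpow_one]
    have hA := zpow_ne_zero a hq
    have hB := zpow_ne_zero b hq
    have hC := zpow_ne_zero c hq
    generalize q ^ a = A at *
    generalize q ^ b = B at *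
    generalize q ^ c = C at *
    generalize q ^ i = I at *
    generalize q ^ e = E at *
    generalize (-q) ^ (-i) = S at *
    field_simp
    ring
  have hHs : Summable H := summable_of_zero_outside 1 x fun t ht => by
    rcases ht with h | h
    · simp [hH, qFacInv_of_neg (q := q) (n := t - 1) (by omega)]
    · simp [hH, qFacInv_of_neg (q := q) (n := x - t) (by omega)]
  have h1' := (summable_cgTerm q x m (n + 1)).mul_left (q ^ m * (1 - (q ^ (n + 1)) ^ 2))
  have h2' := (summable_cgTerm q x (m - 1) n).mul_left (q ^ n)
  have h3' := (summable_cgTerm q x m n).mul_left (q ^ x)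
  have key := tsum_congr (L := .unconditional ℤ) hterm
  rw [hHs.tsum_sub (summable_shift hHs 1), tsum_shift H 1, sub_self,
    (h1'.add h2').tsum_sub h3', h1'.tsum_add h2', tsum_mul_left, tsum_mul_left,
    tsum_mul_left] at key
  exact sub_eq_zero.1 key

/-- Uniqueness of the solution of a contiguous relation with given boundary values. -/
lemma eq_of_contiguous (a b : ℤ → ℤ → ℝ) (ha : ∀ m n, 0 ≤ n → a m n ≠ 0) (w : ℝ)
    {f g : ℤ → ℤ → ℝ}
    (hf : ∀ m n, 0 ≤ m → 0 ≤ n → a m n * f m (n + 1) + b m n * f (m - 1) n = w * f m n)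
    (hg : ∀ m n, 0 ≤ m → 0 ≤ n → a m n * g m (n + 1) + b m n * g (m - 1) n = w * g m n)
    (hneg : ∀ n, f (-1) n = g (-1) n) (hbd : ∀ m, 0 ≤ m → f m 0 = g m 0)
    {m n : ℤ} (hm : 0 ≤ m) (hn : 0 ≤ n) : f m n = g m n := by
  lift n to ℕ using hn
  -- The relation determines the value at $(m,n+1)$ from those at $(m,n)$ and $(m-1,n)$; for $m=0$
  -- the latter is the prescribed value at $m=-1$.
  induction n generalizing m with
  | zero => exact hbd m hm
  | succ n ih =>
    have e1 := hf m n hm (by omega)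
    have e2 := hg m n hm (by omega)
    rw [ih hm] at e1
    have e3 : f (m - 1) n = g (m - 1) n := by
      rcases hm.eq_or_lt with h | h
      · subst h
        simpa using hneg n
      · exact ih (by omega)
    rw [e3] at e1
    push_cast
    refine mul_left_cancel₀ (ha m n (by omega)) ?_
    linarith

/-! ### The reduced form -/

/-- The summand of `cgRed`. -/
def cgRedTerm (q : ℝ) (x m n l : ℤ) : ℝ :=
  (-1) ^ l * q ^ (l * l - l - 2 * x * l) * (qFacInv q l * qFacInv q (m - l) * qFacInv q (n - l))

/-- A single terminating `₂φ₁`-form of `cgSum`. -/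
def cgRed (q : ℝ) (x m n : ℤ) : ℝ :=
  qFacInv q x * q ^ (n * x + m * x - n * m) * ∑' l : ℤ, cgRedTerm q x m n l

lemma cgRedTerm_of_lt (q : ℝ) {x m n l : ℤ} (h : l < 0 ∨ m < l ∨ n < l) :
    cgRedTerm q x m n l = 0 := by
  unfold cgRedTerm
  rcases h with h | h | h
  · simp [qFacInv_of_neg h]
  · simp [qFacInv_of_neg (q := q) (n := m - l) (by omega)]
  · simp [qFacInv_of_neg (q := q) (n := n - l) (by omega)]

lemma summable_cgRedTerm (q : ℝ) (x m n : ℤ) : Summable (cgRedTerm q x m n) :=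
  summable_of_zero_outside 0 m fun _ ht => cgRedTerm_of_lt q (by omega)

lemma cgRed_contiguous (h0 : 0 < q) (h1 : q < 1) (x m n : ℤ) :
    q ^ m * (1 - (q ^ (n + 1)) ^ 2) * cgRed q x m (n + 1) + q ^ n * cgRed q x (m - 1) n
      = q ^ x * cgRed q x m n := by
  have hq : q ≠ 0 := h0.ne'
  set H : ℤ → ℝ := fun l => (q ^ (n + 1 - l)) ^ 2 * ((-1) ^ l * q ^ (l * l - l - 2 * x * l) *
    (qFacInv q (l - 1) * qFacInv q (m - l) * qFacInv q (n + 1 - l))) with hH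
  -- This is the relation for the bare sums: the prefactors of `cgRed` have been cancelled and are
  -- restored at the end.
  have hterm : ∀ l, (1 - (q ^ (n + 1)) ^ 2) * cgRedTerm q x m (n + 1) l
      + (q ^ n) ^ 2 * (q ^ x)⁻¹ ^ 2 * cgRedTerm q x (m - 1) n l - cgRedTerm q x m n l
        = H l - H (l + 1) := by
    intro l
    obtain ⟨b, rfl⟩ : ∃ b, m = b + l := ⟨m - l, by ring⟩
    obtain ⟨c, rfl⟩ : ∃ c, n = c + l := ⟨n - l, by ring⟩
    simp only [hH, cgRedTerm]
    rw [show b + l - l = b by ring, show c + l - l = c by ring,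
      show c + l + 1 - l = c + 1 by ring, show b + l - 1 - l = b - 1 by ring,
      show b + l - (l + 1) = b - 1 by ring,
      show c + l + 1 - (l + 1) = c by ring, show l + 1 - 1 = l by ring]
    rw [qFacInv_sub_one h0 h1 l, qFacInv_sub_one h0 h1 b]
    have hc := qFacInv_sub_one h0 h1 (c + 1)
    rw [show c + 1 - 1 = c by ring] at hc
    rw [hc]
    rw [show (l + 1) * (l + 1) - (l + 1) - 2 * x * (l + 1)
        = (l * l - l - 2 * x * l) + l + l - x - x by ring, show c + l + 1 = c + 1 + l by ring]
    generalize l * l - l - 2 * x * l = e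
    simp only [zpow_add₀ hq, zpow_sub₀ hq, zpow_add₀ (show (-1 : ℝ) ≠ 0 by norm_num), zpow_one]
    have hX := zpow_ne_zero x hq
    generalize q ^ x = X at *
    generalize q ^ c = C at *
    generalize q ^ l = L at *
    generalize q ^ e = E at *
    generalize (-1 : ℝ) ^ l = S at *
    field_simp
    ring
  have hHs : Summable H := summable_of_zero_outside 1 m fun t ht => by
    rcases ht with h | h
    · simp [hH, qFacInv_of_neg (q := q) (n := t - 1) (by omega)]
    · simp [hH, qFacInv_of_neg (q := q) (n := m - t) (by omega)]
  have h1' := (summable_cgRedTerm q x m (n + 1)).mul_left (1 - (q ^ (n + 1)) ^ 2)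
  have h2' := (summable_cgRedTerm q x (m - 1) n).mul_left ((q ^ n) ^ 2 * (q ^ x)⁻¹ ^ 2)
  have h3' := summable_cgRedTerm q x m n
  have key := tsum_congr (L := .unconditional ℤ) hterm
  rw [hHs.tsum_sub (summable_shift hHs 1), tsum_shift H 1, sub_self,
    (h1'.add h2').tsum_sub h3', h1'.tsum_add h2', tsum_mul_left, tsum_mul_left] at key
  simp only [cgRed]
  rw [show (n + 1) * x + m * x - (n + 1) * m = (n * x + m * x - n * m) + x - m by ring,
    show n * x + (m - 1) * x - n * (m - 1) = (n * x + m * x - n * m) - x + n by ring]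
  generalize n * x + m * x - n * m = e
  simp only [zpow_add₀ hq, zpow_sub₀ hq] at key ⊢
  have hX := zpow_ne_zero x hq
  have hM := zpow_ne_zero m hq
  rw [show q ^ m * (1 - (q ^ n * q ^ (1 : ℤ)) ^ 2) * (qFacInv q x * (q ^ e * q ^ x / q ^ m) *
      ∑' l, cgRedTerm q x m (n + 1) l) = qFacInv q x * q ^ e * q ^ x *
      ((1 - (q ^ n * q ^ (1 : ℤ)) ^ 2) * ∑' l, cgRedTerm q x m (n + 1) l) by field_simp,
    show (1 - (q ^ n * q ^ (1 : ℤ)) ^ 2) * ∑' l, cgRedTerm q x m (n + 1) l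
      = ∑' l, cgRedTerm q x m n l
        - (q ^ n) ^ 2 * (q ^ x)⁻¹ ^ 2 * ∑' l, cgRedTerm q x (m - 1) n l by linarith]
  field_simp
  ring

lemma cgRed_zero_right (q : ℝ) (x m : ℤ) :
    cgRed q x m 0 = q ^ (m * x) * (qFacInv q x * qFacInv q m) := by
  unfold cgRed
  rw [tsum_eq_single 0]
  · simp [cgRedTerm, qFacInv_zero]
    ring
  · intro i hi
    exact cgRedTerm_of_lt q (by omega)

lemma cgRed_of_neg (q : ℝ) (x n : ℤ) {m : ℤ} (hm : m < 0) : cgRed q x m n = 0 := by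
  unfold cgRed
  rw [show cgRedTerm q x m n = fun _ => 0 from funext fun i => cgRedTerm_of_lt q (by omega),
    tsum_zero, mul_zero]

/-- Both sides satisfy the same contiguous relation in $(m,n)$ and agree at $m=-1$ and at $n=0$. The
symmetric form serves orthogonality and the star-triangle relation; the reduced form connects to
Wall polynomials and to the ${}_1\varphi_1$ of the limit. -/
lemma cgSum_eq_cgRed (h0 : 0 < q) (h1 : q < 1) (x : ℤ) {m n : ℤ} (hm : 0 ≤ m) (hn : 0 ≤ n) :
    cgSum q x m n = cgRed q x m n := by
  refine eq_of_contiguous (fun m n => q ^ m * (1 - (q ^ (n + 1)) ^ 2)) (fun _ n => q ^ n)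
    (fun m n hn => mul_ne_zero (zpow_ne_zero _ h0.ne') (one_sub_sq_pos h0 h1 (by omega)).ne')
    (q ^ x) (f := cgSum q x) (g := cgRed q x)
    (fun m n _ _ => cgSum_contiguous h0 h1 x m n) (fun m n _ _ => cgRed_contiguous h0 h1 x m n)
    (fun n => ?_) (fun m _ => ?_) hm hn
  · rw [cgSum_of_neg q (by omega), cgRed_of_neg q x n (by omega)]
  · rw [cgRed_zero_right, cgSum_swap, cgSum_swap', cgSum_zero_left, mul_comm x m]

/-! ### Further contiguous relations -/

lemma cgSum_contiguous_left (h0 : 0 < q) (h1 : q < 1) (x m n : ℤ) :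
    q ^ x * (1 - (q ^ (n + 1)) ^ 2) * cgSum q x m (n + 1) + q ^ n * cgSum q (x - 1) m n
      = q ^ m * cgSum q x m n := by
  have := cgSum_contiguous h0 h1 m x n
  rwa [cgSum_swap' q x m, cgSum_swap' q (x - 1) m, cgSum_swap' q x m] at this

lemma cgSum_contiguous_raise_left (h0 : 0 < q) (h1 : q < 1) (x m n : ℤ) :
    q ^ n * (1 - (q ^ (x + 1)) ^ 2) * cgSum q (x + 1) m n + q ^ x * cgSum q x m (n - 1)
      = q ^ m * cgSum q x m n := by
  have := cgSum_contiguous_left h0 h1 n m x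
  have e : ∀ a b c, cgSum q a b c = cgSum q c b a := fun a b c => by
    rw [← cgSum_swap' q a b c, ← cgSum_swap q b a c, cgSum_swap' q c b a]
  rwa [e n m (x + 1), e (n - 1) m x, e n m x] at this

/-- The relation that expresses the action of the raising operator. -/
lemma cgSum_raise (h0 : 0 < q) (h1 : q < 1) (x m n : ℤ) :
    cgSum q x (m - 1) (n - 1) =
      q ^ (m + n + 1) * cgSum q x m n - q * (1 - (q ^ (x + 1)) ^ 2) * cgSum q (x + 1) m n := by
  have hq : q ≠ 0 := h0.ne'
  -- Two contiguous relations share the value at $(x,m,n-1)$; eliminating it gives the claim.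
  have e1 := cgSum_contiguous h0 h1 x m (n - 1)
  have e2 := cgSum_contiguous_raise_left h0 h1 x m n
  rw [show n - 1 + 1 = n by ring] at e1
  simp only [zpow_add₀ hq, zpow_sub₀ hq, zpow_one] at e1 e2 ⊢
  have hX := zpow_ne_zero x hq
  have hN := zpow_ne_zero n hq
  have hM := zpow_ne_zero m hq
  field_simp at e1 e2 ⊢
  have e3 : q ^ n * cgSum q x (m - 1) (n - 1) = q * (q ^ x * cgSum q x m (n - 1))
      - q * q ^ m * (1 - (q ^ n) ^ 2) * cgSum q x m n := by linear_combination e1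
  have e4 : q ^ x * cgSum q x m (n - 1) = q ^ m * cgSum q x m n
      - q ^ n * (1 - (q ^ x * q) ^ 2) * cgSum q (x + 1) m n := by linear_combination e2
  rw [e4] at e3
  refine mul_left_cancel₀ hN ?_
  linear_combination e3

/-- The relation that expresses the action of the lowering operator. -/
lemma cgSum_lower (h0 : 0 < q) (h1 : q < 1) (x m n : ℤ) :
    cgSum q (x - 1) m n = q ^ (m + n + 2) * cgSum q x m n -
      q * (1 - (q ^ (m + 1)) ^ 2) * (1 - (q ^ (n + 1)) ^ 2) * cgSum q x (m + 1) (n + 1) := by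
  have hq : q ≠ 0 := h0.ne'
  have e1 := cgSum_contiguous h0 h1 x (m + 1) n
  have e2 := cgSum_contiguous_left h0 h1 x n m
  rw [cgSum_swap q x (m + 1) n, cgSum_swap q (x - 1) m n, cgSum_swap q x m n] at e2
  rw [show m + 1 - 1 = m by ring] at e1
  simp only [zpow_add₀ hq, zpow_one] at e1 e2 ⊢
  rw [show q ^ (2 : ℤ) = q * q by rw [show (2 : ℤ) = 1 + 1 by norm_num, zpow_add₀ hq, zpow_one]]
  have hX := zpow_ne_zero x hq
  have hN := zpow_ne_zero n hq
  have hM := zpow_ne_zero m hq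
  refine mul_left_cancel₀ hM ?_
  have e3 : (1 - (q ^ m * q) ^ 2) * (q ^ m * q * (1 - (q ^ n * q) ^ 2) * cgSum q x (m + 1) (n + 1)
      + q ^ n * cgSum q x m n) = q ^ x * (1 - (q ^ m * q) ^ 2) * cgSum q x (m + 1) n := by
    rw [e1]; ring
  linear_combination e2 + e3

/-! ### Summability and dominated convergence over the integers -/

lemma summable_zpow_abs (h0 : 0 < q) (h1 : q < 1) (a : ℤ) :
    Summable fun t : ℤ => q ^ |t + a| := by
  have h : Summable fun t : ℤ => q ^ |t| := by
    refine Summable.of_nat_of_neg ?_ ?_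
    · simpa using summable_geometric_of_lt_one h0.le h1
    · simpa using summable_geometric_of_lt_one h0.le h1
  exact summable_shift h a

lemma hasSum_of_eq {ι : Type*} {f g : ι → ℝ} {a b : ℝ} (h : HasSum f a) (hfg : ∀ t, g t = f t)
    (hab : a = b) : HasSum g b := by
  rw [show g = f from funext hfg, ← hab]
  exact h

lemma summable_of_abs_le (h0 : 0 < q) (h1 : q < 1) {f : ℤ → ℝ} (c : ℝ) (a : ℤ)
    (hf : ∀ t, |f t| ≤ c * q ^ |t + a|) : Summable f :=
  Summable.of_norm_bounded ((summable_zpow_abs h0 h1 a).mul_left c) hf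

lemma tendsto_tsum_int (h0 : 0 < q) (h1 : q < 1) {f : ℕ → ℤ → ℝ} {g : ℤ → ℝ} (c : ℝ) (a : ℤ)
    (hf : ∀ N t, |f N t| ≤ c * q ^ |t + a|) (hlim : ∀ t, Tendsto (fun N => f N t) atTop (𝓝 (g t))) :
    Tendsto (fun N => ∑' t, f N t) atTop (𝓝 (∑' t, g t)) :=
  tendsto_tsum_of_dominated_convergence ((summable_zpow_abs h0 h1 a).mul_left c) hlim
    (Eventually.of_forall hf)

lemma zpow_anti (h0 : 0 < q) (h1 : q < 1) {a b : ℤ} (h : a ≤ b) : q ^ b ≤ q ^ a :=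
  zpow_le_zpow_right_of_le_one₀ h0 h1.le h

lemma zpow_le_one_of_nonneg (h0 : 0 < q) (h1 : q < 1) {a : ℤ} (h : 0 ≤ a) : q ^ a ≤ 1 := by
  simpa using zpow_anti h0 h1 h

/-! ### The q-Vandermonde and Cauchy identities -/

/-- The difference of the two summands telescopes. Iterated, this reduces the $q$-Vandermonde sum to
$A=0$, where one term survives. -/
lemma tsum_vandermonde_step (h0 : 0 < q) (h1 : q < 1) (A B : ℤ) :
    (1 - (q ^ A) ^ 2) * ∑' t : ℤ, (q ^ ((A + t) * (B + t))) ^ 2 *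
        (qFacInv q (A + t) * qFacInv q (B + t) * qFacInv q (-t))
      = ∑' t : ℤ, (q ^ ((A - 1 + t) * (B + t))) ^ 2 *
        (qFacInv q (A - 1 + t) * qFacInv q (B + t) * qFacInv q (-t)) := by
  have hq : q ≠ 0 := h0.ne'
  set H : ℤ → ℝ := fun t => (q ^ (A + t)) ^ 2 * (q ^ ((A + t) * (B + t))) ^ 2 *
    (qFacInv q (A + t) * qFacInv q (B + t) * qFacInv q (-t - 1)) with hH
  have hs : ∀ A B : ℤ, Summable fun t : ℤ => (q ^ ((A + t) * (B + t))) ^ 2 *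
        (qFacInv q (A + t) * qFacInv q (B + t) * qFacInv q (-t)) := fun A B =>
    summable_of_zero_outside (-A) 0 fun t ht => by
      rcases ht with h | h
      · simp [qFacInv_of_neg (q := q) (n := A + t) (by omega)]
      · simp [qFacInv_of_neg (q := q) (n := -t) (by omega)]
  have hHs : Summable H := summable_of_zero_outside (-A) 0 fun t ht => by
    rcases ht with h | h
    · simp [hH, qFacInv_of_neg (q := q) (n := A + t) (by omega)]
    · simp [hH, qFacInv_of_neg (q := q) (n := -t - 1) (by omega)]
  have hterm : ∀ t, (1 - (q ^ A) ^ 2) * ((q ^ ((A + t) * (B + t))) ^ 2 *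
        (qFacInv q (A + t) * qFacInv q (B + t) * qFacInv q (-t)))
      - (q ^ ((A - 1 + t) * (B + t))) ^ 2 *
        (qFacInv q (A - 1 + t) * qFacInv q (B + t) * qFacInv q (-t)) = H t - H (t + -1) := by
    intro t
    obtain ⟨a, rfl⟩ : ∃ a, A = a - t := ⟨A + t, by ring⟩
    obtain ⟨b, rfl⟩ : ∃ b, B = b - t := ⟨B + t, by ring⟩
    simp only [hH]
    rw [show a - t + t = a by ring, show b - t + t = b by ring, show a - t - 1 + t = a - 1 by ring,
      show a - t + (t + -1) = a - 1 by ring, show b - t + (t + -1) = b - 1 by ring,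
      show -(t + -1) - 1 = -t by ring]
    rw [qFacInv_sub_one h0 h1 a, qFacInv_sub_one h0 h1 b, qFacInv_sub_one h0 h1 (-t)]
    rw [show (a - 1) * b = a * b - b by ring, show (a - 1) * (b - 1) = a * b - a - b + 1 by ring]
    generalize a * b = e
    simp only [zpow_add₀ hq, zpow_sub₀ hq, zpow_neg, zpow_one]
    have hA := zpow_ne_zero a hq
    have hB := zpow_ne_zero b hq
    have hT := zpow_ne_zero t hq
    generalize q ^ a = A at *
    generalize q ^ b = B at *
    generalize q ^ t = T at *
    generalize q ^ e = E at *
    field_simp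
    ring
  have key := tsum_congr (L := .unconditional ℤ) hterm
  rw [hHs.tsum_sub (summable_shift hHs (-1)), tsum_shift H (-1), sub_self,
    ((hs A B).mul_left _).tsum_sub (hs (A - 1) B), tsum_mul_left] at key
  exact sub_eq_zero.1 key

/-- The `q`-Vandermonde identity. -/
lemma tsum_vandermonde (h0 : 0 < q) (h1 : q < 1) (A B : ℤ) :
    ∑' t : ℤ, (q ^ ((A + t) * (B + t))) ^ 2 *
        (qFacInv q (A + t) * qFacInv q (B + t) * qFacInv q (-t)) = qFacInv q A * qFacInv q B := by
  rcases lt_or_ge A 0 with hA | hA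
  · rw [qFacInv_of_neg hA, zero_mul]
    convert tsum_zero (α := ℝ) (β := ℤ) using 1
    refine tsum_congr fun t => ?_
    by_cases ht : 0 < t
    · simp [qFacInv_of_neg (q := q) (n := -t) (by omega)]
    · simp [qFacInv_of_neg (q := q) (n := A + t) (by omega)]
  · lift A to ℕ using hA
    induction A with
    | zero =>
      rw [tsum_eq_single 0]
      · simp [qFacInv_zero]
      · intro t ht
        rcases lt_or_gt_of_ne ht with h | h
        · simp [qFacInv_of_neg h]
        · simp [qFacInv_of_neg (q := q) (n := -t) (by omega)]
    | succ A ih =>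
      have h := tsum_vandermonde_step h0 h1 ((A + 1 : ℕ) : ℤ) B
      rw [show (((A + 1 : ℕ) : ℤ)) - 1 = A by push_cast; ring, ih] at h
      have h2 := qFacInv_sub_one h0 h1 ((A + 1 : ℕ) : ℤ)
      rw [show (((A + 1 : ℕ) : ℤ)) - 1 = A by push_cast; ring] at h2
      rw [h2, mul_assoc] at h
      exact mul_left_cancel₀ (one_sub_sq_pos h0 h1 (by push_cast; omega)).ne' h

/-- Cauchy's identity. -/
lemma hasSum_cauchy (h0 : 0 < q) (h1 : q < 1) (A B : ℤ) :
    HasSum (fun t : ℤ => (q ^ ((A + t) * (B + t))) ^ 2 * (qFacInv q (A + t) * qFacInv q (B + t)))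
      (qFacInf q)⁻¹ := by
  set K := (qFacInf q)⁻¹
  have hK : 0 < K := inv_pos.2 (qFacInf_pos h0 h1)
  have hb : ∀ t : ℤ, |(q ^ ((A + t) * (B + t))) ^ 2 * (qFacInv q (A + t) * qFacInv q (B + t))|
      ≤ K * K * q ^ |t + min A B| := by
    intro t
    by_cases h : 0 ≤ A + t ∧ 0 ≤ B + t
    · have n1 := qFacInv_nonneg h0 h1 (A + t)
      have n2 := qFacInv_nonneg h0 h1 (B + t)
      rw [abs_of_nonneg (by positivity), mul_comm]
      have e1 : |t + min A B| ≤ 2 * ((A + t) * (B + t)) := by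
        rw [abs_of_nonneg (by omega)]
        rcases le_total A B with h' | h'
        · rw [min_eq_left h']; nlinarith [mul_nonneg h.1 h.2]
        · rw [min_eq_right h']; nlinarith [mul_nonneg h.1 h.2]
      have e2 : (q ^ ((A + t) * (B + t))) ^ 2 = q ^ (2 * ((A + t) * (B + t))) := by
        rw [two_mul, zpow_add₀ h0.ne', sq]
      rw [e2]
      exact mul_le_mul (mul_le_mul (qFacInv_le h0 h1 _) (qFacInv_le h0 h1 _) n2 hK.le)
        (zpow_anti h0 h1 e1) (by positivity) (by positivity)
    · have : qFacInv q (A + t) * qFacInv q (B + t) = 0 := by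
        rcases not_and_or.1 h with h | h
        · rw [qFacInv_of_neg (by omega), zero_mul]
        · rw [qFacInv_of_neg (n := B + t) (by omega), mul_zero]
      rw [this]
      simp only [mul_zero, abs_zero]
      positivity
  have hsum := summable_of_abs_le h0 h1 _ _ hb
  -- With $A,B$ replaced by $A+N,B+N$ and $t$ shifted by $N$, the $q$-Vandermonde sum has the extra
  -- weight $1/(q^2;q^2)_{N-t}\to K$. As $N\to\infty$ the left side tends to $K$ times the wanted
  -- sum, the right side to $K^2$.
  have hlim := tendsto_tsum_int h0 h1 (f := fun N t => (q ^ ((A + t) * (B + t))) ^ 2 *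
    (qFacInv q (A + t) * qFacInv q (B + t)) * qFacInv q (-t + (N : ℤ)))
    (g := fun t => (q ^ ((A + t) * (B + t))) ^ 2 * (qFacInv q (A + t) * qFacInv q (B + t)) * K)
    (K * K * K) (min A B) (fun N t => by
      rw [abs_mul]
      calc _ ≤ (K * K * q ^ |t + min A B|) * K := by
            gcongr
            · exact hb t
            · rw [abs_of_nonneg (qFacInv_nonneg h0 h1 _)]
              exact qFacInv_le h0 h1 _
        _ = _ := by ring)
    (fun t => ((tendsto_qFacInv h0 h1).comp (tendsto_add_natCast_atTop (-t))).const_mul _)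
  have heq : ∀ N : ℕ, ∑' t : ℤ, (q ^ ((A + t) * (B + t))) ^ 2 *
      (qFacInv q (A + t) * qFacInv q (B + t)) * qFacInv q (-t + (N : ℤ))
      = qFacInv q (A + N) * qFacInv q (B + N) := by
    intro N
    rw [← tsum_vandermonde h0 h1, ← tsum_shift _ (N : ℤ)]
    refine tsum_congr fun t => ?_
    rw [show A + (t + (N : ℤ)) = A + N + t by ring, show B + (t + (N : ℤ)) = B + N + t by ring,
      show -(t + (N : ℤ)) + N = -t by ring]
    ring
  simp_rw [heq] at hlim
  have hlim2 := ((tendsto_qFacInv h0 h1).comp (tendsto_add_natCast_atTop A)).mul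
    ((tendsto_qFacInv h0 h1).comp (tendsto_add_natCast_atTop B))
  have := tendsto_nhds_unique hlim hlim2
  rw [tsum_mul_right] at this
  have := mul_right_cancel₀ hK.ne' this
  have h := hsum.hasSum
  rwa [this] at h

/-! ### The normalized coefficients -/

/-- The Clebsch-Gordan coefficient in symmetric form. -/
def cg (q : ℝ) (x m n : ℤ) : ℝ :=
  (-q) ^ x * (√(qFacInf q) * √(qFac q x) * √(qFac q m) * √(qFac q n)) * cgSum q x m n

lemma cg_of_neg (q : ℝ) {x m n : ℤ} (h : x < 0 ∨ m < 0 ∨ n < 0) : cg q x m n = 0 := by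
  rw [cg, cgSum_of_neg q h, mul_zero]

lemma cg_swap (q : ℝ) (x m n : ℤ) : cg q x n m = cg q x m n := by
  rw [cg, cg, cgSum_swap]
  ring

/-- A constant that bounds the Clebsch-Gordan coefficients. -/
def cgBound (q : ℝ) : ℝ := (qFacInf q)⁻¹ ^ 4 * ∑' t : ℤ, q ^ |t|

lemma cgBound_pos (h0 : 0 < q) (h1 : q < 1) : 0 < cgBound q := by
  have := qFacInf_pos h0 h1
  have h : 0 < ∑' t : ℤ, q ^ |t| :=
    (by simpa using summable_zpow_abs h0 h1 0 : Summable fun t : ℤ => q ^ |t|).tsum_pos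
      (fun t => by positivity) 0 (by positivity)
  unfold cgBound
  positivity

/-- Put $a=x-i$, $b=m-i$, $c=n-i$, all nonnegative in a nonzero term. Since $q^{-i}=q^{-x}q^{a}$,
the remaining exponent is $a+ab+ac+bc$, which is at least $|a-\min(b,c)|+\min(a,b,c)$. -/
lemma abs_cgTerm_le (h0 : 0 < q) (h1 : q < 1) (x m n i : ℤ) :
    |cgTerm q x m n i| ≤ q ^ (-x) * q ^ |x - min m n| *
      ((qFacInf q)⁻¹ ^ 4 * q ^ |min x (min m n) - i|) := by
  have hK : 0 < (qFacInf q)⁻¹ := inv_pos.2 (qFacInf_pos h0 h1)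
  by_cases h : i ≤ x ∧ i ≤ m ∧ i ≤ n
  · obtain ⟨hx, hm, hn⟩ := h
    have key : |x - min m n| + |min x (min m n) - i| ≤
        (x - i) + ((x - i) * (m - i) + (x - i) * (n - i) + (m - i) * (n - i)) := by
      obtain ⟨a, rfl⟩ : ∃ a, x = a + i := ⟨x - i, by ring⟩
      obtain ⟨b, rfl⟩ : ∃ b, m = b + i := ⟨m - i, by ring⟩
      obtain ⟨c, rfl⟩ : ∃ c, n = c + i := ⟨n - i, by ring⟩
      have ha : 0 ≤ a := by omega
      have hb : 0 ≤ b := by omega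
      have hc : 0 ≤ c := by omega
      simp only [add_sub_cancel_right]
      have hab := mul_nonneg ha hb
      have hac := mul_nonneg ha hc
      have hbc := mul_nonneg hb hc
      rcases le_total a (min b c) with h | h
      · have e1 : |a + i - min (b + i) (c + i)| + |min (a + i) (min (b + i) (c + i)) - i|
          = min b c := by
          rw [abs_of_nonpos (by omega), abs_of_nonneg (by omega)]; omega
        rw [e1]
        rcases le_total b c with h' | h'
        · rw [min_eq_left h']; nlinarith
        · rw [min_eq_right h']; nlinarith
      · have e1 : |a + i - min (b + i) (c + i)| + |min (a + i) (min (b + i) (c + i)) - i|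
          = a := by
          rw [abs_of_nonneg (by omega), abs_of_nonneg (by omega)]; omega
        rw [e1]; nlinarith
    have e2 : |cgTerm q x m n i| = q ^ (-x) * q ^ ((x - i) +
        ((x - i) * (m - i) + (x - i) * (n - i) + (m - i) * (n - i))) *
        (qFacInv q i * qFacInv q (x - i) * qFacInv q (m - i) * qFacInv q (n - i)) := by
      have n1 := qFacInv_nonneg h0 h1 i
      have n2 := qFacInv_nonneg h0 h1 (x - i)
      have n3 := qFacInv_nonneg h0 h1 (m - i)
      have n4 := qFacInv_nonneg h0 h1 (n - i)
      unfold cgTerm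
      rw [abs_mul, abs_mul, abs_zpow, abs_neg, abs_of_pos h0,
        abs_of_nonneg (a := _ * _) (by positivity), abs_of_pos (a := q ^ _) (by positivity),
        zpow_add₀ h0.ne' (x - i), ← mul_assoc (q ^ (-x)), ← zpow_add₀ h0.ne' (-x),
        show -x + (x - i) = -i by ring]
    rw [e2]
    have e3 : qFacInv q i * qFacInv q (x - i) * qFacInv q (m - i) * qFacInv q (n - i)
        ≤ (qFacInf q)⁻¹ ^ 4 := by
      have n1 := qFacInv_nonneg h0 h1 i
      have n2 := qFacInv_nonneg h0 h1 (x - i)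
      have n3 := qFacInv_nonneg h0 h1 (m - i)
      have n4 := qFacInv_nonneg h0 h1 (n - i)
      calc _ ≤ (qFacInf q)⁻¹ * (qFacInf q)⁻¹ * (qFacInf q)⁻¹ * (qFacInf q)⁻¹ := by
            gcongr <;> exact qFacInv_le h0 h1 _
        _ = _ := by ring
    calc _ ≤ q ^ (-x) * q ^ (|x - min m n| + |min x (min m n) - i|) * (qFacInf q)⁻¹ ^ 4 := by
          have n1 := qFacInv_nonneg h0 h1 i
          have n2 := qFacInv_nonneg h0 h1 (x - i)
          have n3 := qFacInv_nonneg h0 h1 (m - i)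
          have n4 := qFacInv_nonneg h0 h1 (n - i)
          exact mul_le_mul (mul_le_mul_of_nonneg_left (zpow_anti h0 h1 key) (by positivity)) e3
            (by positivity) (by positivity)
      _ = _ := by rw [zpow_add₀ h0.ne']; ring
  · rw [cgTerm_of_lt q (by omega), abs_zero]
    positivity

lemma abs_cgSum_le (h0 : 0 < q) (h1 : q < 1) (x m n : ℤ) :
    |cgSum q x m n| ≤ q ^ (-x) * (cgBound q * q ^ |x - min m n|) := by
  have hs : Summable fun i : ℤ => q ^ |min x (min m n) - i| := by
    have := summable_zpow_abs h0 h1 (-(min x (min m n)))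
    refine this.congr fun i => ?_
    rw [abs_sub_comm, sub_eq_add_neg]
  have ht : ∑' i : ℤ, q ^ |min x (min m n) - i| = ∑' t : ℤ, q ^ |t| := by
    rw [← tsum_shift (fun t : ℤ => q ^ |t|) (-(min x (min m n)))]
    exact tsum_congr fun i => by rw [abs_sub_comm, sub_eq_add_neg]
  have := tsum_of_norm_bounded (((hs.mul_left ((qFacInf q)⁻¹ ^ 4)).mul_left
    (q ^ (-x) * q ^ |x - min m n|)).hasSum)
    (f := cgTerm q x m n) (abs_cgTerm_le h0 h1 x m n)
  rw [tsum_mul_left, tsum_mul_left, ht] at this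
  refine (show |cgSum q x m n| ≤ _ from this).trans (le_of_eq ?_)
  rw [cgBound]
  ring

/-- The factor $(-q)^x$ absorbs the $q^{-x}$ of `abs_cgSum_le`. The bound depends only on
differences of labels, so it is uniform when all labels are shifted by the same $N$; the limits
below are dominated in this way. -/
lemma abs_cg_le (h0 : 0 < q) (h1 : q < 1) (x m n : ℤ) :
    |cg q x m n| ≤ cgBound q * q ^ |x - min m n| := by
  have hQ : √(qFacInf q) ≤ 1 := Real.sqrt_le_one.2 ((qFacInf_le h0 h1 0).trans (qFac_le_one h0 h1 0))
  have hs : ∀ n, √(qFac q n) ≤ 1 := fun n => Real.sqrt_le_one.2 (qFac_le_one h0 h1 n)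
  have hw : √(qFacInf q) * √(qFac q x) * √(qFac q m) * √(qFac q n) ≤ 1 := by
    calc _ ≤ (1 : ℝ) * 1 * 1 * 1 := by gcongr <;> apply_assumption
      _ = 1 := by norm_num
  rw [cg, abs_mul, abs_mul, abs_zpow, abs_neg, abs_of_pos h0,
    abs_of_nonneg (a := √(qFacInf q) * _ * _ * _) (by positivity)]
  calc _ ≤ q ^ x * 1 * (q ^ (-x) * (cgBound q * q ^ |x - min m n|)) := by
        gcongr
        exact abs_cgSum_le h0 h1 x m n
    _ = _ := by
      rw [zpow_neg]
      field_simp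

lemma abs_cg_le_bound (h0 : 0 < q) (h1 : q < 1) (x m n : ℤ) : |cg q x m n| ≤ cgBound q :=
  (abs_cg_le h0 h1 x m n).trans (mul_le_of_le_one_right (cgBound_pos h0 h1).le
    (zpow_le_one_of_nonneg h0 h1 (abs_nonneg _)))

lemma abs_cg_shift_le (h0 : 0 < q) (h1 : q < 1) (x A B t : ℤ) :
    |cg q x (A + t) (B + t)| ≤ cgBound q * q ^ |t + (min A B - x)| := by
  refine (abs_cg_le h0 h1 _ _ _).trans (le_of_eq ?_)
  rw [abs_sub_comm]
  congr 3
  omega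

lemma abs_cgSum_shift_le (h0 : 0 < q) (h1 : q < 1) (x A B t : ℤ) :
    |cgSum q x (A + t) (B + t)| ≤ q ^ (-x) * cgBound q * q ^ |t + (min A B - x)| := by
  refine (abs_cgSum_le h0 h1 _ _ _).trans (le_of_eq ?_)
  rw [abs_sub_comm, mul_assoc]
  congr 4
  omega

lemma summable_cgSum_mul (h0 : 0 < q) (h1 : q < 1) (x x' A B A' B' : ℤ) {w : ℤ → ℝ}
    (hw : ∀ t, |w t| ≤ 1) :
    Summable fun t => w t * cgSum q x (A + t) (B + t) * cgSum q x' (A' + t) (B' + t) := by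
  have hc := (cgBound_pos h0 h1).le
  refine summable_of_abs_le h0 h1 (1 * (q ^ (-x) * cgBound q) * (q ^ (-x') * cgBound q))
    (min A B - x) fun t => ?_
  rw [abs_mul, abs_mul]
  calc _ ≤ 1 * (q ^ (-x) * cgBound q * q ^ |t + (min A B - x)|) * (q ^ (-x') * cgBound q * 1) := by
        gcongr
        · exact hw t
        · exact abs_cgSum_shift_le h0 h1 _ _ _ _
        · refine (abs_cgSum_shift_le h0 h1 _ _ _ _).trans ?_
          gcongr
          exact zpow_le_one_of_nonneg h0 h1 (abs_nonneg _)
    _ = _ := by ring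

lemma abs_qFac_mul_le (h0 : 0 < q) (h1 : q < 1) (m n : ℤ) : |qFac q m * qFac q n| ≤ 1 := by
  have a := qFac_pos h0 h1 m
  have b := qFac_pos h0 h1 n
  rw [abs_of_pos (by positivity)]
  exact mul_le_one₀ (qFac_le_one h0 h1 m) b.le (qFac_le_one h0 h1 n)

/-- The Gram matrix of the unnormalized coefficients. -/
def cgGram (q : ℝ) (A B x x' : ℤ) : ℝ :=
  ∑' t : ℤ, qFac q (A + t) * qFac q (B + t) * cgSum q x (A + t) (B + t) * cgSum q x' (A + t) (B + t)

lemma cgGram_comm (q : ℝ) (A B x x' : ℤ) : cgGram q A B x x' = cgGram q A B x' x :=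
  tsum_congr fun t => by ring

/-- Raising and lowering are adjoint: `cgSum_raise` in the first factor and `cgSum_lower` in the
second produce the same mixed product `U`, at $t$ and at $t-1$, so the difference of the two sides
telescopes. -/
lemma cgGram_raise (h0 : 0 < q) (h1 : q < 1) (A B x x' : ℤ) :
    q ^ 2 * (1 - (q ^ (x + 1)) ^ 2) * cgGram q A B (x + 1) x' = cgGram q A B x (x' - 1) := by
  have hq : q ≠ 0 := h0.ne'
  set U : ℤ → ℝ := fun t => qFac q (A + 1 + t) * qFac q (B + 1 + t) * cgSum q x (A + t) (B + t) *
    cgSum q x' (A + 1 + t) (B + 1 + t) with hU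
  have hUs : Summable U := summable_cgSum_mul h0 h1 x x' A B (A + 1) (B + 1)
    (fun t => abs_qFac_mul_le h0 h1 _ _)
  have hs : ∀ x x', Summable fun t : ℤ => qFac q (A + t) * qFac q (B + t) *
      cgSum q x (A + t) (B + t) * cgSum q x' (A + t) (B + t) := fun x x' =>
    summable_cgSum_mul h0 h1 x x' A B A B (fun t => abs_qFac_mul_le h0 h1 _ _)
  have hterm : ∀ t, q ^ 2 * (1 - (q ^ (x + 1)) ^ 2) * (qFac q (A + t) * qFac q (B + t) *
      cgSum q (x + 1) (A + t) (B + t) * cgSum q x' (A + t) (B + t))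
      - qFac q (A + t) * qFac q (B + t) * cgSum q x (A + t) (B + t) *
        cgSum q (x' - 1) (A + t) (B + t) = q * U t - q * U (t + -1) := by
    intro t
    simp only [hU]
    rw [show A + 1 + (t + -1) = A + t by ring, show B + 1 + (t + -1) = B + t by ring,
      show A + (t + -1) = A + t - 1 by ring, show B + (t + -1) = B + t - 1 by ring,
      show A + 1 + t = A + t + 1 by ring, show B + 1 + t = B + t + 1 by ring]
    generalize A + t = m
    generalize B + t = n
    rw [cgSum_raise h0 h1 x m n, cgSum_lower h0 h1 x' m n]
    by_cases h : 0 ≤ m ∧ 0 ≤ n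
    · rw [qFac_add_one h.1, qFac_add_one h.2,
        show q ^ (m + n + 2) = q * q ^ (m + n + 1) by
          rw [show m + n + 2 = 1 + (m + n + 1) by ring, zpow_add₀ hq, zpow_one]]
      ring
    · have e : ∀ y, cgSum q y m n = 0 := fun y => cgSum_of_neg q (by omega)
      simp [e]
  have key := tsum_congr (L := .unconditional ℤ) hterm
  rw [(hUs.mul_left q).tsum_sub ((summable_shift hUs (-1)).mul_left q), tsum_mul_left,
    tsum_mul_left, tsum_shift U (-1), sub_self,
    ((hs (x + 1) x').mul_left _).tsum_sub (hs x (x' - 1)), tsum_mul_left] at key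
  exact sub_eq_zero.1 key

lemma cgGram_zero (h0 : 0 < q) (h1 : q < 1) (A B : ℤ) : cgGram q A B 0 0 = (qFacInf q)⁻¹ := by
  rw [← (hasSum_cauchy h0 h1 A B).tsum_eq]
  refine tsum_congr fun t => ?_
  rw [cgSum_zero_left]
  by_cases h : 0 ≤ A + t ∧ 0 ≤ B + t
  · have e1 := qFac_mul_qFacInv h0 h1 h.1
    have e2 := qFac_mul_qFacInv h0 h1 h.2
    linear_combination (q ^ ((A + t) * (B + t))) ^ 2 * (qFacInv q (A + t) * qFacInv q (B + t)) *
      (e1 * qFac q (B + t) * qFacInv q (B + t) + e2)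
  · have : qFacInv q (A + t) * qFacInv q (B + t) = 0 := by
      rcases not_and_or.1 h with h | h
      · rw [qFacInv_of_neg (by omega), zero_mul]
      · rw [qFacInv_of_neg (n := B + t) (by omega), mul_zero]
    rw [this]
    ring

lemma cgGram_neg (q : ℝ) (A B x : ℤ) : cgGram q A B x (-1) = 0 := by
  unfold cgGram
  convert tsum_zero (α := ℝ) (β := ℤ) using 1
  exact tsum_congr fun t => by rw [cgSum_of_neg q (x := -1) (by omega), mul_zero]

/-- `cgGram_raise` lowers both indices together. Off the diagonal one ends at an entry with index
$-1$, which is zero; on the diagonal one ends at the entry $(0,0)$, which is Cauchy's sum. -/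
lemma cgGram_eq (h0 : 0 < q) (h1 : q < 1) (A B : ℤ) (x x' : ℕ) :
    q ^ (2 * x) * qFac q x * qFacInf q * cgGram q A B x x' = if x = x' then 1 else 0 := by
  have hz : ∀ x : ℕ, cgGram q A B (x + 1 : ℕ) 0 = 0 := fun x => by
    have h := cgGram_raise h0 h1 A B x 0
    rw [zero_sub, cgGram_neg] at h
    have : q ^ 2 * (1 - (q ^ ((x : ℤ) + 1)) ^ 2) ≠ 0 :=
      mul_ne_zero (pow_ne_zero _ h0.ne') (one_sub_sq_pos h0 h1 (by omega)).ne'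
    push_cast
    exact (mul_eq_zero.1 h).resolve_left this
  induction x generalizing x' with
  | zero =>
    cases x' with
    | zero =>
      simp only [Nat.cast_zero, cgGram_zero h0 h1, qFac_zero, if_true]
      have := qFacInf_ne_zero h0 h1
      field_simp
      simp
    | succ x' => rw [cgGram_comm, Nat.cast_zero, hz]; simp
  | succ x ih =>
    cases x' with
    | zero => rw [Nat.cast_zero, hz]; simp
    | succ x' =>
      have h := cgGram_raise h0 h1 A B x (x' + 1)
      rw [add_sub_cancel_right] at h
      have h2 := ih x'
      rw [← h] at h2
      push_cast
      rw [qFac_add_one (by omega)]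
      rw [← h2]
      ring

/-- Orthonormality of the Clebsch-Gordan coefficients. -/
lemma hasSum_cg_mul_cg (h0 : 0 < q) (h1 : q < 1) (A B : ℤ) {x x' : ℤ} (hx : 0 ≤ x) (hx' : 0 ≤ x') :
    HasSum (fun t : ℤ => cg q x (A + t) (B + t) * cg q x' (A + t) (B + t))
      (if x = x' then 1 else 0) := by
  lift x to ℕ using hx
  lift x' to ℕ using hx'
  have hs := summable_cgSum_mul h0 h1 x x' A B A B (w := fun t => qFac q (A + t) * qFac q (B + t))
    (fun t => abs_qFac_mul_le h0 h1 _ _)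
  have hp : ∀ n, √(qFac q n) * √(qFac q n) = qFac q n := fun n =>
    Real.mul_self_sqrt (qFac_pos h0 h1 n).le
  have hQ : √(qFacInf q) * √(qFacInf q) = qFacInf q := Real.mul_self_sqrt (qFacInf_pos h0 h1).le
  have h := hs.hasSum.mul_left ((-q) ^ x * (-q) ^ x' * qFacInf q * √(qFac q x) * √(qFac q x'))
  have hg := cgGram_eq h0 h1 A B x x'
  unfold cgGram at hg
  refine hasSum_of_eq h (fun t => ?_) ?_
  · simp only [cg]
    simp only [zpow_natCast]
    calc _ = (-q) ^ x * (-q) ^ x' * (√(qFacInf q) * √(qFacInf q)) * √(qFac q x) * √(qFac q x') *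
          ((√(qFac q (A + t)) * √(qFac q (A + t))) * (√(qFac q (B + t)) * √(qFac q (B + t))) *
          cgSum q x (A + t) (B + t) * cgSum q x' (A + t) (B + t)) := by ring
      _ = _ := by rw [hp, hp, hQ]
  · by_cases hxx : x = x'
    · subst hxx
      rw [if_pos rfl] at hg ⊢
      rw [← hg]
      have : (-q) ^ x * (-q) ^ x = q ^ (2 * x) := by
        rw [← mul_pow, neg_mul_neg, ← sq, pow_mul]
      rw [this]
      linear_combination (q ^ (2 * x) * qFacInf q * ∑' t : ℤ, qFac q (A + t) * qFac q (B + t) *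
        cgSum q x (A + t) (B + t) * cgSum q x (A + t) (B + t)) * hp x
    · rw [if_neg hxx] at hg
      rw [if_neg (by exact_mod_cast hxx)]
      have hne : q ^ (2 * x) * qFac q x * qFacInf q ≠ 0 := by
        have := (qFac_pos h0 h1 x).ne'
        have := qFacInf_ne_zero h0 h1
        have := h0.ne'
        positivity
      rw [(mul_eq_zero.1 hg).resolve_left hne, mul_zero]

/-! ### The star-triangle relation -/

/-- The polynomial normalization of `cgSum`. -/
def cgPoly (q : ℝ) (x m n : ℤ) : ℝ := qFac q x * qFac q m * qFac q n * cgSum q x m n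

lemma cgPoly_of_neg (q : ℝ) {x m n : ℤ} (h : x < 0 ∨ m < 0 ∨ n < 0) : cgPoly q x m n = 0 := by
  rw [cgPoly, cgSum_of_neg q h, mul_zero]

lemma cgPoly_swap (q : ℝ) (x m n : ℤ) : cgPoly q x n m = cgPoly q x m n := by
  rw [cgPoly, cgPoly, cgSum_swap]
  ring

lemma cgPoly_swap' (q : ℝ) (x m n : ℤ) : cgPoly q m x n = cgPoly q x m n := by
  rw [cgPoly, cgPoly, cgSum_swap']
  ring

lemma cgPoly_zero_left (h0 : 0 < q) (h1 : q < 1) {m n : ℤ} (hm : 0 ≤ m) (hn : 0 ≤ n) :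
    cgPoly q 0 m n = q ^ (m * n) := by
  rw [cgPoly, cgSum_zero_left, qFac_zero]
  have e1 := qFac_mul_qFacInv h0 h1 hm
  have e2 := qFac_mul_qFacInv h0 h1 hn
  linear_combination q ^ (m * n) * (e1 * qFac q n * qFacInv q n + e2)

lemma cgPoly_contiguous (h0 : 0 < q) (h1 : q < 1) (x m : ℤ) {n : ℤ} (hn : 0 ≤ n) :
    q ^ m * cgPoly q x m (n + 1) + q ^ n * (1 - (q ^ m) ^ 2) * cgPoly q x (m - 1) n
      = q ^ x * cgPoly q x m n := by
  have h := cgSum_contiguous h0 h1 x m n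
  rcases lt_trichotomy m 0 with hm | hm | hm
  · rw [cgPoly_of_neg q (by omega), cgPoly_of_neg q (by omega), cgPoly_of_neg q (by omega)]
    ring
  · subst hm
    rw [cgSum_of_neg q (m := 0 - 1) (by omega)] at h
    rw [cgPoly_of_neg q (m := 0 - 1) (by omega), cgPoly, cgPoly, qFac_add_one hn]
    linear_combination (qFac q x * qFac q 0 * qFac q n) * h
  · simp only [cgPoly]
    rw [qFac_add_one hn, qFac_eq (n := m) (by omega)]
    linear_combination (qFac q x * ((1 - (q ^ m) ^ 2) * qFac q (m - 1)) * qFac q n) * h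

lemma cgPoly_raise (h0 : 0 < q) (h1 : q < 1) {x : ℤ} (hx : 0 ≤ x) (m n : ℤ) :
    (1 - (q ^ m) ^ 2) * (1 - (q ^ n) ^ 2) * cgPoly q x (m - 1) (n - 1) =
      q ^ (m + n + 1) * cgPoly q x m n - q * cgPoly q (x + 1) m n := by
  have h := cgSum_raise h0 h1 x m n
  by_cases hmn : 1 ≤ m ∧ 1 ≤ n
  · simp only [cgPoly]
    rw [qFac_add_one hx, qFac_eq hmn.1, qFac_eq hmn.2, h]
    ring
  · have e : cgSum q x (m - 1) (n - 1) = 0 := cgSum_of_neg q (by omega)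
    have e' : cgPoly q x (m - 1) (n - 1) = 0 := cgPoly_of_neg q (by omega)
    rw [e] at h
    rw [e', cgPoly, cgPoly, qFac_add_one hx]
    linear_combination (qFac q x * qFac q m * qFac q n) * h

/-- The summand of `starSum`. -/
def starTerm (q : ℝ) (x n y z m k : ℤ) : ℝ :=
  qFacInv q z * qFacInv q m * qFacInv q k *
    (cgPoly q x z k * cgPoly q n z m * cgPoly q y m k)

/-- The sum over the inner triangle in the star-triangle relation. -/
def starSum (q : ℝ) (x n y z m k : ℤ) : ℝ :=
  ∑' t : ℤ, (-q) ^ t * starTerm q x n y (z + t) (m + t) (k + t)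

/-- Termwise form of `starSum_contiguous`. After multiplication by $(-q)^t$ and shifts of the
labels, the last two terms become consecutive values of one function of $t$, the factor $q^{-1}$
coming from $(-q)^{t-1}$. -/
lemma starTerm_telescope (h0 : 0 < q) (h1 : q < 1) (x n : ℤ) {y : ℤ} (hy : 0 ≤ y) (z m k : ℤ) :
    q ^ n * starTerm q x n (y + 1) (z - 1) m k
      - q⁻¹ * (q ^ y * (1 - (q ^ n) ^ 2)) * starTerm q x (n - 1) y (z - 1) (m - 1) k
      = q ^ x * starTerm q x n y z m k
      - qFacInv q z * qFacInv q m * qFacInv q k * q ^ z *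
        (cgPoly q x z (k + 1) * cgPoly q n z m * cgPoly q y m k)
      - q⁻¹ * (qFacInv q (z - 1) * qFacInv q (m - 1) * qFacInv q (k - 1) * q ^ (z - 1) *
        (cgPoly q x (z - 1) k * cgPoly q n (z - 1) (m - 1) * cgPoly q y (m - 1) (k - 1))) := by
  have hq : q ≠ 0 := h0.ne'
  simp only [starTerm]
  rw [qFacInv_sub_one h0 h1 z, qFacInv_sub_one h0 h1 m, qFacInv_sub_one h0 h1 k]
  by_cases hn : 0 ≤ z ∧ 0 ≤ m ∧ 0 ≤ k
  swap
  · have : qFacInv q z * qFacInv q m * qFacInv q k = 0 := by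
      rcases (by omega : z < 0 ∨ m < 0 ∨ k < 0) with h | h | h <;> simp [qFacInv_of_neg h]
    linear_combination
      (q ^ n * ((1 - (q ^ z) ^ 2) * (cgPoly q x (z - 1) k * cgPoly q n (z - 1) m *
        cgPoly q (y + 1) m k)) - q⁻¹ * (q ^ y * (1 - (q ^ n) ^ 2)) * ((1 - (q ^ z) ^ 2) *
        (1 - (q ^ m) ^ 2) * (cgPoly q x (z - 1) k * cgPoly q (n - 1) (z - 1) (m - 1) *
        cgPoly q y (m - 1) k)) - q ^ x * (cgPoly q x z k * cgPoly q n z m * cgPoly q y m k)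
        + q ^ z * (cgPoly q x z (k + 1) * cgPoly q n z m * cgPoly q y m k)
        + q⁻¹ * ((1 - (q ^ z) ^ 2) * (1 - (q ^ m) ^ 2) * (1 - (q ^ k) ^ 2) * q ^ (z - 1) *
        (cgPoly q x (z - 1) k * cgPoly q n (z - 1) (m - 1) * cgPoly q y (m - 1) (k - 1)))) * this
  · obtain ⟨hz, hm, hk⟩ := hn
    have r5 := cgPoly_contiguous h0 h1 x z hk
    rcases hz.eq_or_lt with hz' | hz'
    · subst hz'
      simp only [zpow_zero, one_pow, sub_self, zero_mul, mul_zero] at r5 ⊢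
      linear_combination (qFacInv q 0 * qFacInv q m * qFacInv q k * cgPoly q n 0 m *
        cgPoly q y m k) * r5
    · have r1 := cgPoly_raise h0 h1 (x := z - 1) (by omega) n m
      have r2 := cgPoly_contiguous h0 h1 k m hy
      have r3 := cgPoly_contiguous h0 h1 n m (n := z - 1) (by omega)
      -- The contiguous relation at $m-1$ needs $m\ge1$; the factor $1-q^{2m}$ makes it valid at
      -- $m=0$ too.
      have r4 : (1 - (q ^ m) ^ 2) * (q ^ k * cgPoly q y m k +
          q ^ (m - 1) * (1 - (q ^ k) ^ 2) * cgPoly q y (m - 1) (k - 1)) =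
          (1 - (q ^ m) ^ 2) * (q ^ y * cgPoly q y (m - 1) k) := by
        rcases hm.eq_or_lt with h | h
        · simp [← h]
        · have := cgPoly_contiguous h0 h1 y k (n := m - 1) (by omega)
          rw [sub_add_cancel, cgPoly_swap q y m k, cgPoly_swap q y (m - 1) (k - 1),
            cgPoly_swap q y (m - 1) k] at this
          rw [this]
      have rev : ∀ a b c, cgPoly q a b c = cgPoly q c b a := fun a b c => by
        rw [← cgPoly_swap' q a b c, ← cgPoly_swap q b a c, cgPoly_swap' q c b a]
      rw [sub_add_cancel] at r1 r3
      rw [cgPoly_swap' q (n - 1), cgPoly_swap' q n, cgPoly_swap' q n] at r1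
      rw [rev k m (y + 1), rev k (m - 1) y, rev k m y] at r2
      rw [cgPoly_swap q n z m, cgPoly_swap q n (z - 1) (m - 1), cgPoly_swap q n (z - 1) m] at r3
      have eM : q ^ m = q * q ^ (m - 1) := by rw [← zpow_one_add₀ hq]; congr 1; ring
      have eZ : q ^ z = q * q ^ (z - 1) := by rw [← zpow_one_add₀ hq]; congr 1; ring
      have eNM : q ^ (n + m + 1) = q ^ n * (q * q ^ (m - 1)) * q := by
        rw [← eM, zpow_add₀ hq, zpow_add₀ hq, zpow_one]
      have hM := zpow_ne_zero (m - 1) hq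
      rw [eNM] at r1
      rw [eM] at r1 r2 r3 r4 ⊢
      rw [eZ] at r5 ⊢
      generalize q ^ (m - 1) = M at *
      generalize q ^ (z - 1) = Z at *
      generalize q ^ n = N at *
      generalize q ^ k = K at *
      generalize q ^ x = X at *
      generalize q ^ y = Y at *
      generalize cgPoly q x z k = p1 at *
      generalize cgPoly q x (z - 1) k = p2 at *
      generalize cgPoly q x z (k + 1) = p3 at *
      generalize cgPoly q n z m = p4 at *
      generalize cgPoly q n (z - 1) m = p5 at *
      generalize cgPoly q n (z - 1) (m - 1) = p6 at *
      generalize cgPoly q (n - 1) (z - 1) (m - 1) = p7 at *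
      generalize cgPoly q y m k = p8 at *
      generalize cgPoly q (y + 1) m k = p9 at *
      generalize cgPoly q y (m - 1) k = p10 at *
      generalize cgPoly q y (m - 1) (k - 1) = p11 at *
      refine mul_left_cancel₀ (mul_ne_zero hM hq) ?_
      have hi : q⁻¹ * q = 1 := inv_mul_cancel₀ hq
      -- Here `r1`, `r2`, `r4` and `r5` eliminate `p7`, `p9`, `p11` and `p3`; what remains is a
      -- multiple of `r3`, the relation between `p4`, `p5` and `p6`.
      linear_combination (exp := 1) (qFacInv q z * qFacInv q m * qFacInv q k) *
        (-(Y * p10 * p2 * (1 - (q * Z) ^ 2) * M) * r1 + (1 - (q * Z) ^ 2) * p2 * N * p5 * r2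
        - (1 - (q * Z) ^ 2) * p2 * (K * p8 - Y * p10) * r3
        + (1 - (q * Z) ^ 2) * p2 * Z * p6 * r4 + M * q * p4 * p8 * r5
        + (- M * ((Y * (1 - N ^ 2)) * ((1 - (q * Z) ^ 2) * (1 - (q * M) ^ 2) * (p2 * p7 * p10)))
        + M * ((1 - (q * Z) ^ 2) * (1 - (q * M) ^ 2) * (1 - K ^ 2) * Z * (p2 * p6 * p11))) * hi)

lemma abs_cgPoly_le (h0 : 0 < q) (h1 : q < 1) (x m n : ℤ) :
    |cgPoly q x m n| ≤ q ^ (-x) * cgBound q * q ^ |x - min m n| := by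
  have h := abs_cgSum_le h0 h1 x m n
  have hx := qFac_pos h0 h1 x
  have hm := qFac_pos h0 h1 m
  have hn := qFac_pos h0 h1 n
  rw [cgPoly, abs_mul, abs_of_pos (by positivity), mul_assoc (q ^ (-x))]
  refine le_trans ?_ h
  refine mul_le_of_le_one_left (abs_nonneg _) ?_
  exact mul_le_one₀ (mul_le_one₀ (qFac_le_one h0 h1 x) hm.le (qFac_le_one h0 h1 m)) hn.le
    (qFac_le_one h0 h1 n)

lemma summable_starTerm (h0 : 0 < q) (h1 : q < 1) (x n y a b c d e f : ℤ) {v : ℤ → ℝ} (C : ℝ)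
    (hv : ∀ t, |v t| ≤ C) :
    Summable fun t => v t * (cgPoly q x (a + t) (b + t) * cgPoly q n (c + t) (d + t) *
      cgPoly q y (e + t) (f + t)) := by
  have hc := (cgBound_pos h0 h1).le
  have hC : 0 ≤ C := (abs_nonneg _).trans (hv 0)
  have hb : ∀ n m k, |cgPoly q n m k| ≤ q ^ (-n) * cgBound q := fun n m k =>
    (abs_cgPoly_le h0 h1 n m k).trans (mul_le_of_le_one_right (by positivity)
      (zpow_le_one_of_nonneg h0 h1 (abs_nonneg _)))
  refine summable_of_abs_le h0 h1 (C * (q ^ (-x) * cgBound q * (q ^ (-n) * cgBound q) *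
    (q ^ (-y) * cgBound q))) (min a b - x) fun t => ?_
  rw [abs_mul, abs_mul, abs_mul]
  have h1' : |cgPoly q x (a + t) (b + t)| ≤ q ^ (-x) * cgBound q * q ^ |t + (min a b - x)| := by
    refine (abs_cgPoly_le h0 h1 _ _ _).trans (le_of_eq ?_)
    rw [abs_sub_comm]
    congr 3
    omega
  calc _ ≤ C * (q ^ (-x) * cgBound q * q ^ |t + (min a b - x)| * (q ^ (-n) * cgBound q) *
        (q ^ (-y) * cgBound q)) := by
        gcongr
        · exact hv t
        · exact hb _ _ _
        · exact hb _ _ _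
    _ = _ := by ring

lemma abs_zpow_mul_qFacInv_le (h0 : 0 < q) (h1 : q < 1) (z : ℤ) :
    |(-q) ^ z * qFacInv q z| ≤ (qFacInf q)⁻¹ := by
  have hK : 0 < (qFacInf q)⁻¹ := inv_pos.2 (qFacInf_pos h0 h1)
  rcases lt_or_ge z 0 with h | h
  · rw [qFacInv_of_neg h, mul_zero, abs_zero]
    exact hK.le
  · rw [abs_mul, abs_zpow, abs_neg, abs_of_pos h0, abs_of_nonneg (qFacInv_nonneg h0 h1 z)]
    exact (mul_le_of_le_one_left (qFacInv_nonneg h0 h1 z) (zpow_le_one_of_nonneg h0 h1 h)).trans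
      (qFacInv_le h0 h1 z)

lemma abs_star_weight_le (h0 : 0 < q) (h1 : q < 1) (z m k t : ℤ) :
    |(-q) ^ t * (qFacInv q (z + t) * qFacInv q (m + t) * qFacInv q (k + t))|
      ≤ q ^ (-z) * ((qFacInf q)⁻¹ * (qFacInf q)⁻¹ * (qFacInf q)⁻¹) := by
  have hK : 0 < (qFacInf q)⁻¹ := inv_pos.2 (qFacInf_pos h0 h1)
  have e : (-q) ^ t = (-q) ^ (-z) * (-q) ^ (z + t) := by
    rw [← zpow_add₀ (neg_ne_zero.2 h0.ne')]
    congr 1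
    ring
  have e2 : |(-q) ^ (-z)| = q ^ (-z) := by rw [abs_zpow, abs_neg, abs_of_pos h0]
  have hab : ∀ n, |qFacInv q n| ≤ (qFacInf q)⁻¹ := fun n => by
    rw [abs_of_nonneg (qFacInv_nonneg h0 h1 n)]
    exact qFacInv_le h0 h1 n
  rw [show (-q) ^ t * (qFacInv q (z + t) * qFacInv q (m + t) * qFacInv q (k + t))
    = (-q) ^ (-z) * (((-q) ^ (z + t) * qFacInv q (z + t)) * qFacInv q (m + t) *
      qFacInv q (k + t)) by rw [e]; ring, abs_mul, e2, abs_mul, abs_mul]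
  gcongr
  · exact abs_zpow_mul_qFacInv_le h0 h1 _
  · exact hab _
  · exact hab _

lemma summable_starSum (h0 : 0 < q) (h1 : q < 1) (x n y z m k : ℤ) :
    Summable fun t : ℤ => (-q) ^ t * starTerm q x n y (z + t) (m + t) (k + t) := by
  refine (summable_starTerm h0 h1 x n y z k z m m k _
    (fun t => abs_star_weight_le h0 h1 z m k t)).congr fun t => ?_
  rw [starTerm]
  ring

/-- The sums $x+m$, $n+k$ and $y+z$ are the same in all three terms. With these fixed, it is the
relation of `cgPoly_contiguous` in the outer labels $(n,y)$, so the star sum must be proportional to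
`cgPoly q x n y`. -/
lemma starSum_contiguous (h0 : 0 < q) (h1 : q < 1) (x n : ℤ) {y : ℤ} (hy : 0 ≤ y) (z m k : ℤ) :
    q ^ n * starSum q x n (y + 1) (z - 1) m k
      + q ^ y * (1 - (q ^ n) ^ 2) * starSum q x (n - 1) y z m (k + 1)
      = q ^ x * starSum q x n y z m k := by
  have hq : q ≠ 0 := h0.ne'
  have hnq : -q ≠ 0 := neg_ne_zero.2 hq
  set U : ℤ → ℝ := fun t => (-q) ^ t * (qFacInv q (z + t) * qFacInv q (m + t) * qFacInv q (k + t)) *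
    q ^ (z + t) * (cgPoly q x (z + t) (k + 1 + t) * cgPoly q n (z + t) (m + t) *
      cgPoly q y (m + t) (k + t)) with hU
  have hUs : Summable U := by
    refine summable_starTerm h0 h1 x n y z (k + 1) z m m k
      (q ^ (-z) * ((qFacInf q)⁻¹ * (qFacInf q)⁻¹ * (qFacInf q)⁻¹)) fun t => ?_
    refine le_trans ?_ (abs_star_weight_le h0 h1 z m k t)
    rw [abs_mul]
    rcases lt_or_ge (z + t) 0 with h | h
    · simp [qFacInv_of_neg h]
    · refine mul_le_of_le_one_right (abs_nonneg _) ?_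
      rw [abs_of_pos (zpow_pos h0 _)]
      exact zpow_le_one_of_nonneg h0 h1 h
  have s1 := summable_starSum h0 h1 x n (y + 1) (z - 1) m k
  have s2 := summable_starSum h0 h1 x (n - 1) y z m (k + 1)
  have s3 := summable_starSum h0 h1 x n y z m k
  have hterm : ∀ t, q ^ n * ((-q) ^ t * starTerm q x n (y + 1) (z - 1 + t) (m + t) (k + t))
      + q ^ y * (1 - (q ^ n) ^ 2) * ((-q) ^ (t + -1) *
        starTerm q x (n - 1) y (z + (t + -1)) (m + (t + -1)) (k + 1 + (t + -1)))
      - q ^ x * ((-q) ^ t * starTerm q x n y (z + t) (m + t) (k + t)) = U (t + -1) - U t := by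
    intro t
    have h := starTerm_telescope h0 h1 x n hy (z + t) (m + t) (k + t)
    simp only [hU]
    rw [show z - 1 + t = z + t - 1 by ring, show z + (t + -1) = z + t - 1 by ring,
      show m + (t + -1) = m + t - 1 by ring, show k + 1 + (t + -1) = k + t by ring,
      show k + (t + -1) = k + t - 1 by ring, show k + 1 + t = k + t + 1 by ring,
      zpow_add₀ hnq, zpow_neg, zpow_one, inv_neg]
    linear_combination (-q) ^ t * h
  have key := tsum_congr (L := .unconditional ℤ) hterm
  rw [(summable_shift hUs (-1)).tsum_sub hUs, tsum_shift U (-1), sub_self,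
    ((s1.mul_left _).add ((summable_shift s2 (-1)).mul_left _)).tsum_sub (s3.mul_left _),
    (s1.mul_left _).tsum_add ((summable_shift s2 (-1)).mul_left _), tsum_mul_left, tsum_mul_left,
    tsum_mul_left, tsum_shift (fun t : ℤ => (-q) ^ t * starTerm q x (n - 1) y (z + t) (m + t)
      (k + 1 + t)) (-1)] at key
  exact sub_eq_zero.1 key

lemma starSum_swap (q : ℝ) (x n y z m k : ℤ) : starSum q n x y z k m = starSum q x n y z m k := by
  refine tsum_congr fun t => ?_
  rw [starTerm, starTerm, cgPoly_swap q y (m + t) (k + t)]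
  ring

lemma starSum_swap' (q : ℝ) (x n y z m k : ℤ) : starSum q y n x m z k = starSum q x n y z m k := by
  refine tsum_congr fun t => ?_
  rw [starTerm, starTerm, cgPoly_swap q n (z + t) (m + t)]
  ring

lemma starSum_of_neg (q : ℝ) {x n y : ℤ} (z m k : ℤ) (hn : n < 0) : starSum q x n y z m k = 0 := by
  unfold starSum
  convert tsum_zero (α := ℝ) (β := ℤ) using 1
  refine tsum_congr fun t => ?_
  rw [starTerm, cgPoly_of_neg q (x := n) (by omega)]
  ring

/-- The star-triangle relation for the polynomial normalization. -/
lemma starSum_eq (h0 : 0 < q) (h1 : q < 1) (A B C : ℤ) {x n y : ℤ} (hx : 0 ≤ x) (hn : 0 ≤ n)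
    (hy : 0 ≤ y) :
    starSum q x n y (C - y) (A - x) (B - n) = cgPoly q x n y * starSum q 0 0 0 C A B := by
  have hcont : ∀ (A B C : ℤ) (x n y : ℤ), 0 ≤ y →
      q ^ n * starSum q x n (y + 1) (C - (y + 1)) (A - x) (B - n)
      + q ^ y * (1 - (q ^ n) ^ 2) * starSum q x (n - 1) y (C - y) (A - x) (B - (n - 1))
      = q ^ x * starSum q x n y (C - y) (A - x) (B - n) := by
    intro A B C x n y hy
    have := starSum_contiguous h0 h1 x n hy (C - y) (A - x) (B - n)
    rwa [show C - y - 1 = C - (y + 1) by ring, show B - n + 1 = B - (n - 1) by ring] at this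
  -- Boundary values: with $n=0$ the coefficient $1-q^{2n}$ kills one term and the relation becomes
  -- a two-term recursion. By the symmetries of the star sum it first moves $x$ at $n=y=0$, then $n$
  -- at $y=0$.
  have hbase : ∀ x : ℕ, starSum q x 0 0 C (A - x) B = starSum q 0 0 0 C A B := by
    intro x
    induction x with
    | zero => simp
    | succ x ih =>
      have h := hcont C B A 0 0 x (by omega)
      simp only [zpow_zero, one_pow, sub_self, mul_zero, zero_mul, add_zero, one_mul,
        sub_zero] at h
      rw [starSum_swap' q (x + 1) 0 0 C _ B, starSum_swap' q x 0 0 C _ B] at h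
      push_cast
      rw [h, ih]
  have hbd : ∀ n : ℕ, starSum q x n 0 C (A - x) (B - n) =
      q ^ (x * n) * starSum q 0 0 0 C A B := by
    intro n
    induction n with
    | zero =>
      lift x to ℕ using hx
      simp [hbase]
    | succ n ih =>
      have h := hcont A C B x 0 n (by omega)
      simp only [zpow_zero, one_pow, sub_self, mul_zero, zero_mul, add_zero, one_mul,
        sub_zero] at h
      have e : ∀ n z k, starSum q x 0 n k (A - x) z = starSum q x n 0 z (A - x) k := by
        intro n z k
        rw [← starSum_swap, ← starSum_swap', starSum_swap]
      rw [e, e] at h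
      push_cast
      rw [h, ih, mul_add, mul_one, zpow_add₀ h0.ne']
      ring
  refine eq_of_contiguous (fun n _ => q ^ n) (fun n y => q ^ y * (1 - (q ^ n) ^ 2))
    (fun n y _ => zpow_ne_zero _ h0.ne') (q ^ x)
    (f := fun n y => starSum q x n y (C - y) (A - x) (B - n))
    (g := fun n y => cgPoly q x n y * starSum q 0 0 0 C A B)
    (fun n y _ hy => hcont A B C x n y hy) (fun n y _ hy => ?_) (fun y => ?_) (fun n hn => ?_)
    hn hy
  · have := cgPoly_contiguous h0 h1 x n hy
    linear_combination starSum q 0 0 0 C A B * this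
  · rw [starSum_of_neg q _ _ _ (by omega), cgPoly_of_neg q (by omega), zero_mul]
  · lift n to ℕ using hn
    simp only [sub_zero]
    rw [hbd, cgPoly_swap, cgPoly_swap', cgPoly_zero_left h0 h1 hx (by omega)]

/-- The recoupling coefficient as a bilateral sum. -/
def recSum (q : ℝ) (A B C : ℤ) : ℝ := (-q) ^ C * qFacInf q * starSum q 0 0 0 C A B

/-- The star-triangle relation for the Clebsch-Gordan coefficients. -/
lemma hasSum_cg_star (h0 : 0 < q) (h1 : q < 1) (x n y z m k : ℤ) :
    HasSum (fun t : ℤ => cg q x (z + t) (k + t) * cg q (z + t) n (m + t) * cg q y (m + t) (k + t))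
      (recSum q (x + m) (n + k) (y + z) * cg q x n y) := by
  by_cases hneg : x < 0 ∨ n < 0 ∨ y < 0
  · rw [cg_of_neg q hneg, mul_zero]
    refine hasSum_of_eq hasSum_zero (fun t => ?_) rfl
    rcases hneg with h | h | h
    · rw [cg_of_neg q (x := x) (by omega)]; ring
    · rw [cg_of_neg q (m := n) (by omega)]; ring
    · rw [cg_of_neg q (x := y) (by omega)]; ring
  · have hx : 0 ≤ x := by omega
    have hn : 0 ≤ n := by omega
    have hy : 0 ≤ y := by omega
    have h := starSum_eq h0 h1 (x + m) (n + k) (y + z) hx hn hy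
    rw [show y + z - y = z by ring, show x + m - x = m by ring, show n + k - n = k by ring] at h
    have hs := (summable_starSum h0 h1 x n y z m k).hasSum
    rw [show ∑' t : ℤ, (-q) ^ t * starTerm q x n y (z + t) (m + t) (k + t)
      = starSum q x n y z m k from rfl, h] at hs
    have px := (qFac_pos h0 h1 x).ne'
    have pn := (qFac_pos h0 h1 n).ne'
    have py := (qFac_pos h0 h1 y).ne'
    have hp : ∀ n, √(qFac q n) * √(qFac q n) = qFac q n := fun n =>
      Real.mul_self_sqrt (qFac_pos h0 h1 n).le
    have hQ : √(qFacInf q) * √(qFacInf q) = qFacInf q := Real.mul_self_sqrt (qFacInf_pos h0 h1).le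
    have hnq : -q ≠ 0 := neg_ne_zero.2 h0.ne'
    -- The constant converts the normalization at the outer labels $x,n,y$. Each inner label occurs
    -- in two of the three coefficients, so its square roots pair up to the weight left by
    -- `starTerm`.
    refine hasSum_of_eq (hs.mul_left ((-q) ^ x * (-q) ^ y * (-q) ^ z * qFacInf q * √(qFacInf q) *
      (√(qFac q x) * √(qFac q n) * √(qFac q y)) / (qFac q x * qFac q n * qFac q y)))
      (fun t => ?_) ?_
    · rw [starTerm]
      by_cases hi : 0 ≤ z + t ∧ 0 ≤ m + t ∧ 0 ≤ k + t
      · obtain ⟨hz, hm, hk⟩ := hi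
        rw [qFacInv_of_nonneg hz, qFacInv_of_nonneg hm, qFacInv_of_nonneg hk]
        simp only [cg, cgPoly]
        rw [zpow_add₀ hnq z t]
        have pz := (qFac_pos h0 h1 (z + t)).ne'
        have pm := (qFac_pos h0 h1 (m + t)).ne'
        have pk := (qFac_pos h0 h1 (k + t)).ne'
        have key : ∀ c t X N Y z m k a b d : ℝ, X ≠ 0 → N ≠ 0 → Y ≠ 0 → z ≠ 0 → m ≠ 0 → k ≠ 0 →
          c / (X * N * Y) * (t * (z⁻¹ * m⁻¹ * k⁻¹ * ((X * z * k * a) * (N * z * m * b) *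
            (Y * m * k * d)))) = c * t * (z * m * k) * (a * b * d) := by
          intros; field_simp
        rw [key _ _ _ _ _ _ _ _ _ _ _ px pn py pz pm pk]
        calc _ = (-q) ^ x * (-q) ^ y * (-q) ^ z * (√(qFacInf q) * √(qFacInf q)) * √(qFacInf q) *
              (√(qFac q x) * √(qFac q n) * √(qFac q y)) * (-q) ^ t *
              ((√(qFac q (z + t)) * √(qFac q (z + t))) * (√(qFac q (m + t)) * √(qFac q (m + t))) *
                (√(qFac q (k + t)) * √(qFac q (k + t)))) *
              (cgSum q x (z + t) (k + t) * cgSum q n (z + t) (m + t) *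
                cgSum q y (m + t) (k + t)) := by
              rw [← cgSum_swap' q (z + t) n]; ring
          _ = _ := by rw [hp, hp, hp, hQ]
      · have e : cg q x (z + t) (k + t) * cg q (z + t) n (m + t) = 0 := by
          rcases (by omega : z + t < 0 ∨ m + t < 0 ∨ k + t < 0) with h | h | h
          · rw [cg_of_neg q (x := z + t) (by omega), mul_zero]
          · rw [cg_of_neg q (n := m + t) (by omega), mul_zero]
          · rw [cg_of_neg q (n := k + t) (by omega), zero_mul]
        have e' : qFacInv q (z + t) * qFacInv q (m + t) * qFacInv q (k + t) = 0 := by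
          rcases (by omega : z + t < 0 ∨ m + t < 0 ∨ k + t < 0) with h | h | h <;>
            simp [qFacInv_of_neg h]
        rw [e, e']
        ring
    · rw [recSum, cg, cgPoly, zpow_add₀ hnq]
      rw [div_mul_eq_mul_div, div_eq_iff (mul_ne_zero (mul_ne_zero px pn) py)]
      ring

/-! ### The limit of the Clebsch-Gordan coefficients -/

lemma starTerm_zero (h0 : 0 < q) (h1 : q < 1) (z m k : ℤ) :
    starTerm q 0 0 0 z m k =
      q ^ (z * m + z * k + m * k) * (qFacInv q z * qFacInv q m * qFacInv q k) := by
  rw [starTerm]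
  by_cases hi : 0 ≤ z ∧ 0 ≤ m ∧ 0 ≤ k
  · obtain ⟨hz, hm, hk⟩ := hi
    rw [cgPoly_zero_left h0 h1 hz hk, cgPoly_zero_left h0 h1 hz hm, cgPoly_zero_left h0 h1 hm hk,
      zpow_add₀ h0.ne', zpow_add₀ h0.ne']
    ring
  · have e' : qFacInv q z * qFacInv q m * qFacInv q k = 0 := by
      rcases (by omega : z < 0 ∨ m < 0 ∨ k < 0) with h | h | h <;> simp [qFacInv_of_neg h]
    rw [e']
    ring

lemma tsum_reflect (f : ℤ → ℝ) (N : ℤ) : ∑' t, f (N - t) = ∑' t, f t :=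
  (Equiv.subLeft N).tsum_eq f

lemma tendsto_sqrt_qFac (h0 : 0 < q) (h1 : q < 1) (A : ℤ) :
    Tendsto (fun N : ℕ => √(qFac q (A + N))) atTop (𝓝 √(qFacInf q)) :=
  ((tendsto_qFac_int h0 h1).comp (tendsto_add_natCast_atTop A)).sqrt

lemma tendsto_cg_prefactor (h0 : 0 < q) (h1 : q < 1) (A B C : ℤ) :
    Tendsto (fun N : ℕ => √(qFacInf q) * √(qFac q (C + N)) * √(qFac q (A + N)) *
      √(qFac q (B + N))) atTop (𝓝 (qFacInf q * qFacInf q)) := by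
  have h := (((tendsto_const_nhds (x := √(qFacInf q))).mul (tendsto_sqrt_qFac h0 h1 C)).mul
    (tendsto_sqrt_qFac h0 h1 A)).mul (tendsto_sqrt_qFac h0 h1 B)
  have hQ : √(qFacInf q) * √(qFacInf q) = qFacInf q := Real.mul_self_sqrt (qFacInf_pos h0 h1).le
  rwa [hQ, mul_assoc, hQ] at h

/-- Dominated convergence with the weight `1/(q²;q²)_{N-t}`. -/
lemma tendsto_tsum_qFacInv (h0 : 0 < q) (h1 : q < 1) {f : ℤ → ℝ} (hf : Summable f) :
    Tendsto (fun N : ℕ => ∑' t : ℤ, f t * qFacInv q (-t + (N : ℤ))) atTop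
      (𝓝 ((∑' t, f t) * (qFacInf q)⁻¹)) := by
  rw [← tsum_mul_right]
  refine tendsto_tsum_of_dominated_convergence (hf.norm.mul_right (qFacInf q)⁻¹)
    (fun t => ((tendsto_qFacInv h0 h1).comp (tendsto_add_natCast_atTop (-t))).const_mul _)
    (Eventually.of_forall fun N t => ?_)
  rw [norm_mul]
  refine mul_le_mul_of_nonneg_left ?_ (norm_nonneg _)
  rw [Real.norm_eq_abs, abs_of_nonneg (qFacInv_nonneg h0 h1 _)]
  exact qFacInv_le h0 h1 _

/-- Reversing the summation by $i=N-t$ turns each term of `cgSum` into the star term with outer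
labels $0$, times $1/(q^2;q^2)_{N-t}$, which tends to a constant. -/
lemma tendsto_cg_recSum (h0 : 0 < q) (h1 : q < 1) (A B C : ℤ) :
    Tendsto (fun N : ℕ => cg q (C + N) (A + N) (B + N)) atTop (𝓝 (recSum q A B C)) := by
  have hnq : -q ≠ 0 := neg_ne_zero.2 h0.ne'
  have hQ := qFacInf_ne_zero h0 h1
  have h := (tendsto_cg_prefactor h0 h1 A B C).mul
    ((tendsto_tsum_qFacInv h0 h1 (summable_starSum h0 h1 0 0 0 C A B)).const_mul ((-q) ^ C))
  have e : qFacInf q * qFacInf q * ((-q) ^ C * ((∑' t : ℤ, (-q) ^ t *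
      starTerm q 0 0 0 (C + t) (A + t) (B + t)) * (qFacInf q)⁻¹)) = recSum q A B C := by
    rw [recSum, starSum]
    field_simp
  rw [e] at h
  refine h.congr fun N => ?_
  have e2 : cgSum q (C + N) (A + N) (B + N) = (-q) ^ (-(N : ℤ)) * ∑' t : ℤ, (-q) ^ t *
      starTerm q 0 0 0 (C + t) (A + t) (B + t) * qFacInv q (-t + (N : ℤ)) := by
    rw [cgSum, ← tsum_reflect _ (N : ℤ), ← tsum_mul_left]
    refine tsum_congr fun t => ?_
    rw [starTerm_zero h0 h1, cgTerm, show C + N - (N - t) = C + t by ring,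
      show A + N - (N - t) = A + t by ring, show B + N - (N - t) = B + t by ring,
      show -((N : ℤ) - t) = -N + t by ring, show (N : ℤ) - t = -t + N by ring, zpow_add₀ hnq]
    ring
  rw [cg, e2, zpow_add₀ hnq, zpow_neg]
  have := zpow_ne_zero (N : ℤ) hnq
  field_simp

/-- The summand of the limit of the reduced form. -/
def recTerm (q : ℝ) (A B C s : ℤ) : ℝ :=
  (-1) ^ (C + s) * q ^ (C + C * (A + B) - A * B + s * s + s + 2 * C * s) *
    (qFacInv q (A + s) * qFacInv q (B + s))

lemma summable_recTerm (h0 : 0 < q) (h1 : q < 1) (A B C : ℤ) : Summable (recTerm q A B C) := by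
  have hK : 0 < (qFacInf q)⁻¹ := inv_pos.2 (qFacInf_pos h0 h1)
  refine summable_of_abs_le h0 h1 (q ^ (C + C * (A + B) - A * B - (1 + |C|) ^ 2) *
    ((qFacInf q)⁻¹ * (qFacInf q)⁻¹)) 0 fun s => ?_
  have n1 := qFacInv_nonneg h0 h1 (A + s)
  have n2 := qFacInv_nonneg h0 h1 (B + s)
  have key : C + C * (A + B) - A * B - (1 + |C|) ^ 2 + |s + 0| ≤
      C + C * (A + B) - A * B + s * s + s + 2 * C * s := by
    have hc := abs_nonneg C
    have hc2 : |C| * |C| = C * C := abs_mul_abs_self C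
    have hc3 := neg_abs_le C
    have hc4 := le_abs_self C
    rw [add_zero]
    rcases le_total 0 s with h | h
    · rw [abs_of_nonneg h]
      nlinarith [sq_nonneg (s + C)]
    · rw [abs_of_nonpos h]
      nlinarith [sq_nonneg (s + 1 + C)]
  unfold recTerm
  rw [abs_mul, abs_mul, abs_zpow, abs_neg, abs_one, one_zpow, one_mul,
    abs_of_pos (zpow_pos h0 _), abs_of_nonneg (by positivity)]
  calc _ ≤ q ^ (C + C * (A + B) - A * B - (1 + |C|) ^ 2 + |s + 0|) *
        ((qFacInf q)⁻¹ * (qFacInf q)⁻¹) := by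
        refine mul_le_mul (zpow_anti h0 h1 key) ?_ (by positivity) (by positivity)
        exact mul_le_mul (qFacInv_le h0 h1 _) (qFacInv_le h0 h1 _) n2 hK.le
    _ = _ := by rw [zpow_add₀ h0.ne']; ring

/-- The same sequence as in `tendsto_cg_recSum`, now computed from the reduced form with $l=N-t$.
Comparing the two limits evaluates the bilateral sum `recSum`. -/
lemma tendsto_cg_recTerm (h0 : 0 < q) (h1 : q < 1) (A B C : ℤ) :
    Tendsto (fun N : ℕ => cg q (C + N) (A + N) (B + N)) atTop (𝓝 (∑' s, recTerm q A B C s)) := by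
  have hnq : -q ≠ 0 := neg_ne_zero.2 h0.ne'
  have hQ := qFacInf_ne_zero h0 h1
  have h := ((tendsto_cg_prefactor h0 h1 A B C).mul
    ((tendsto_qFacInv h0 h1).comp (tendsto_add_natCast_atTop C))).mul
    (tendsto_tsum_qFacInv h0 h1 (summable_recTerm h0 h1 A B C))
  have e : qFacInf q * qFacInf q * (qFacInf q)⁻¹ * ((∑' t : ℤ, recTerm q A B C t) *
      (qFacInf q)⁻¹) = ∑' s, recTerm q A B C s := by
    field_simp
  rw [e] at h
  refine h.congr' ?_
  filter_upwards [eventually_ge_atTop (|A| + |B|).toNat] with N hN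
  have hA : 0 ≤ A + N := by have := neg_abs_le A; have := abs_nonneg B; omega
  have hB : 0 ≤ B + N := by have := neg_abs_le B; have := abs_nonneg A; omega
  rw [cg, cgSum_eq_cgRed h0 h1 _ hA hB, cgRed,
    ← tsum_reflect (cgRedTerm q (C + N) (A + N) (B + N)) (N : ℤ)]
  have e2 : (-q) ^ (C + N) * (q ^ ((B + N) * (C + N) + (A + N) * (C + N) - (B + N) * (A + N)) *
      ∑' t : ℤ, cgRedTerm q (C + N) (A + N) (B + N) (N - t)) =
      ∑' t : ℤ, recTerm q A B C t * qFacInv q (-t + (N : ℤ)) := by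
    rw [← tsum_mul_left, ← tsum_mul_left]
    refine tsum_congr fun t => ?_
    rw [cgRedTerm, recTerm, show A + N - (N - t) = A + t by ring,
      show B + N - (N - t) = B + t by ring]
    have e3 : (-q) ^ (C + N) = (-1) ^ (C + N) * q ^ (C + N) := by
      rw [← mul_zpow, neg_one_mul]
    have e4 : (-1 : ℝ) ^ (C + N) * (-1) ^ ((N : ℤ) - t) = (-1) ^ (C + t) := by
      rw [← zpow_add₀ (by norm_num : (-1 : ℝ) ≠ 0),
        show C + N + ((N : ℤ) - t) = C + t + 2 * (N - t) by ring,
        zpow_add₀ (by norm_num : (-1 : ℝ) ≠ 0), zpow_mul]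
      norm_num
    have e5 : q ^ (C + C * (A + B) - A * B + t * t + t + 2 * C * t) = q ^ (C + N) *
        q ^ ((B + N) * (C + N) + (A + N) * (C + N) - (B + N) * (A + N)) *
        q ^ (((N : ℤ) - t) * (N - t) - (N - t) - 2 * (C + N) * (N - t)) := by
      rw [← zpow_add₀ h0.ne', ← zpow_add₀ h0.ne']
      congr 1
      ring
    rw [e3, e5, ← e4, show (N : ℤ) - t = -t + N by ring]
    ring
  rw [← e2]
  simp only [Function.comp]
  ring

/-! ### The recoupling coefficient as a q-Bessel function -/

/-- The recoupling coefficient, a `q`-Bessel function in base `q²`. -/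
def recCoeff (q : ℝ) (r u : ℤ) : ℝ := (-q) ^ u * besselJ r ((q ^ 2) ^ u) (q ^ 2)

lemma qPochInf_shift (h0 : 0 < q) (h1 : q < 1) (D : ℕ) :
    qPochInf ((q ^ 2) ^ (D + 1)) (q ^ 2) = qFacInf q * (qFac q D)⁻¹ := by
  have hm : Multipliable fun n : ℕ => 1 - (q ^ 2) * (q ^ 2) ^ (n + D) := by
    have hs : Summable fun n : ℕ => -(q ^ 2 * (q ^ 2) ^ (n + D)) :=
      ((summable_nat_add_iff D).2 (summable_sq_pow h0 h1)).neg
    simpa only [sub_eq_add_neg] using Real.multipliable_one_add_of_summable hs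
  have h := Multipliable.prod_mul_tprod_nat_mul' (f := fun n : ℕ => 1 - (q ^ 2) * (q ^ 2) ^ n) hm
  rw [eq_mul_inv_iff_mul_eq₀ (qFac_pos h0 h1 D).ne', mul_comm, qFacInf, qPochInf, qPochInf, ← h]
  congr 1
  · refine tprod_congr fun n => ?_
    ring

lemma qPoch_shift (h0 : 0 < q) (h1 : q < 1) (D k : ℕ) :
    qPoch ((q ^ 2) ^ (D + 1)) (q ^ 2) k = qFac q (D + k) * (qFac q D)⁻¹ := by
  rw [eq_mul_inv_iff_mul_eq₀ (qFac_pos h0 h1 D).ne', mul_comm, qFac, qFac,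
    show ((D : ℤ) + k).toNat = D + k by omega, show ((D : ℤ)).toNat = D by omega, qPoch, qPoch,
    qPoch, Finset.prod_range_add]
  congr 1
  refine Finset.prod_congr rfl fun i _ => ?_
  ring

lemma pow_choose_two (q : ℝ) (k : ℕ) :
    (q ^ 2) ^ (k.choose 2) = q ^ ((k : ℤ) * k - k) := by
  rw [← pow_mul, ← zpow_natCast]
  congr 1
  cases k with
  | zero => simp
  | succ k =>
    rw [Nat.choose_two_right, Nat.mul_div_cancel' (Nat.even_mul_pred_self _).two_dvd]
    push_cast
    ring

lemma qPoch_zero_left (q : ℝ) (k : ℕ) : qPoch 0 q k = 1 := by simp [qPoch]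

lemma sq_zpow (q : ℝ) (u : ℤ) : (q ^ 2) ^ u = (q ^ u) ^ 2 := by
  rw [← zpow_natCast q 2, ← zpow_mul, mul_comm, zpow_mul, zpow_natCast]

lemma besselJNat_eq (h0 : 0 < q) (h1 : q < 1) (n : ℕ) (u : ℤ) :
    besselJNat n ((q ^ 2) ^ u) (q ^ 2) = ∑' k : ℕ, q ^ (u * n) * ((-1) ^ k *
      q ^ ((k : ℤ) * k + k + 2 * u * k) * (qFacInv q k * qFacInv q (n + k))) := by
  have hq := h0.ne'
  have hQ := qFacInf_ne_zero h0 h1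
  rw [besselJNat, phi11, ← tsum_mul_left]
  refine tsum_congr fun k => ?_
  rw [qPochInf_shift h0 h1, qPoch_shift h0 h1, qPoch_zero_left, pow_choose_two q k,
    qFacInv_of_nonneg (by omega : (0 : ℤ) ≤ k), qFacInv_of_nonneg (by omega : (0 : ℤ) ≤ n + k),
    show qPochInf (q ^ 2) (q ^ 2) = qFacInf q from rfl,
    show qPoch (q ^ 2) (q ^ 2) k = qFac q k from rfl]
  have e1 : ((q ^ 2) ^ u) ^ ((n : ℝ) / 2) = q ^ (u * n) := by
    rw [sq_zpow, ← Real.rpow_natCast (q ^ u) 2, ← Real.rpow_mul (zpow_pos h0 u).le, Nat.cast_ofNat,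
      mul_div_cancel₀ _ (by norm_num : (2 : ℝ) ≠ 0), Real.rpow_natCast, ← zpow_natCast, ← zpow_mul]
  have e2 : (q ^ 2 * (q ^ 2) ^ u) ^ k = q ^ (2 * (k : ℤ) + 2 * u * k) := by
    rw [sq_zpow, ← mul_pow, ← pow_mul, ← zpow_one_add₀ hq, ← zpow_natCast, ← zpow_mul]
    congr 1
    push_cast
    ring
  have e3 : q ^ ((k : ℤ) * k + k + 2 * u * k) = q ^ ((k : ℤ) * k - k) *
      q ^ (2 * (k : ℤ) + 2 * u * k) := by
    rw [← zpow_add₀ hq]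
    congr 1
    ring
  have p1 := (qFac_pos h0 h1 n).ne'
  have p2 := (qFac_pos h0 h1 k).ne'
  have p3 := (qFac_pos h0 h1 (n + k)).ne'
  rw [e1, e2, e3]
  field_simp

lemma recCoeff_neg (h0 : 0 < q) (n : ℕ) (u : ℤ) :
    recCoeff q (-n) u = recCoeff q n (u + n) := by
  rcases Nat.eq_zero_or_pos n with h | h
  · subst h; simp
  have hnq : -q ≠ 0 := neg_ne_zero.2 h0.ne'
  have hq := h0.ne'
  have e1 : (q ^ 2) ^ ((n : ℝ) / 2) = q ^ n := by
    rw [← Real.rpow_natCast q 2, ← Real.rpow_mul h0.le]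
    push_cast
    rw [mul_div_cancel₀ _ (by norm_num : (2 : ℝ) ≠ 0), Real.rpow_natCast]
  have hl : besselJ (-n : ℤ) ((q ^ 2) ^ u) (q ^ 2) = (-1) ^ n * (q ^ 2) ^ ((n : ℝ) / 2) *
      besselJNat n ((q ^ 2) ^ u * (q ^ 2) ^ n) (q ^ 2) := by
    rw [besselJ, if_neg (by omega)]
    simp
  have hr : besselJ (n : ℤ) ((q ^ 2) ^ (u + n)) (q ^ 2) = 
      besselJNat n ((q ^ 2) ^ (u + n)) (q ^ 2) := by
    rw [besselJ, if_pos (by omega)]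
    simp
  rw [recCoeff, recCoeff, hl, hr, e1, zpow_add₀ hnq, zpow_add₀ (pow_ne_zero 2 hq), zpow_natCast,
    zpow_natCast, neg_pow q n]
  ring

lemma recTerm_swap (q : ℝ) (A B C s : ℤ) : recTerm q A B C s = recTerm q B A C s := by
  unfold recTerm
  rw [show C + C * (A + B) - A * B = C + C * (B + A) - B * A by ring]
  ring

/-- For $A=B+n$, $n\ge0$, the shift $s=k-B$ leaves only $k\ge0$ and the ${}_1\varphi_1$ series of
$J_n$. The case $A\le B$ follows from the symmetry in $A,B$, which matches the definition of
$J_{-n}$. -/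
lemma tsum_recTerm (h0 : 0 < q) (h1 : q < 1) (A B C : ℤ) :
    ∑' s, recTerm q A B C s = recCoeff q (A - B) (C - B) := by
  have main : ∀ (B : ℤ) (n : ℕ), ∑' s, recTerm q (B + n) B C s = recCoeff q n (C - B) := by
    intro B n
    rw [recCoeff, besselJ, if_pos (by omega), Int.toNat_natCast, besselJNat_eq h0 h1,
      ← tsum_mul_left, ← tsum_shift _ (-B)]
    rw [← Function.Injective.tsum_eq (g := fun k : ℕ => (k : ℤ)) Nat.cast_injective]
    · refine tsum_congr fun k => ?_
      rw [recTerm, show B + n + ((k : ℤ) + -B) = n + k by ring,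
        show B + ((k : ℤ) + -B) = k by ring]
      have e3 : (-q) ^ (C - B) = (-1) ^ (C - B) * q ^ (C - B) := by
        rw [← mul_zpow, neg_one_mul]
      have e4 : (-1 : ℝ) ^ (C + ((k : ℤ) + -B)) = (-1) ^ (C - B) * (-1) ^ k := by
        rw [← zpow_natCast, ← zpow_add₀ (by norm_num : (-1 : ℝ) ≠ 0)]
        congr 1
        ring
      have e5 : q ^ (C + C * (B + n + B) - (B + n) * B + ((k : ℤ) + -B) * (k + -B) + (k + -B) +
          2 * C * (k + -B)) = q ^ (C - B) * q ^ ((C - B) * n) *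
          q ^ ((k : ℤ) * k + k + 2 * (C - B) * k) := by
        rw [← zpow_add₀ h0.ne', ← zpow_add₀ h0.ne']
        congr 1
        ring
      rw [e3, e4, e5]
      ring
    · intro s hs
      by_contra hneg
      apply hs
      have : s < 0 := by
        by_contra h
        exact hneg ⟨s.toNat, by simp; omega⟩
      show recTerm q (B + n) B C (s + -B) = 0
      rw [recTerm, qFacInv_of_neg (n := B + (s + -B)) (by omega)]
      ring
  rcases le_total B A with h | h
  · obtain ⟨n, hn⟩ := Int.le.dest h
    rw [← hn, main, add_sub_cancel_left]
  · obtain ⟨n, hn⟩ := Int.le.dest h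
    rw [← hn, show A - (A + n) = -(n : ℤ) by ring, recCoeff_neg h0,
      show C - (A + n) + n = C - A by ring, ← main A n]
    exact tsum_congr fun s => recTerm_swap _ _ _ _ _

lemma recSum_eq (h0 : 0 < q) (h1 : q < 1) (A B C : ℤ) :
    recSum q A B C = recCoeff q (A - B) (C - B) := by
  rw [← tsum_recTerm h0 h1]
  exact tendsto_nhds_unique (tendsto_cg_recSum h0 h1 A B C) (tendsto_cg_recTerm h0 h1 A B C)

/-- The `q`-Bessel function is the limit of the Clebsch-Gordan coefficients. -/
lemma tendsto_cg (h0 : 0 < q) (h1 : q < 1) (A B C : ℤ) :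
    Tendsto (fun N : ℕ => cg q (C + N) (A + N) (B + N)) atTop
      (𝓝 (recCoeff q (A - B) (C - B))) := by
  rw [← recSum_eq h0 h1]
  exact tendsto_cg_recSum h0 h1 A B C

lemma recCoeff_symm (h0 : 0 < q) (h1 : q < 1) (r u : ℤ) : recCoeff q (-r) (u - r) = recCoeff q r u := by
  have e1 := tsum_recTerm h0 h1 r 0 u
  have e2 := tsum_recTerm h0 h1 0 r u
  rw [sub_zero, sub_zero] at e1
  rw [zero_sub] at e2
  rw [← e1, ← e2]
  exact tsum_congr fun s => recTerm_swap _ _ _ _ _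

/-- The recoupling coefficients have unit norm. -/
lemma hasSum_recCoeff_sq (h0 : 0 < q) (h1 : q < 1) (r : ℤ) :
    HasSum (fun u => recCoeff q r u ^ 2) 1 := by
  have hc := (cgBound_pos h0 h1).le
  set m := min r 0
  have hb : ∀ (N : ℕ) (t : ℤ), |cg q (0 + N) (r + t + N) (0 + t + N) ^ 2| ≤
      cgBound q * cgBound q * q ^ |t + m| := by
    intro N t
    have e := abs_cg_shift_le h0 h1 (0 + N) (r + N) (0 + N) t
    rw [show r + N + t = r + t + N by ring, show (0 : ℤ) + N + t = 0 + t + N by ring,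
      show min (r + (N : ℤ)) (0 + N) - (0 + N) = m by omega] at e
    rw [sq, abs_mul]
    calc _ ≤ (cgBound q * q ^ |t + m|) * cgBound q := by
          gcongr
          exact abs_cg_le_bound h0 h1 _ _ _
      _ = _ := by ring
  have hlim : ∀ t : ℤ, Tendsto (fun N : ℕ => cg q (0 + N) (r + t + N) (0 + t + N) ^ 2) atTop
      (𝓝 (recCoeff q r (-t) ^ 2)) := fun t => by
    have := (tendsto_cg h0 h1 (r + t) (0 + t) 0).pow 2
    rwa [show r + t - (0 + t) = r by ring, show 0 - (0 + t) = -t by ring] at this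
  -- The bound is uniform in $N$, so no mass escapes and the limit has norm exactly 1. This equality
  -- later replaces a completeness proof for the mixed trees.
  have h := tendsto_tsum_int h0 h1 _ _ hb hlim
  have hone : ∀ N : ℕ, ∑' t : ℤ, cg q (0 + N) (r + t + N) (0 + t + N) ^ 2 = 1 := by
    intro N
    have := (hasSum_cg_mul_cg h0 h1 (r + N) (0 + N) (x := 0 + N) (x' := 0 + N) (by omega)
      (by omega)).tsum_eq
    rw [if_pos rfl] at this
    rw [← this]
    refine tsum_congr fun t => ?_
    rw [show r + N + t = r + t + N by ring, show (0 : ℤ) + N + t = 0 + t + N by ring]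
    ring
  simp_rw [hone] at h
  have hs : Summable fun t : ℤ => recCoeff q r (-t) ^ 2 := by
    refine summable_of_abs_le h0 h1 (cgBound q * cgBound q) m fun t => ?_
    exact le_of_tendsto' (hlim t).abs fun N => hb N t
  have h2 := hs.hasSum
  rw [← tendsto_nhds_unique tendsto_const_nhds h] at h2
  simpa [Function.comp_def] using (Equiv.neg ℤ).hasSum_iff.2 h2

/-- The pentagon relation for the recoupling coefficients, in symmetric form. -/
lemma hasSum_recCoeff_star (h0 : 0 < q) (h1 : q < 1) (x n y z m k : ℤ) :
    HasSum (fun t : ℤ => recCoeff q (z - k) (x - k - t) * recCoeff q (n - m - t) (z - m) *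
      recCoeff q (m - k) (y - k - t))
      (recCoeff q (x + m - n - k) (y + z - n - k) * recCoeff q (n - y) (x - y)) := by
  have hc := (cgBound_pos h0 h1).le
  have hb : ∀ (N : ℕ) (t : ℤ), |cg q (x + N) (z + t + N) (k + t + N) *
      cg q (z + t + N) (n + N) (m + t + N) * cg q (y + N) (m + t + N) (k + t + N)| ≤
      cgBound q * cgBound q * cgBound q * q ^ |t + (min z k - x)| := by
    intro N t
    have e := abs_cg_shift_le h0 h1 (x + N) (z + N) (k + N) t
    rw [show z + N + t = z + t + N by ring, show k + N + t = k + t + N by ring,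
      show min (z + (N : ℤ)) (k + N) - (x + N) = min z k - x by omega] at e
    rw [abs_mul, abs_mul]
    calc _ ≤ (cgBound q * q ^ |t + (min z k - x)|) * cgBound q * cgBound q := by
          gcongr
          · exact abs_cg_le_bound h0 h1 _ _ _
          · exact abs_cg_le_bound h0 h1 _ _ _
      _ = _ := by ring
  have hlim : ∀ t : ℤ, Tendsto (fun N : ℕ => cg q (x + N) (z + t + N) (k + t + N) *
      cg q (z + t + N) (n + N) (m + t + N) * cg q (y + N) (m + t + N) (k + t + N)) atTop
      (𝓝 (recCoeff q (z - k) (x - k - t) * recCoeff q (n - m - t) (z - m) *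
        recCoeff q (m - k) (y - k - t))) := fun t => by
    have := ((tendsto_cg h0 h1 (z + t) (k + t) x).mul (tendsto_cg h0 h1 n (m + t) (z + t))).mul
      (tendsto_cg h0 h1 (m + t) (k + t) y)
    rwa [show z + t - (k + t) = z - k by ring, show x - (k + t) = x - k - t by ring,
      show n - (m + t) = n - m - t by ring, show z + t - (m + t) = z - m by ring,
      show m + t - (k + t) = m - k by ring, show y - (k + t) = y - k - t by ring] at this
  have h := tendsto_tsum_int h0 h1 _ _ hb hlim
  -- In the recoupling factor the shifts by $N$ cancel; only the Clebsch–Gordan coefficient on the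
  -- right side passes to the limit.
  have hval : ∀ N : ℕ, ∑' t : ℤ, cg q (x + N) (z + t + N) (k + t + N) *
      cg q (z + t + N) (n + N) (m + t + N) * cg q (y + N) (m + t + N) (k + t + N)
      = recCoeff q (x + m - n - k) (y + z - n - k) * cg q (x + N) (n + N) (y + N) := by
    intro N
    have := (hasSum_cg_star h0 h1 (x + N) (n + N) (y + N) (z + N) (m + N) (k + N)).tsum_eq
    rw [recSum_eq h0 h1, show x + N + (m + N) - (n + N + (k + N)) = x + m - n - k by ring,
      show y + N + (z + N) - (n + N + (k + N)) = y + z - n - k by ring] at this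
    rw [← this]
    refine tsum_congr fun t => ?_
    rw [show z + N + t = z + t + N by ring, show k + N + t = k + t + N by ring,
      show m + N + t = m + t + N by ring]
  simp_rw [hval] at h
  have hs := summable_of_abs_le h0 h1 _ _ (fun t => le_of_tendsto' (hlim t).abs fun N => hb N t)
  have h2 := hs.hasSum
  rwa [tendsto_nhds_unique h ((tendsto_cg h0 h1 n y x).const_mul _)] at h2

/-- The pentagon relation for the recoupling coefficients, in the labels of trees with four
leaves. -/
lemma hasSum_recCoeff_pentagon (h0 : 0 < q) (h1 : q < 1) (x a b c d r s t s' : ℤ) :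
    HasSum (fun τ : ℤ => recCoeff q (x - a - d + τ) (b - a - d + s') *
      recCoeff q (s' - a + t - c) (s + τ - a - c) * recCoeff q (b + c - d - t) (r - d + τ - t))
      (recCoeff q (x + c - d - s) (r - d + s' - s) *
        recCoeff q (x - a - r + t) (b - a - r + s)) := by
  -- The labels solve the linear system that matches the arguments of the factors, with $m$
  -- normalized to $0$ and $\tau=-t$. The third factor and the prefactor match only after
  -- `recCoeff_symm`.
  have h := hasSum_recCoeff_star h0 h1 (s - a + b - d - t) (x - a - d) (r - d - t)
    (s' - a + b - d) 0 (b + c - d - t)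
  have h' := (Equiv.neg ℤ).hasSum_iff.2 h
  refine hasSum_of_eq h' (fun τ => ?_) ?_
  · simp only [Function.comp, Equiv.neg_apply]
    rw [← recCoeff_symm h0 h1 (b + c - d - t)]
    rw [show s' - a + b - d - (b + c - d - t) = s' - a + t - c by ring,
      show s - a + b - d - t - (b + c - d - t) - -τ = s + τ - a - c by ring,
      show x - a - d - 0 - -τ = x - a - d + τ by ring,
      show s' - a + b - d - 0 = b - a - d + s' by ring,
      show 0 - (b + c - d - t) = -(b + c - d - t) by ring,
      show r - d - t - (b + c - d - t) - -τ = r - d + τ - t - (b + c - d - t) by ring]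
    ring
  · rw [← recCoeff_symm h0 h1 (x + c - d - s)]
    congr 2 <;> ring

/-! ### The Clebsch-Gordan coefficients in terms of Wall polynomials -/

lemma qPoch_neg (h0 : 0 < q) (M : ℕ) {j : ℕ} (hj : j ≤ M) :
    qPoch ((q ^ 2) ^ (-(M : ℤ))) (q ^ 2) j * qFac q (M - j) =
      (-1) ^ j * q ^ ((j : ℤ) * j - j - 2 * M * j) * qFac q M := by
  have hq := h0.ne'
  induction j with
  | zero => simp [qPoch_zero]
  | succ j ih =>
    have ih := ih (by omega)
    rw [qFac_eq (n := (M : ℤ) - j) (by omega)] at ih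
    rw [qPoch_succ]
    have e1 : (q ^ 2) ^ (-(M : ℤ)) * (q ^ 2) ^ j = (q ^ ((M : ℤ) - j))⁻¹ ^ 2 := by
      rw [sq_zpow, ← zpow_natCast (q ^ 2) j, sq_zpow, ← mul_pow, ← zpow_add₀ hq, ← zpow_neg]
      congr 2
      ring
    have e2 : q ^ (((j + 1 : ℕ) : ℤ) * ((j + 1 : ℕ) : ℤ) - ((j + 1 : ℕ) : ℤ) -
        2 * M * ((j + 1 : ℕ) : ℤ)) =
        q ^ ((j : ℤ) * j - j - 2 * M * j) * (q ^ ((M : ℤ) - j))⁻¹ ^ 2 := by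
      rw [← zpow_neg, ← zpow_natCast, ← zpow_mul, ← zpow_add₀ hq]
      congr 1
      push_cast
      ring
    rw [e1, e2, pow_succ (-1 : ℝ) j, show (M : ℤ) - ((j + 1 : ℕ) : ℤ) = M - j - 1 by push_cast; ring]
    have hne := zpow_ne_zero ((M : ℤ) - j) hq
    generalize q ^ ((M : ℤ) - j) = Z at *
    have e3 : 1 - Z⁻¹ ^ 2 = -(Z⁻¹ ^ 2 * (1 - Z ^ 2)) := by
      field_simp
      ring
    rw [e3]
    linear_combination (-Z⁻¹ ^ 2) * ih

lemma qPoch_neg_of_lt (h0 : 0 < q) {M j : ℕ} (hj : M < j) :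
    qPoch ((q ^ 2) ^ (-(M : ℤ))) (q ^ 2) j = 0 := by
  refine Finset.prod_eq_zero (Finset.mem_range.2 hj) ?_
  rw [zpow_neg, zpow_natCast, inv_mul_cancel₀ (by positivity), sub_self]

/-- The terminating ${}_2\varphi_1$ is the sum of `cgRed` read backwards, $l=M-j$; `qPoch_neg`
rewrites $(q^{-2M};q^2)_j$ accordingly. -/
lemma wall_eq (h0 : 0 < q) (h1 : q < 1) (M X D : ℕ) :
    q ^ (((D : ℤ) + 1) * (X - M)) * (-1) ^ M * wall M X ((q ^ 2) ^ D) (q ^ 2) =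
      qFac q M * qFac q D * (q ^ X * q ^ (((M : ℤ) + D) * X + M * X - (M + D) * M) *
        ∑' l : ℤ, cgRedTerm q X M (M + D) l) := by
  have hq := h0.ne'
  rw [← tsum_reflect (cgRedTerm q X M (M + D)) (M : ℤ), wall, phi21, ← tsum_mul_left,
    ← tsum_mul_left, ← tsum_mul_left,
    ← Function.Injective.tsum_eq (g := fun k : ℕ => (k : ℤ)) Nat.cast_injective]
  · refine tsum_congr fun j => ?_
    rw [← pow_succ, qPoch_shift h0 h1, qPoch_zero_left,
      show qPoch (q ^ 2) (q ^ 2) j = qFac q j from rfl, cgRedTerm]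
    by_cases hj : j ≤ M
    · have hp := qPoch_neg h0 M hj
      rw [show (M : ℤ) - (M - j) = j by ring, show (M : ℤ) + D - (M - j) = D + j by ring,
        qFacInv_of_nonneg (by omega : (0 : ℤ) ≤ M - j), qFacInv_of_nonneg (by omega : (0 : ℤ) ≤ j),
        qFacInv_of_nonneg (by omega : (0 : ℤ) ≤ D + j)]
      have p1 := (qFac_pos h0 h1 ((M : ℤ) - j)).ne'
      have p2 := (qFac_pos h0 h1 j).ne'
      have p3 := (qFac_pos h0 h1 (D + j)).ne'
      have p4 := (qFac_pos h0 h1 D).ne'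
      have e1 : ((q ^ 2) ^ (X + 1)) ^ j = q ^ (2 * ((X : ℤ) + 1) * j) := by
        rw [← pow_mul, ← pow_mul, ← zpow_natCast]
        congr 1
        push_cast
        ring
      have e2 : (-1 : ℝ) ^ ((M : ℤ) - j) = (-1) ^ M * (-1) ^ j := by
        rw [zpow_sub₀ (by norm_num), zpow_natCast, zpow_natCast, div_eq_mul_inv, ← inv_pow]
        norm_num
      have e3 : q ^ X * q ^ (((M : ℤ) + D) * X + M * X - (M + D) * M) *
          q ^ (((M : ℤ) - j) * (M - j) - (M - j) - 2 * X * (M - j)) =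
          q ^ (((D : ℤ) + 1) * (X - M)) * q ^ ((j : ℤ) * j - j - 2 * M * j) *
          q ^ (2 * ((X : ℤ) + 1) * j) := by
        rw [← zpow_natCast q X, ← zpow_add₀ hq, ← zpow_add₀ hq, ← zpow_add₀ hq, ← zpow_add₀ hq]
        congr 1
        ring
      have hp' : qPoch ((q ^ 2) ^ (-(M : ℤ))) (q ^ 2) j =
          (-1) ^ j * q ^ ((j : ℤ) * j - j - 2 * M * j) * qFac q M / qFac q (M - j) := by
        rw [eq_div_iff p1, hp]
      rw [hp', e1, e2]
      generalize q ^ X * q ^ (((M : ℤ) + D) * X + M * X - (M + D) * M) = a at *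
      generalize q ^ (((M : ℤ) - j) * (M - j) - (M - j) - 2 * X * (M - j)) = b at *
      generalize q ^ (((D : ℤ) + 1) * (X - M)) = c at *
      generalize q ^ ((j : ℤ) * j - j - 2 * M * j) = d at *
      generalize q ^ (2 * ((X : ℤ) + 1) * j) = e at *
      generalize qFac q ((M : ℤ) - j) = f1 at *
      generalize qFac q (j : ℤ) = f2 at *
      generalize qFac q ((D : ℤ) + j) = f3 at *
      generalize qFac q (D : ℤ) = f4 at *
      field_simp
      linear_combination (-qFac q M) * e3
    · rw [qPoch_neg_of_lt h0 (by omega), qFacInv_of_neg (n := (M : ℤ) - j) (by omega)]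
      ring
  · intro s hs
    by_contra hneg
    apply hs
    have : s < 0 := by
      by_contra h
      exact hneg ⟨s.toNat, by simp; omega⟩
    show _ * (_ * cgRedTerm q X M (M + D) (M - s)) = 0
    rw [cgRedTerm_of_lt q (by omega)]
    ring

lemma wallBar_eq (h0 : 0 < q) (h1 : q < 1) (M X D : ℕ) :
    wallBar M X ((q ^ 2) ^ D) (q ^ 2) = cg q X M (M + D) := by
  have hq := h0.ne'
  have pX := qFac_pos h0 h1 X
  have pM := qFac_pos h0 h1 M
  have pD := qFac_pos h0 h1 D
  have pN := qFac_pos h0 h1 (M + D)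
  have pQ := qFacInf_pos h0 h1
  -- The radicand is the product under the roots in `cg` times a perfect square, so the square root
  -- splits.
  have hr : ((q ^ 2) ^ D * q ^ 2) ^ ((X : ℤ) - M) * qPochInf ((q ^ 2) ^ D * q ^ 2) (q ^ 2) *
      qPoch ((q ^ 2) ^ D * q ^ 2) (q ^ 2) M / (qPoch (q ^ 2) (q ^ 2) M * qPoch (q ^ 2) (q ^ 2) X)
      = (qFacInf q * qFac q X * qFac q M * qFac q (M + D)) *
        (q ^ (((D : ℤ) + 1) * (X - M)) / (qFac q D * qFac q M * qFac q X)) ^ 2 := by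
    rw [← pow_succ, qPochInf_shift h0 h1, qPoch_shift h0 h1,
      show qPoch (q ^ 2) (q ^ 2) M = qFac q M from rfl,
      show qPoch (q ^ 2) (q ^ 2) X = qFac q X from rfl, add_comm (D : ℤ) M]
    have e : ((q ^ 2) ^ (D + 1)) ^ ((X : ℤ) - M) = (q ^ (((D : ℤ) + 1) * (X - M))) ^ 2 := by
      rw [← pow_mul, ← zpow_natCast q, ← zpow_mul, ← zpow_natCast (q ^ _) 2, ← zpow_mul]
      congr 1
      push_cast
      ring
    rw [e]
    field_simp
  have h := wall_eq h0 h1 M X D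
  rw [wallBar, hr, Real.sqrt_mul (by positivity), Real.sqrt_sq (by positivity), cg,
    cgSum_eq_cgRed h0 h1 _ (by omega) (by omega), cgRed, Real.sqrt_mul (by positivity),
    Real.sqrt_mul (by positivity), Real.sqrt_mul (by positivity),
    qFacInv_of_nonneg (by omega : (0 : ℤ) ≤ X), zpow_natCast, neg_pow q X]
  have h2 : wall M X ((q ^ 2) ^ D) (q ^ 2) * q ^ (((D : ℤ) + 1) * (X - M)) * (-1) ^ M
     / (qFac q D * qFac q M) = (q ^ X * q ^ (((M : ℤ) + D) * X + M * X - (M + D) * M) *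
        ∑' l : ℤ, cgRedTerm q X M (M + D) l) := by
    rw [div_eq_iff (by positivity)]
    linear_combination h
  calc _ = (-1) ^ X * (√(qFacInf q) * √(qFac q X) * √(qFac q M) * √(qFac q (M + D))) *
        (qFac q X)⁻¹ * (wall M X ((q ^ 2) ^ D) (q ^ 2) * q ^ (((D : ℤ) + 1) * (X - M)) * (-1) ^ M
        / (qFac q D * qFac q M)) := by
        rw [pow_add]
        field_simp
    _ = _ := by
        rw [h2]
        ring

/-- The Clebsch-Gordan coefficient in symmetric form. -/
lemma clebsch_eq_cg (h0 : 0 < q) (h1 : q < 1) (x m n : ℤ) : clebsch q x m n = cg q x m n := by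
  unfold clebsch
  split_ifs with h
  · obtain ⟨hx, hm, hn⟩ := h
    lift x to ℕ using hx
    lift m to ℕ using hm
    lift n to ℕ using hn
    rcases le_total m n with h | h
    · obtain ⟨D, rfl⟩ := Nat.exists_eq_add_of_le h
      have := wallBar_eq h0 h1 m x D
      push_cast at this ⊢
      rw [min_eq_left (by omega), ← this]
      simp
    · obtain ⟨D, rfl⟩ := Nat.exists_eq_add_of_le h
      have := wallBar_eq h0 h1 n x D
      push_cast at this ⊢
      rw [min_eq_right (by omega), cg_swap, ← this]
      simp
  · rw [cg_of_neg q (by omega)]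

/-! ### Sums over products and tuples -/

lemma summable_mul_of_sq {ι : Type*} {v w : ι → ℝ} (hv : Summable fun i => v i ^ 2)
    (hw : Summable fun i => w i ^ 2) : Summable fun i => v i * w i := by
  refine Summable.of_norm_bounded (hv.add hw) fun i => ?_
  rw [Real.norm_eq_abs, abs_mul]
  nlinarith [sq_nonneg (|v i| - |w i|), sq_abs (v i), sq_abs (w i), abs_nonneg (v i),
    abs_nonneg (w i)]

/-- Square summability of both factors makes the product absolutely summable, which justifies
summing one variable at a time. The interchanges for trees and for $\mathbf t$ rest on this. -/
lemma hasSum_mul_prod {α β : Type*} {v w : α × β → ℝ} {g : α → ℝ} {S : ℝ}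
    (hv : Summable fun x => v x ^ 2) (hw : Summable fun x => w x ^ 2)
    (hg : ∀ a, HasSum (fun b => v (a, b) * w (a, b)) (g a)) (h : HasSum g S) :
    HasSum (fun x => v x * w x) S := by
  have hs := (summable_mul_of_sq hv hw).hasSum
  rwa [(hs.prod_fiberwise hg).unique h] at hs

lemma hasSum_prod_of_nonneg {α β : Type*} {f : α × β → ℝ} {g : α → ℝ} {S : ℝ}
    (hf : ∀ x, 0 ≤ f x) (hg : ∀ a, HasSum (fun b => f (a, b)) (g a)) (h : HasSum g S) :
    HasSum f S := by
  have hs : Summable f := by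
    rw [summable_prod_of_nonneg hf]
    refine ⟨fun a => (hg a).summable, ?_⟩
    rw [funext fun a => (hg a).tsum_eq]
    exact h.summable
  rw [← (hs.hasSum.prod_fiberwise hg).unique h]
  exact hs.hasSum

lemma hasSum_cons_iff {α : Type*} {d : ℕ} {f : (Fin (d + 1) → α) → ℝ} {S : ℝ} :
    HasSum (fun x : α × (Fin d → α) => f (Fin.cons x.1 x.2)) S ↔ HasSum f S :=
  (Fin.consEquiv fun _ => α).hasSum_iff

lemma hasSum_snoc_iff {α : Type*} {d : ℕ} {f : (Fin (d + 1) → α) → ℝ} {S : ℝ} :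
    HasSum (fun x : α × (Fin d → α) => f (Fin.snoc x.2 x.1)) S ↔ HasSum f S :=
  (Fin.snocEquiv fun _ => α).hasSum_iff

lemma hasSum_init_snoc_iff {α : Type*} {d : ℕ} {f : (Fin (d + 1) → α) → ℝ} {S : ℝ} :
    HasSum (fun x : (Fin d → α) × α => f (Fin.snoc x.1 x.2)) S ↔ HasSum f S := by
  rw [← hasSum_snoc_iff, ← (Equiv.prodComm _ _).hasSum_iff]
  rfl

lemma hasSum_mul_cons {α : Type*} {d : ℕ} {v w : (Fin (d + 1) → α) → ℝ} {g : α → ℝ} {S : ℝ}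
    (hv : Summable fun x => v x ^ 2) (hw : Summable fun x => w x ^ 2)
    (hg : ∀ a, HasSum (fun m => v (Fin.cons a m) * w (Fin.cons a m)) (g a)) (h : HasSum g S) :
    HasSum (fun x => v x * w x) S :=
  hasSum_cons_iff.1 <| hasSum_mul_prod
    (v := fun x : α × (Fin d → α) => v (Fin.cons x.1 x.2))
    (w := fun x : α × (Fin d → α) => w (Fin.cons x.1 x.2))
    ((Fin.consEquiv fun _ => α).summable_iff.2 hv) ((Fin.consEquiv fun _ => α).summable_iff.2 hw)
    hg h

lemma hasSum_mul_snoc {α : Type*} {d : ℕ} {v w : (Fin (d + 1) → α) → ℝ} {g : α → ℝ} {S : ℝ}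
    (hv : Summable fun x => v x ^ 2) (hw : Summable fun x => w x ^ 2)
    (hg : ∀ a, HasSum (fun m : Fin d → α => v (Fin.snoc m a) * w (Fin.snoc m a)) (g a))
    (h : HasSum g S) : HasSum (fun x => v x * w x) S :=
  hasSum_snoc_iff.1 <| hasSum_mul_prod
    (v := fun x : α × (Fin d → α) => v (Fin.snoc x.2 x.1))
    (w := fun x : α × (Fin d → α) => w (Fin.snoc x.2 x.1))
    ((Fin.snocEquiv fun _ => α).summable_iff.2 hv) ((Fin.snocEquiv fun _ => α).summable_iff.2 hw)
    hg h

lemma hasSum_nat_of_int {f : ℤ → ℝ} {S : ℝ} (hf : ∀ t < 0, f t = 0) (h : HasSum f S) :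
    HasSum (fun n : ℕ => f n) S := by
  refine (Nat.cast_injective.hasSum_iff fun t ht => hf t ?_).2 h
  by_contra hneg
  exact ht ⟨t.toNat, by simp; omega⟩

/-! ### Families of coupled vectors -/

lemma coupleLeft_cons (h0 : 0 < q) (h1 : q < 1) {d : ℕ} (r : ℤ) (f : ℤ → ℤ → (Fin d → ℕ) → ℝ)
    (x p : ℤ) (n : ℕ) (m : Fin d → ℕ) : coupleLeft q r f x p (Fin.cons n m) =
      cg q x n (n + p) * f (n + p) (x - n - r) m := by
  rw [coupleLeft, clebsch_eq_cg h0 h1, Fin.cons_zero, Fin.tail_cons]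

lemma coupleRight_snoc (h0 : 0 < q) (h1 : q < 1) {d : ℕ} (r : ℤ) (f : ℤ → ℤ → (Fin d → ℕ) → ℝ)
    (x p : ℤ) (k : ℕ) (m : Fin d → ℕ) : coupleRight q r f x p (Fin.snoc m k) =
      cg q x (k - p) k * f (k - p) (r - x + k) m := by
  rw [coupleRight, clebsch_eq_cg h0 h1, Fin.snoc_last, Fin.init_snoc]

lemma hasSum_cg_mul_cg_left (h0 : 0 < q) (h1 : q < 1) (x x' p : ℤ) :
    HasSum (fun n : ℕ => cg q x n (n + p) * cg q x' n (n + p))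
      (if x = x' ∧ 0 ≤ x then 1 else 0) := by
  by_cases hx : 0 ≤ x
  · by_cases hx' : 0 ≤ x'
    · have h := hasSum_cg_mul_cg h0 h1 0 p hx hx'
      refine hasSum_of_eq (hasSum_nat_of_int (fun t ht => ?_) h) (fun n => ?_) (by simp [hx])
      · rw [cg_of_neg q (by omega), zero_mul]
      · rw [zero_add, add_comm p]
    · refine hasSum_of_eq hasSum_zero (fun n => ?_) ?_
      · rw [cg_of_neg q (x := x') (by omega), mul_zero]
      · rw [if_neg (by omega)]
  · refine hasSum_of_eq hasSum_zero (fun n => ?_) ?_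
    · rw [cg_of_neg q (x := x) (by omega), zero_mul]
    · rw [if_neg (by omega)]

lemma hasSum_cg_mul_cg_right (h0 : 0 < q) (h1 : q < 1) (x x' p : ℤ) :
    HasSum (fun n : ℕ => cg q x (n - p) n * cg q x' (n - p) n)
      (if x = x' ∧ 0 ≤ x then 1 else 0) :=
  hasSum_of_eq (hasSum_cg_mul_cg_left h0 h1 x x' (-p))
    (fun n => by rw [cg_swap q x, cg_swap q x', sub_eq_add_neg]) rfl

/-- A family of vectors that are unit vectors at the levels `y ≥ 0` and vanish at the levels
`y < 0`. -/
def IsUnitFamily {d : ℕ} (f : ℤ → ℤ → (Fin d → ℕ) → ℝ) : Prop :=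
  ∀ y p, HasSum (fun m => f y p m ^ 2) (if 0 ≤ y then 1 else 0)

/-- The inner products of the members of two families at the same level are `c (p - p')`, those at
different levels vanish. -/
def IsCoupled {d : ℕ} (c : ℤ → ℝ) (f g : ℤ → ℤ → (Fin d → ℕ) → ℝ) : Prop :=
  ∀ y y' p p', HasSum (fun m => f y p m * g y' p' m) (if y = y' ∧ 0 ≤ y then c (p - p') else 0)

/-- The reduced matrix elements of a family with one more tensor factor on the left. -/
def IsReduced {d : ℕ} (q : ℝ) (c : ℤ → ℤ → ℝ) (f : ℤ → ℤ → (Fin d → ℕ) → ℝ)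
    (g : ℤ → ℤ → (Fin (d + 1) → ℕ) → ℝ) : Prop :=
  ∀ (n : ℕ) (μ z p p' : ℤ), HasSum (fun m => f μ p m * g z p' (Fin.cons n m))
    (cg q z n μ * c (μ - n - p') (p + n - z))

lemma IsUnitFamily.eq_zero {d : ℕ} {f : ℤ → ℤ → (Fin d → ℕ) → ℝ} (hf : IsUnitFamily f) {y : ℤ}
    (hy : y < 0) (p : ℤ) (m : Fin d → ℕ) : f y p m = 0 := by
  have h := hf y p
  rw [if_neg (by omega), hasSum_zero_iff_of_nonneg fun _ => sq_nonneg _] at h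
  exact pow_eq_zero_iff (two_ne_zero) |>.1 (congrFun h m)

lemma IsUnitFamily.summable {d : ℕ} {f : ℤ → ℤ → (Fin d → ℕ) → ℝ} (hf : IsUnitFamily f)
    (y p : ℤ) : Summable fun m => f y p m ^ 2 :=
  (hf y p).summable

lemma IsUnitFamily.coupleLeft (h0 : 0 < q) (h1 : q < 1) {d : ℕ} {f : ℤ → ℤ → (Fin d → ℕ) → ℝ}
    (hf : IsUnitFamily f) (r : ℤ) : IsUnitFamily (coupleLeft q r f) := by
  intro y p
  rw [← hasSum_cons_iff]
  refine hasSum_prod_of_nonneg (fun x => sq_nonneg _)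
    (g := fun n : ℕ => cg q y n (n + p) ^ 2 * if 0 ≤ (n : ℤ) + p then 1 else 0) (fun n => ?_) ?_
  · refine hasSum_of_eq ((hf _ (y - n - r)).mul_left _) (fun m => ?_) rfl
    rw [coupleLeft_cons h0 h1, mul_pow]
  refine hasSum_of_eq (hasSum_cg_mul_cg_left h0 h1 y y p) (fun n => ?_) (by simp)
  split_ifs with h
  · ring
  · rw [cg_of_neg q (by omega)]
    ring

lemma IsUnitFamily.coupleRight (h0 : 0 < q) (h1 : q < 1) {d : ℕ} {f : ℤ → ℤ → (Fin d → ℕ) → ℝ}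
    (hf : IsUnitFamily f) (r : ℤ) : IsUnitFamily (coupleRight q r f) := by
  intro y p
  rw [← hasSum_snoc_iff]
  refine hasSum_prod_of_nonneg (fun x => sq_nonneg _)
    (g := fun n : ℕ => cg q y (n - p) n ^ 2 * if 0 ≤ (n : ℤ) - p then 1 else 0) (fun n => ?_) ?_
  · refine hasSum_of_eq ((hf _ (r - y + n)).mul_left _) (fun m => ?_) rfl
    rw [coupleRight_snoc h0 h1, mul_pow]
  refine hasSum_of_eq (hasSum_cg_mul_cg_right h0 h1 y y p) (fun n => ?_) (by simp)
  split_ifs with h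
  · ring
  · rw [cg_of_neg q (by omega)]
    ring

/-- For $p\ne p'$ the inner levels $n+p$ and $n+p'$ differ and every slice vanishes. For $p=p'$ the
inner value does not depend on $n$ and comes out of the sum, which is then orthonormality of
Clebsch–Gordan coefficients. -/
lemma IsCoupled.coupleLeft (h0 : 0 < q) (h1 : q < 1) {d : ℕ} {c : ℤ → ℝ}
    {f g : ℤ → ℤ → (Fin d → ℕ) → ℝ} (hf : IsUnitFamily f) (hg : IsUnitFamily g)
    (h : IsCoupled c f g) (r r' : ℤ) :
    IsCoupled (fun u => if u = 0 then c (r' - r) else 0) (coupleLeft q r f)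
      (coupleLeft q r' g) := by
  intro y y' p p'
  have uf := (hf.coupleLeft h0 h1 r).summable y p
  have ug := (hg.coupleLeft h0 h1 r').summable y' p'
  refine hasSum_mul_cons uf ug
    (g := fun n : ℕ => (cg q y n (n + p) * cg q y' n (n + p')) *
      (if (n : ℤ) + p = n + p' ∧ 0 ≤ (n : ℤ) + p then c (y - n - r - (y' - n - r')) else 0))
    (fun n => ?_) ?_
  · refine hasSum_of_eq ((h _ _ _ _).mul_left _) (fun m => ?_) rfl
    simp only [coupleLeft_cons h0 h1]
    ring
  · by_cases hp : p = p'
    · subst hp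
      refine hasSum_of_eq ((hasSum_cg_mul_cg_left h0 h1 y y' p).mul_right
        (c (y - r - (y' - r')))) (fun n => ?_) ?_
      · by_cases hn : 0 ≤ (n : ℤ) + p
        · rw [if_pos ⟨rfl, hn⟩]
          congr 2
          ring
        · rw [cg_of_neg q (x := y) (by omega)]
          ring
      · by_cases hy : y = y' ∧ 0 ≤ y
        · simp only [if_pos hy, sub_self, if_true, one_mul]
          congr 1
          omega
        · rw [if_neg hy, if_neg hy, zero_mul]
    · refine hasSum_of_eq hasSum_zero (fun n => ?_) ?_
      · rw [if_neg (by omega), mul_zero]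
      · simp only [if_neg (by omega : ¬ p - p' = 0), ite_self]

lemma IsCoupled.coupleRight (h0 : 0 < q) (h1 : q < 1) {d : ℕ} {c : ℤ → ℝ}
    {f g : ℤ → ℤ → (Fin d → ℕ) → ℝ} (hf : IsUnitFamily f) (hg : IsUnitFamily g)
    (h : IsCoupled c f g) (r r' : ℤ) :
    IsCoupled (fun u => if u = 0 then c (r - r') else 0) (coupleRight q r f)
      (coupleRight q r' g) := by
  intro y y' p p'
  have uf := (hf.coupleRight h0 h1 r).summable y p
  have ug := (hg.coupleRight h0 h1 r').summable y' p'
  refine hasSum_mul_snoc uf ug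
    (g := fun n : ℕ => (cg q y (n - p) n * cg q y' (n - p') n) *
      (if (n : ℤ) - p = n - p' ∧ 0 ≤ (n : ℤ) - p then c (r - y + n - (r' - y' + n)) else 0))
    (fun n => ?_) ?_
  · refine hasSum_of_eq ((h _ _ _ _).mul_left _) (fun m => ?_) rfl
    simp only [coupleRight_snoc h0 h1]
    ring
  · by_cases hp : p = p'
    · subst hp
      refine hasSum_of_eq ((hasSum_cg_mul_cg_right h0 h1 y y' p).mul_right
        (c (r - y - (r' - y')))) (fun n => ?_) ?_
      · by_cases hn : 0 ≤ (n : ℤ) - p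
        · rw [if_pos ⟨rfl, hn⟩]
          congr 2
          ring
        · rw [cg_of_neg q (x := y) (by omega)]
          ring
      · by_cases hy : y = y' ∧ 0 ≤ y
        · simp only [if_pos hy, sub_self, if_true, one_mul]
          congr 1
          omega
        · rw [if_neg hy, if_neg hy, zero_mul]
    · refine hasSum_of_eq hasSum_zero (fun n => ?_) ?_
      · rw [if_neg (by omega), mul_zero]
      · simp only [if_neg (by omega : ¬ p - p' = 0), ite_self]

lemma summable_comp_cons {d : ℕ} {f : ℤ → ℤ → (Fin (d + 1) → ℕ) → ℝ} (hf : IsUnitFamily f)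
    (y p : ℤ) (n : ℕ) : Summable fun m : Fin d → ℕ => f y p (Fin.cons n m) ^ 2 :=
  (hf.summable y p).comp_injective (Fin.cons_right_injective (α := fun _ => ℕ) n)

/-- The slice at last coordinate $k$ contributes the coefficients of the two couplings and the one
from the hypothesis. Their sum over $k$ is the star-triangle sum: one coefficient for the leaf $n$
and one factor `recCoeff`. -/
lemma IsReduced.coupleRight (h0 : 0 < q) (h1 : q < 1) {d : ℕ} {c : ℤ → ℤ → ℝ}
    {f : ℤ → ℤ → (Fin d → ℕ) → ℝ} {g : ℤ → ℤ → (Fin (d + 1) → ℕ) → ℝ} (hf : IsUnitFamily f)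
    (hg : IsUnitFamily g) (h : IsReduced q c f g) (r r' : ℤ) :
    IsReduced q (fun u e => recCoeff q (-e) u * c (-e - r') (r - u)) (coupleRight q r f)
      (coupleRight q r' g) := by
  intro n μ z p p'
  have uf := (hf.coupleRight h0 h1 r).summable μ p
  have ug := summable_comp_cons (hg.coupleRight h0 h1 r') z p' n
  refine hasSum_mul_snoc uf ug
    (g := fun k : ℕ => cg q z (k - p') k * cg q (k - p') n (k - p) * cg q μ (k - p) k *
      c (-(p + n - z) - r') (r - (μ - n - p')))
    (fun k => ?_) ?_
  · refine hasSum_of_eq ((h n (k - p) (k - p') (r - μ + k) (r' - z + k)).mul_left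
      (cg q μ (k - p) k * cg q z (k - p') k)) (fun m => ?_) ?_
    · simp only [coupleRight_snoc h0 h1,
        Fin.cons_snoc_eq_snoc_cons]
      ring
    · rw [show (k : ℤ) - p - n - (r' - z + k) = -(p + n - z) - r' by ring,
        show r - μ + (k : ℤ) + n - (k - p') = r - (μ - n - p') by ring]
      ring
  · have hs := hasSum_cg_star h0 h1 z n μ (-p') (-p) 0
    have hs' := (hasSum_nat_of_int (fun t ht => ?_) hs).mul_right
      (c (-(p + n - z) - r') (r - (μ - n - p')))
    · refine hasSum_of_eq hs' (fun k => ?_) ?_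
      · rw [zero_add, sub_eq_neg_add, sub_eq_neg_add]
      · rw [recSum_eq h0 h1, show z + -p - ((n : ℤ) + 0) = -(p + n - z) by ring,
          show μ + -p' - ((n : ℤ) + 0) = μ - n - p' by ring]
        ring
    · rw [cg_of_neg q (x := z) (by omega)]
      ring

/-- Coupling the leaf $n$ to the smaller family multiplies the slice by a second Clebsch–Gordan
coefficient with the same labels $n,n+p$; orthonormality then leaves the reduced element alone. -/
lemma IsReduced.isCoupled (h0 : 0 < q) (h1 : q < 1) {d : ℕ} {c : ℤ → ℤ → ℝ}
    {f : ℤ → ℤ → (Fin d → ℕ) → ℝ} {g : ℤ → ℤ → (Fin (d + 1) → ℕ) → ℝ} (hf : IsUnitFamily f)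
    (hg : IsUnitFamily g) (h : IsReduced q c f g) (r : ℤ) :
    IsCoupled (fun u => c u (-r)) (QBessel.coupleLeft q r f) g := by
  intro y y' p p'
  have uf := (hf.coupleLeft h0 h1 r).summable y p
  refine hasSum_mul_cons uf (hg.summable y' p')
    (g := fun n : ℕ => cg q y n (n + p) * cg q y' n (n + p) * c (p - p') (y - y' - r))
    (fun n => ?_) ?_
  · refine hasSum_of_eq ((h n (n + p) y' (y - n - r) p').mul_left (cg q y n (n + p)))
      (fun m => ?_) ?_
    · simp only [coupleLeft_cons h0 h1]
      ring
    · rw [show (n : ℤ) + p - n - p' = p - p' by ring, show y - n - r + n - y' = y - y' - r by ring]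
      ring
  · refine hasSum_of_eq ((hasSum_cg_mul_cg_left h0 h1 y y' p).mul_right
        (c (p - p') (y - y' - r))) (fun n => rfl) ?_
    by_cases hy : y = y' ∧ 0 ≤ y
    · rw [if_pos hy, if_pos hy, hy.1, one_mul, sub_self, zero_sub]
    · rw [if_neg hy, if_neg hy, zero_mul]

/-- The standard basis of `ℓ²(ℕ)` as a family of vectors. -/
def basisFamily (y _p : ℤ) (m : Fin 1 → ℕ) : ℝ := if (m 0 : ℤ) = y then 1 else 0

/-- A single leaf does not depend on the second index, so $r$ is arbitrary. Two-leaf trees thereby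
fall under the general coupling lemmas. -/
lemma pairVec_eq_coupleRight (q : ℝ) (r : ℤ) : pairVec q = coupleRight q r basisFamily := by
  funext x p m
  have e : (Fin.init m : Fin 1 → ℕ) 0 = m 0 := rfl
  rw [pairVec, coupleRight, basisFamily, e, show (Fin.last 1 : Fin 2) = 1 from rfl]
  by_cases h : (m 1 : ℤ) - m 0 = p
  · rw [if_pos h, if_pos (by omega), show (m 1 : ℤ) - p = m 0 by omega, mul_one]
  · rw [if_neg h, if_neg (by omega), mul_zero]

lemma isUnitFamily_basisFamily : IsUnitFamily basisFamily := by
  intro y p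
  rw [← (Equiv.funUnique (Fin 1) ℕ).symm.hasSum_iff]
  by_cases hy : 0 ≤ y
  · lift y to ℕ using hy
    refine hasSum_of_eq (hasSum_ite_eq y (1 : ℝ)) (fun n => ?_) (by simp)
    simp only [Function.comp_apply, basisFamily, Equiv.funUnique_symm_apply, uniqueElim_const,
      Nat.cast_inj, ite_pow, one_pow, ne_eq, OfNat.ofNat_ne_zero, not_false_eq_true, zero_pow]
    exact if_congr Iff.rfl rfl rfl
  · refine hasSum_of_eq hasSum_zero (fun n => ?_) (by simp [hy])
    have : (n : ℤ) ≠ y := by omega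
    simp [basisFamily, this]

lemma isCoupled_basisFamily : IsCoupled (fun _ => 1) basisFamily basisFamily := by
  intro y y' p p'
  by_cases h : y = y'
  · subst h
    refine hasSum_of_eq (isUnitFamily_basisFamily y p) (fun m => ?_) (by simp)
    rw [sq]
    rfl
  · refine hasSum_of_eq hasSum_zero (fun m => ?_) (by simp [h])
    rw [basisFamily, basisFamily]
    split_ifs with h2 h3
    · exact absurd (h2.symm.trans h3) h
    all_goals simp

lemma isReduced_basisFamily (h0 : 0 < q) (h1 : q < 1) :
    IsReduced q (fun u _ => if u = 0 then 1 else 0) basisFamily (pairVec q) := by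
  intro n μ z p p'
  rw [← (Equiv.funUnique (Fin 1) ℕ).symm.hasSum_iff]
  by_cases hy : 0 ≤ μ
  · lift μ to ℕ using hy
    refine hasSum_of_eq (hasSum_ite_eq μ (cg q z n μ * if (μ : ℤ) - n - p' = 0 then 1 else 0))
      (fun k => ?_) rfl
    have e1 : (Fin.cons n ((Equiv.funUnique (Fin 1) ℕ).symm k) : Fin 2 → ℕ) 0 = n := rfl
    have e2 : (Fin.cons n ((Equiv.funUnique (Fin 1) ℕ).symm k) : Fin 2 → ℕ) 1 = k := rfl
    have e3 : (Equiv.funUnique (Fin 1) ℕ).symm k 0 = k := rfl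
    rw [Function.comp_apply, basisFamily, pairVec, e1, e2, e3, clebsch_eq_cg h0 h1]
    by_cases h : k = μ
    · subst h
      rw [if_pos rfl, if_pos rfl, one_mul, mul_ite, mul_one, mul_zero]
      exact if_congr (by omega) rfl rfl
    · rw [if_neg h, if_neg (by omega), zero_mul]
  · refine hasSum_of_eq hasSum_zero (fun k => ?_) ?_
    · have e3 : (Equiv.funUnique (Fin 1) ℕ).symm k 0 = k := rfl
      rw [Function.comp_apply, basisFamily, e3, if_neg (by omega), zero_mul]
    · rw [cg_of_neg q (by omega), zero_mul]

/-! ### Expansion of a unit vector in an orthonormal system -/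

/-- For a unit vector the squared distance to a partial sum is 1 minus the partial sum of squared
coefficients. Parseval's equality for the single vector $v$ thus suffices; the system need not be
complete. -/
lemma hasSum_smul_of_orthonormal {E T : Type*} [NormedAddCommGroup E] [InnerProductSpace ℝ E]
    {M : T → E} (hM : Orthonormal ℝ M) {v : E} (hv : ‖v‖ = 1)
    (h : HasSum (fun t => inner ℝ (M t) v ^ 2) 1) :
    HasSum (fun t => inner ℝ (M t) v • M t) v := by
  have key : ∀ s : Finset T, ‖∑ t ∈ s, inner ℝ (M t) v • M t - v‖ ^ 2 =
      1 - ∑ t ∈ s, inner ℝ (M t) v ^ 2 := by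
    intro s
    rw [norm_sub_sq_real, hv, ← real_inner_self_eq_norm_sq, hM.inner_sum, sum_inner]
    simp only [real_inner_smul_left, conj_trivial, ← sq]
    ring
  have h2 : Tendsto (fun s : Finset T => ‖∑ t ∈ s, inner ℝ (M t) v • M t - v‖ ^ 2) atTop (𝓝 0) := by
    simp only [key]
    have h' : Tendsto (fun s : Finset T => ∑ t ∈ s, inner ℝ (M t) v ^ 2) atTop (𝓝 1) := h
    simpa using h'.const_sub 1
  show Tendsto (fun s : Finset T => ∑ t ∈ s, inner ℝ (M t) v • M t) atTop (𝓝 v)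
  rw [tendsto_iff_norm_sub_tendsto_zero]
  have h3 := (Real.continuous_sqrt.tendsto 0).comp h2
  simpa [Function.comp_def, Real.sqrt_sq (norm_nonneg _)] using h3

lemma hasSum_expansion {I T : Type*} {M : T → I → ℝ} {u v : I → ℝ} {a b : T → ℝ} {S : ℝ}
    (hM : ∀ t, HasSum (fun i => M t i ^ 2) 1)
    (hMM : ∀ t t', t ≠ t' → HasSum (fun i => M t i * M t' i) 0)
    (hv : HasSum (fun i => v i ^ 2) 1) (hu : Summable fun i => u i ^ 2)
    (ha : ∀ t, HasSum (fun i => M t i * v i) (a t)) (ha2 : HasSum (fun t => a t ^ 2) 1)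
    (hb : ∀ t, HasSum (fun i => u i * M t i) (b t)) (hS : HasSum (fun i => u i * v i) S) :
    HasSum (fun t => a t * b t) S := by
  have mem : ∀ {w : I → ℝ}, Summable (fun i => w i ^ 2) → Memℓp w 2 := by
    intro w hw
    refine memℓp_gen ?_
    simpa using hw
  let M' : T → lp (fun _ : I => ℝ) 2 := fun t => ⟨M t, mem (hM t).summable⟩
  let v' : lp (fun _ : I => ℝ) 2 := ⟨v, mem hv.summable⟩
  let u' : lp (fun _ : I => ℝ) 2 := ⟨u, mem hu⟩
  have inn : ∀ (f g : lp (fun _ : I => ℝ) 2) (s : ℝ), HasSum (fun i => f i * g i) s →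
      inner ℝ f g = s := by
    intro f g s hs
    refine (lp.hasSum_inner f g).unique (hasSum_of_eq hs (fun i => ?_) rfl)
    rw [real_inner_eq_re_inner, RCLike.inner_apply]
    simp [mul_comm]
  have orth : Orthonormal ℝ M' := by
    classical
    rw [orthonormal_iff_ite]
    intro t t'
    split_ifs with h
    · subst h
      exact inn _ _ _ (hasSum_of_eq (hM t) (fun i => (sq _).symm) rfl)
    · exact inn _ _ _ (hMM t t' h)
  have nv : ‖v'‖ = 1 := by
    have h : ‖v'‖ ^ 2 = 1 := by
      rw [← real_inner_self_eq_norm_sq]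
      exact inn _ _ _ (hasSum_of_eq hv (fun i => (sq _).symm) rfl)
    exact (pow_eq_one_iff_of_nonneg (norm_nonneg _) two_ne_zero).1 h
  have ea : ∀ t, inner ℝ (M' t) v' = a t := fun t => inn _ _ _ (ha t)
  have h := (hasSum_smul_of_orthonormal orth nv (by simpa only [ea] using ha2)).mapL
    (innerSL ℝ u')
  rw [innerSL_apply_apply, inn u' v' S hS] at h
  refine hasSum_of_eq h (fun t => ?_) rfl
  rw [innerSL_apply_apply, inner_smul_right, ea, inn u' (M' t) (b t) (hb t)]

/-! ### Products of recoupling coefficients -/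

lemma hasSum_mul_init_snoc {α : Type*} {d : ℕ} {v w : (Fin (d + 1) → α) → ℝ}
    {g : (Fin d → α) → ℝ} {S : ℝ} (hv : Summable fun x => v x ^ 2)
    (hw : Summable fun x => w x ^ 2)
    (hg : ∀ m : Fin d → α, HasSum (fun a => v (Fin.snoc m a) * w (Fin.snoc m a)) (g m))
    (h : HasSum g S) : HasSum (fun x => v x * w x) S := by
  exact hasSum_init_snoc_iff.1 <| hasSum_mul_prod
    (v := fun x : (Fin d → α) × α => v (Fin.snoc x.1 x.2))
    (w := fun x : (Fin d → α) × α => w (Fin.snoc x.1 x.2))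
    (hasSum_init_snoc_iff.2 hv.hasSum).summable (hasSum_init_snoc_iff.2 hw.hasSum).summable hg h

lemma cons_castSucc {m : ℕ} (a : ℤ) (T : Fin (m + 1) → ℤ) (i : Fin (m + 1)) :
    (Fin.cons a T : Fin (m + 2) → ℤ) i.castSucc = (Fin.cons a (Fin.init T) : Fin (m + 1) → ℤ) i := by
  induction i using Fin.cases with
  | zero => rfl
  | succ i => rfl

lemma tail_snoc {m : ℕ} (f : Fin (m + 1) → ℤ) (a : ℤ) :
    Fin.tail (Fin.snoc f a : Fin (m + 2) → ℤ) = (Fin.snoc (Fin.tail f) a : Fin (m + 1) → ℤ) := by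
  funext i
  induction i using Fin.lastCases with
  | last => rw [Fin.snoc_last, Fin.tail, Fin.succ_last, Fin.snoc_last]
  | cast i =>
    rw [Fin.snoc_castSucc, Fin.tail, Fin.succ_castSucc, Fin.snoc_castSucc]
    rfl

lemma leftLabel_succ {k : ℕ} (s : Fin (k + 1) → ℤ) (n : Fin (k + 3) → ℤ) :
    leftLabel s n = n (Fin.last (k + 2)) - s (Fin.last k) := rfl

lemma leftLabel_zero (s : Fin 0 → ℤ) (n : Fin 2 → ℤ) : leftLabel s n = n 1 - n 0 := rfl

lemma rightLabel_succ {k : ℕ} (r : Fin (k + 1) → ℤ) (n : Fin (k + 3) → ℤ) :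
    rightLabel r n = r 0 - n 0 := rfl

lemma rightLabel_zero (r : Fin 0 → ℤ) (n : Fin 2 → ℤ) : rightLabel r n = n 1 - n 0 := rfl

/-- The coupling coefficient of a mixed tree and a left tree as a product of recoupling
coefficients. -/
def prodS (q : ℝ) {m : ℕ} (x : ℤ) (n : Fin (m + 2) → ℤ) (T s : Fin m → ℤ) : ℝ :=
  ∏ j : Fin m, recCoeff q
    ((Fin.snoc s x : Fin (m + 1) → ℤ) j.succ - n 0 + (Fin.cons (n 1) T : Fin (m + 1) → ℤ) j.castSucc
      - n j.succ.succ)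
    (s j + T j - n 0 - n j.succ.succ)

/-- The coupling coefficient of a right tree and a left tree as a product of recoupling
coefficients. -/
def prodR (q : ℝ) {m : ℕ} (x : ℤ) (n : Fin (m + 2) → ℤ) (r s : Fin m → ℤ) : ℝ :=
  ∏ j : Fin m, recCoeff q
    (x + n j.succ.castSucc - (Fin.snoc r (n (Fin.last (m + 1))) : Fin (m + 1) → ℤ) j.succ
      - (Fin.cons (n 0) s : Fin (m + 1) → ℤ) j.castSucc)
    (r j - (Fin.snoc r (n (Fin.last (m + 1))) : Fin (m + 1) → ℤ) j.succ + s j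
      - (Fin.cons (n 0) s : Fin (m + 1) → ℤ) j.castSucc)

lemma prodS_succ (q : ℝ) {k : ℕ} (x : ℤ) (n : Fin (k + 3) → ℤ) (T s : Fin (k + 1) → ℤ) :
    prodS q x n T s = prodS q (s (Fin.last k)) (Fin.init n) (Fin.init T) (Fin.init s) *
      recCoeff q (x - n 0 - leftLabel (Fin.init T) (Fin.tail n))
        (T (Fin.last k) - n 0 - leftLabel s n) := by
  rw [prodS, Fin.prod_univ_castSucc, prodS, leftLabel_succ, leftLabel]
  congr 1
  · refine Finset.prod_congr rfl fun j _ => ?_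
    rw [cons_castSucc, Fin.snoc_init_self, Fin.succ_castSucc, Fin.snoc_castSucc]
    rfl
  · rw [cons_castSucc, Fin.succ_last, Fin.snoc_last, Fin.succ_last]
    congr 1
    · show _ = x - n 0 - (n (Fin.last (k + 2)) -
        (Fin.cons (n 1) (Fin.init T) : Fin (k + 1) → ℤ) (Fin.last k))
      ring
    · ring

/-- The last factor belongs to the lowest node $r_{k+1}$ of the right tree. The remaining factors
are those of the tree in which its two leaves are replaced by a leaf labelled $r_{k+1}$. -/
lemma prodR_succ (q : ℝ) {k : ℕ} (x : ℤ) (n : Fin (k + 3) → ℤ) (r s : Fin (k + 1) → ℤ) :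
    prodR q x n r s =
      prodR q x (Fin.snoc (Fin.init (Fin.init n)) (r (Fin.last k)) : Fin (k + 2) → ℤ)
        (Fin.init r) (Fin.init s) *
      recCoeff q (x + n (Fin.last (k + 1)).castSucc - n (Fin.last (k + 2))
          - (Fin.cons (n 0) (Fin.init s) : Fin (k + 1) → ℤ) (Fin.last k))
        (r (Fin.last k) - n (Fin.last (k + 2)) + s (Fin.last k)
          - (Fin.cons (n 0) (Fin.init s) : Fin (k + 1) → ℤ) (Fin.last k)) := by
  rw [prodR, Fin.prod_univ_castSucc, prodR]
  congr 1
  · refine Finset.prod_congr rfl fun j _ => ?_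
    rw [cons_castSucc, Fin.snoc_last, Fin.snoc_init_self, Fin.succ_castSucc, Fin.snoc_castSucc,
      Fin.snoc_castSucc]
    rfl
  · rw [cons_castSucc, Fin.succ_last, Fin.snoc_last]

lemma prodS_zero (q : ℝ) (x : ℤ) (n : Fin 2 → ℤ) (T s : Fin 0 → ℤ) : prodS q x n T s = 1 := rfl

lemma prodR_zero (q : ℝ) (x : ℤ) (n : Fin 2 → ℤ) (r s : Fin 0 → ℤ) : prodR q x n r s = 1 := rfl

/-- The last variable enters only through one shifted second argument, so summing it first gives 1
by `hasSum_recCoeff_sq`, whatever the other variables are. -/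
lemma hasSum_sq_of_snoc (h0 : 0 < q) (h1 : q < 1) {m : ℕ} {F : (Fin (m + 1) → ℤ) → ℝ}
    {G : (Fin m → ℤ) → ℝ} {A B : (Fin m → ℤ) → ℤ}
    (hF : ∀ t τ, F (Fin.snoc t τ) = G t * recCoeff q (A t) (τ + B t))
    (hG : HasSum (fun t => G t ^ 2) 1) : HasSum (fun t => F t ^ 2) 1 := by
  rw [← hasSum_init_snoc_iff]
  refine hasSum_prod_of_nonneg (fun x => sq_nonneg _) (fun t => ?_) hG
  have h := ((Equiv.addRight (B t)).hasSum_iff.2 (hasSum_recCoeff_sq h0 h1 (A t))).mul_left (G t ^ 2)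
  refine hasSum_of_eq h (fun τ => ?_) (mul_one _)
  rw [hF, mul_pow]
  rfl

lemma hasSum_prodS_sq (h0 : 0 < q) (h1 : q < 1) {m : ℕ} (x : ℤ) (n : Fin (m + 2) → ℤ)
    (s : Fin m → ℤ) : HasSum (fun T => prodS q x n T s ^ 2) 1 := by
  induction m generalizing x with
  | zero =>
    simp only [prodS_zero, one_pow]
    exact hasSum_unique _
  | succ k ih =>
    refine hasSum_sq_of_snoc h0 h1 (A := fun t => x - n 0 - leftLabel t (Fin.tail n))
      (B := fun _ => - n 0 - leftLabel s n) (fun t τ => ?_)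
      (ih (s (Fin.last k)) (Fin.init n) (Fin.init s))
    rw [prodS_succ, Fin.init_snoc, Fin.snoc_last]
    congr 2
    ring

lemma hasSum_prodR_sq (h0 : 0 < q) (h1 : q < 1) {m : ℕ} (x : ℤ) (n : Fin (m + 2) → ℤ)
    (r : Fin m → ℤ) : HasSum (fun s => prodR q x n r s ^ 2) 1 := by
  induction m with
  | zero =>
    simp only [prodR_zero, one_pow]
    exact hasSum_unique _
  | succ k ih =>
    refine hasSum_sq_of_snoc h0 h1
      (A := fun t => x + n (Fin.last (k + 1)).castSucc - n (Fin.last (k + 2))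
          - (Fin.cons (n 0) t : Fin (k + 1) → ℤ) (Fin.last k))
      (B := fun t => r (Fin.last k) - n (Fin.last (k + 2))
          - (Fin.cons (n 0) t : Fin (k + 1) → ℤ) (Fin.last k)) (fun t τ => ?_)
      (ih (Fin.snoc (Fin.init (Fin.init n)) (r (Fin.last k)) : Fin (k + 2) → ℤ) (Fin.init r))
    rw [prodR_succ, Fin.init_snoc, Fin.snoc_last]
    congr 2
    ring

/-- The expansion of the product `prodR` in products with one factor less. -/
lemma hasSum_prodS_mul_prodR (h0 : 0 < q) (h1 : q < 1) {k : ℕ} (x : ℤ) (n : Fin (k + 3) → ℤ)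
    (r s : Fin (k + 1) → ℤ) :
    HasSum (fun t : Fin k → ℤ => prodS q x n (Fin.snoc t (r 0) : Fin (k + 1) → ℤ) s *
      prodR q (r 0) (Fin.tail n) (Fin.tail r) t) (prodR q x n r s) := by
  induction k with
  | zero =>
    refine hasSum_of_eq (hasSum_unique _) (fun t => rfl) ?_
    rw [prodR_zero, mul_one, prodS_succ, prodR_succ, prodS_zero, prodR_zero, leftLabel_succ,
      leftLabel_zero]
    congr 2
    · show x - n 0 - (n 2 - n 1) = x + n 1 - n 2 - n 0
      ring
    · show r 0 - n 0 - (n 2 - s 0) = r 0 - n 2 + s 0 - n 0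
      ring
  | succ k ih =>
    have hS : Summable fun t : Fin (k + 1) → ℤ =>
        prodS q x n (Fin.snoc t (r 0) : Fin (k + 2) → ℤ) s ^ 2 :=
      (hasSum_prodS_sq h0 h1 x n s).summable.comp_injective
        (Fin.snoc_left_injective (α := fun _ => ℤ) (r 0))
    have hR := (hasSum_prodR_sq h0 h1 (r 0) (Fin.tail n) (Fin.tail r)).summable
    -- Leaves of the reduced tree: the last two are replaced by their parent in the right tree.
    let n' : Fin (k + 3) → ℤ := Fin.snoc (Fin.init (Fin.init n)) (r (Fin.last (k + 1)))
    have ht : Fin.tail n' = (Fin.snoc (Fin.init (Fin.init (Fin.tail n))) (r (Fin.last (k + 1))) :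
        Fin (k + 2) → ℤ) := tail_snoc _ _
    set F := recCoeff q (x + n (Fin.last (k + 2)).castSucc - n (Fin.last (k + 3))
          - s (Fin.last k).castSucc)
        (r (Fin.last (k + 1)) - n (Fin.last (k + 3)) + s (Fin.last (k + 1))
          - s (Fin.last k).castSucc) with hF
    refine hasSum_mul_init_snoc hS hR
      (g := fun t => F * (prodS q x n' (Fin.snoc t (r 0) : Fin (k + 1) → ℤ) (Fin.init s) *
      prodR q (r 0) (Fin.tail n') (Fin.tail (Fin.init r)) t))
      (fun t => ?_) ?_
    -- Only three factors contain the last component $\tau$ of $\mathbf t$: the last two of `prodS`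
    -- and the last of `prodR`. The pentagon relation replaces their sum by `F` times the last
    -- factor of `prodS` for `n'`.
    · have h := (hasSum_recCoeff_pentagon h0 h1 x (n 0) (r 0) (n (Fin.last (k + 2)).castSucc)
        (n (Fin.last (k + 3))) (r (Fin.last (k + 1))) (s (Fin.last k).castSucc)
        ((Fin.cons (n 1) t : Fin (k + 1) → ℤ) (Fin.last k)) (s (Fin.last (k + 1)))).mul_left
        (prodS q (s (Fin.last k).castSucc) (Fin.init (Fin.init n)) t (Fin.init (Fin.init s)) *
          prodR q (r 0) (Fin.tail n') (Fin.tail (Fin.init r)) t)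
      refine hasSum_of_eq h (fun τ => ?_) ?_
      · rw [prodS_succ, Fin.init_snoc, Fin.snoc_last, prodS_succ, Fin.init_snoc, Fin.snoc_last,
          prodR_succ, Fin.init_snoc, Fin.snoc_last, leftLabel_succ (Fin.snoc t τ : Fin (k + 1) → ℤ),
          Fin.snoc_last, ht]
        show prodS q (s (Fin.last k).castSucc) (Fin.init (Fin.init n)) t (Fin.init (Fin.init s)) *
          recCoeff q (s (Fin.last (k + 1)) - n 0 - (n (Fin.last (k + 2)).castSucc -
              (Fin.cons (n 1) t : Fin (k + 1) → ℤ) (Fin.last k)))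
            (τ - n 0 - (n (Fin.last (k + 2)).castSucc - s (Fin.last k).castSucc)) *
          recCoeff q (x - n 0 - (n (Fin.last (k + 3)) - τ))
            (r 0 - n 0 - (n (Fin.last (k + 3)) - s (Fin.last (k + 1)))) *
          (prodR q (r 0) (Fin.snoc (Fin.init (Fin.init (Fin.tail n))) (r (Fin.last (k + 1))) :
              Fin (k + 2) → ℤ) (Fin.tail (Fin.init r)) t *
            recCoeff q (r 0 + n (Fin.last (k + 2)).castSucc - n (Fin.last (k + 3)) -
                (Fin.cons (n 1) t : Fin (k + 1) → ℤ) (Fin.last k))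
              (r (Fin.last (k + 1)) - n (Fin.last (k + 3)) + τ -
                (Fin.cons (n 1) t : Fin (k + 1) → ℤ) (Fin.last k))) = _
        simp only [sub_sub_eq_add_sub, add_sub_right_comm]
        ring_nf
      · rw [prodS_succ, Fin.init_snoc, Fin.snoc_last, leftLabel_succ, leftLabel, ht, Fin.snoc_last,
          show (n' (Fin.last (k + 2))) = r (Fin.last (k + 1)) from Fin.snoc_last _ _,
          Fin.init_snoc]
        show _ = F * (prodS q (s (Fin.last k).castSucc) (Fin.init (Fin.init n)) t
          (Fin.init (Fin.init s)) * recCoeff q (x - n 0 - (r (Fin.last (k + 1)) -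
              (Fin.cons (n 1) t : Fin (k + 1) → ℤ) (Fin.last k)))
            (r 0 - n 0 - (r (Fin.last (k + 1)) - s (Fin.last k).castSucc)) *
          prodR q (r 0) (Fin.snoc (Fin.init (Fin.init (Fin.tail n))) (r (Fin.last (k + 1))) :
              Fin (k + 2) → ℤ) (Fin.tail (Fin.init r)) t)
        simp only [hF, sub_sub_eq_add_sub, add_sub_right_comm]
        ring_nf
    · rw [prodR_succ]
      refine hasSum_of_eq ((ih n' (Fin.init r) (Fin.init s)).mul_left F) (fun t => rfl) ?_
      rw [mul_comm]
      rfl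

/-! ### Coupling coefficients of trees -/

lemma isUnitFamily_pairVec (h0 : 0 < q) (h1 : q < 1) : IsUnitFamily (pairVec q) := by
  rw [pairVec_eq_coupleRight q 0]
  exact isUnitFamily_basisFamily.coupleRight h0 h1 0

lemma isUnitFamily_leftFamily (h0 : 0 < q) (h1 : q < 1) (k : ℕ) (x : ℤ) (s : Fin k → ℤ)
    (n : Fin (k + 2) → ℤ) : IsUnitFamily (leftFamily q k x s n) := by
  induction k generalizing x with
  | zero => exact isUnitFamily_pairVec h0 h1
  | succ k ih => exact (ih _ _ _).coupleRight h0 h1 _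

lemma isUnitFamily_rightFamily (h0 : 0 < q) (h1 : q < 1) (k : ℕ) (x : ℤ) (r : Fin k → ℤ)
    (n : Fin (k + 2) → ℤ) : IsUnitFamily (rightFamily q k x r n) := by
  induction k generalizing x with
  | zero => exact isUnitFamily_pairVec h0 h1
  | succ k ih => exact (ih _ _ _).coupleLeft h0 h1 _

lemma isCoupled_pairVec (h0 : 0 < q) (h1 : q < 1) :
    IsCoupled (fun u => if u = 0 then 1 else 0) (pairVec q) (pairVec q) := by
  rw [pairVec_eq_coupleRight q 0]
  exact isCoupled_basisFamily.coupleRight h0 h1 isUnitFamily_basisFamily isUnitFamily_basisFamily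
    0 0

/-- Left trees with the same root and the same leaves are orthonormal. -/
lemma exists_isCoupled_left_left (h0 : 0 < q) (h1 : q < 1) (k : ℕ) (x x' : ℤ)
    (s s' : Fin k → ℤ) (n : Fin (k + 2) → ℤ) :
    ∃ c, IsCoupled c (leftFamily q k x s n) (leftFamily q k x' s' n) ∧
      (x = x' → c (leftLabel s n - leftLabel s' n) = if s = s' then 1 else 0) := by
  induction k generalizing x x' with
  | zero =>
    refine ⟨_, isCoupled_pairVec h0 h1, fun _ => ?_⟩
    rw [Subsingleton.elim s s', sub_self, if_pos rfl, if_pos rfl]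
  | succ k ih =>
    obtain ⟨c, hc, hv⟩ := ih (s (Fin.last k)) (s' (Fin.last k)) (Fin.init s) (Fin.init s')
      (Fin.init n)
    refine ⟨_, hc.coupleRight h0 h1 (isUnitFamily_leftFamily h0 h1 _ _ _ _)
      (isUnitFamily_leftFamily h0 h1 _ _ _ _) _ _, fun hx => ?_⟩
    subst hx
    simp only [leftLabel_succ, sub_sub_sub_cancel_left, add_sub_add_right_eq_sub,
      sub_sub_sub_cancel_right]
    by_cases hl : s (Fin.last k) = s' (Fin.last k)
    · rw [if_pos (by omega), hv hl]
      refine if_congr ⟨fun h => ?_, fun h => by rw [h]⟩ rfl rfl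
      rw [← Fin.snoc_init_self s, ← Fin.snoc_init_self s', h, hl]
    · rw [if_neg (by omega), if_neg (fun h => hl (by rw [h]))]

/-- The reduced matrix elements of left trees. -/
lemma exists_isReduced_left (h0 : 0 < q) (h1 : q < 1) (k : ℕ) (x : ℤ) (n : Fin (k + 3) → ℤ)
    (T s : Fin (k + 1) → ℤ) :
    ∃ c, IsReduced q c (leftFamily q k (T (Fin.last k)) (Fin.init T) (Fin.tail n))
        (leftFamily q (k + 1) x s n) ∧
      c (T (Fin.last k) - n 0 - leftLabel s n)
        (-(x - n 0 - leftLabel (Fin.init T) (Fin.tail n))) = prodS q x n T s := by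
  induction k generalizing x with
  | zero =>
    have h := (isReduced_basisFamily h0 h1).coupleRight h0 h1 isUnitFamily_basisFamily
      (isUnitFamily_pairVec h0 h1) 0
      (leftLabel (Fin.init s) (Fin.init n) + x - n (Fin.last 2))
    rw [← pairVec_eq_coupleRight] at h
    refine ⟨_, h, ?_⟩
    rw [prodS_succ, prodS_zero, neg_neg, one_mul, if_pos, mul_one]
    rw [leftLabel_zero, leftLabel_zero]
    show x - n 0 - (n 2 - n 1) - (n 1 - n 0 + x - n 2) = 0
    ring
  | succ k ih =>
    obtain ⟨c, hc, hv⟩ := ih (s (Fin.last (k + 1))) (Fin.init n) (Fin.init T) (Fin.init s)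
    have h := hc.coupleRight h0 h1 (isUnitFamily_leftFamily h0 h1 _ _ _ _)
      (isUnitFamily_leftFamily h0 h1 _ _ _ _)
      (leftLabel (Fin.init (Fin.init T)) (Fin.init (Fin.tail n)) + T (Fin.last (k + 1)) -
        Fin.tail n (Fin.last (k + 2)))
      (leftLabel (Fin.init s) (Fin.init n) + x - n (Fin.last (k + 3)))
    refine ⟨_, h, ?_⟩
    rw [prodS_succ, neg_neg, mul_comm, ← hv]
    congr 2
    · rw [leftLabel_succ (Fin.init T)]
      show x - n 0 - (n (Fin.last (k + 3)) - _) - _ = _ - n 0 - _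
      ring
    · rw [leftLabel_succ s]
      show leftLabel _ (Fin.tail (Fin.init n)) + T (Fin.last (k + 1)) - n (Fin.last (k + 3)) - _ =
        -(_ - n 0 - _)
      ring

/-- The family of the mixed tree with root `x`, leaves `n` and inner nodes `T`. -/
def mixedFamily (q : ℝ) {k : ℕ} (x : ℤ) (T : Fin (k + 1) → ℤ) (n : Fin (k + 3) → ℤ) :
    ℤ → ℤ → (Fin (k + 3) → ℕ) → ℝ :=
  coupleLeft q (x - n 0 - leftLabel (Fin.init T) (Fin.tail n))
    (leftFamily q k (T (Fin.last k)) (Fin.init T) (Fin.tail n))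

lemma isUnitFamily_mixedFamily (h0 : 0 < q) (h1 : q < 1) {k : ℕ} (x : ℤ) (T : Fin (k + 1) → ℤ)
    (n : Fin (k + 3) → ℤ) : IsUnitFamily (mixedFamily q x T n) :=
  (isUnitFamily_leftFamily h0 h1 _ _ _ _).coupleLeft h0 h1 _

/-- The common shift $c$ of both labels is harmless, as inner products depend only on $p-p'$. It
makes the expansion in mixed trees available for every member of the left family, as the induction
for right trees requires. -/
lemma hasSum_mixed_mul_left (h0 : 0 < q) (h1 : q < 1) {k : ℕ} (x : ℤ) (n : Fin (k + 3) → ℤ)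
    (T s : Fin (k + 1) → ℤ) {y : ℤ} (hy : 0 ≤ y) (c : ℤ) :
    HasSum (fun m => mixedFamily q x T n y (T (Fin.last k) - n 0 + c) m *
      leftFamily q (k + 1) x s n y (leftLabel s n + c) m) (prodS q x n T s) := by
  obtain ⟨C, hC, hv⟩ := exists_isReduced_left h0 h1 k x n T s
  have h := hC.isCoupled h0 h1 (isUnitFamily_leftFamily h0 h1 _ _ _ _)
    (isUnitFamily_leftFamily h0 h1 _ _ _ _) (x - n 0 - leftLabel (Fin.init T) (Fin.tail n))
    y y (T (Fin.last k) - n 0 + c) (leftLabel s n + c)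
  rw [if_pos ⟨rfl, hy⟩, add_sub_add_right_eq_sub] at h
  exact hasSum_of_eq h (fun _ => rfl) hv

lemma hasSum_mixed_mul_mixed (h0 : 0 < q) (h1 : q < 1) {k : ℕ} (x : ℤ) (n : Fin (k + 3) → ℤ)
    {T T' : Fin (k + 1) → ℤ} (hT : T ≠ T') (y c : ℤ) :
    HasSum (fun m => mixedFamily q x T n y (T (Fin.last k) - n 0 + c) m *
      mixedFamily q x T' n y (T' (Fin.last k) - n 0 + c) m) 0 := by
  obtain ⟨C, hC, hv⟩ := exists_isCoupled_left_left h0 h1 k (T (Fin.last k)) (T' (Fin.last k))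
    (Fin.init T) (Fin.init T') (Fin.tail n)
  refine hasSum_of_eq (hC.coupleLeft h0 h1 (isUnitFamily_leftFamily h0 h1 _ _ _ _)
    (isUnitFamily_leftFamily h0 h1 _ _ _ _) (x - n 0 - leftLabel (Fin.init T) (Fin.tail n))
    (x - n 0 - leftLabel (Fin.init T') (Fin.tail n)) y y (T (Fin.last k) - n 0 + c)
    (T' (Fin.last k) - n 0 + c)) (fun m => rfl) ?_
  simp only [add_sub_add_right_eq_sub, sub_sub_sub_cancel_left, sub_sub_sub_cancel_right]
  split_ifs with h h2
  · have hl : T (Fin.last k) = T' (Fin.last k) := by omega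
    rw [hv hl, if_neg]
    intro h3
    apply hT
    rw [← Fin.snoc_init_self T, ← Fin.snoc_init_self T', h3, hl]
  · rfl
  · rfl

/-- The expansion of a left tree in mixed trees. -/
lemma hasSum_prodS_mul (h0 : 0 < q) (h1 : q < 1) {k : ℕ} (x : ℤ) (n : Fin (k + 3) → ℤ)
    (s : Fin (k + 1) → ℤ) {y : ℤ} (hy : 0 ≤ y) (c : ℤ) {u : (Fin (k + 3) → ℕ) → ℝ}
    (hu : Summable fun m => u m ^ 2) {b : (Fin (k + 1) → ℤ) → ℝ}
    (hb : ∀ T, HasSum (fun m => u m * mixedFamily q x T n y (T (Fin.last k) - n 0 + c) m) (b T)) :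
    HasSum (fun T => prodS q x n T s * b T)
      (coupling u (leftFamily q (k + 1) x s n y (leftLabel s n + c))) := by
  have hl := isUnitFamily_leftFamily h0 h1 (k + 1) x s n y (leftLabel s n + c)
  refine hasSum_expansion (M := fun T => mixedFamily q x T n y (T (Fin.last k) - n 0 + c))
    (fun T => ?_) (fun T T' hT => hasSum_mixed_mul_mixed h0 h1 x n hT y c) (by simpa [hy] using hl)
    hu (fun T => hasSum_mixed_mul_left h0 h1 x n T s hy c) (hasSum_prodS_sq h0 h1 x n s) hb
    (summable_mul_of_sq hu hl.summable).hasSum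
  simpa [hy] using isUnitFamily_mixedFamily h0 h1 x T n y (T (Fin.last k) - n 0 + c)

/-- The coupling coefficients of right trees and left trees. -/
lemma exists_isCoupled_right_left (h0 : 0 < q) (h1 : q < 1) (k : ℕ) (x x' : ℤ)
    (r s : Fin k → ℤ) (n n' : Fin (k + 2) → ℤ) :
    ∃ c, IsCoupled c (rightFamily q k x r n) (leftFamily q k x' s n') ∧
      (x = x' → n = n' → c (rightLabel r n - leftLabel s n') = prodR q x n r s) := by
  induction k generalizing x x' with
  | zero =>
    refine ⟨_, isCoupled_pairVec h0 h1, fun _ hn => ?_⟩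
    rw [hn, rightLabel_zero, leftLabel_zero, sub_self, if_pos rfl, prodR_zero]
  | succ k ih =>
    choose C hC hv using fun T : Fin (k + 1) → ℤ => ih (r 0) (T (Fin.last k)) (Fin.tail r)
      (Fin.init T) (Fin.tail n) (Fin.tail n')
    let e : (Fin (k + 1) → ℤ) → ℝ := fun T =>
      C T (x' - n' 0 - leftLabel (Fin.init T) (Fin.tail n') -
        (x - n 0 - rightLabel (Fin.tail r) (Fin.tail n)))
    -- Inner product of the right tree with the mixed tree of `T`, as a function of the label
    -- difference $u$. At the labels of the trees themselves only `T` with last entry `r 0`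
    -- contributes.
    let b : ℤ → (Fin (k + 1) → ℤ) → ℝ := fun u T =>
      if u - (T (Fin.last k) - n' 0 - leftLabel s n') = 0 then e T else 0
    have key : ∀ y y' p p', 0 ≤ y' → HasSum (fun T => prodS q x' n' T s *
        if y = y' ∧ 0 ≤ y then b (p - p') T else 0)
        (coupling (rightFamily q (k + 1) x r n y p) (leftFamily q (k + 1) x' s n' y' p')) := by
      intro y y' p p' hy'
      have h := hasSum_prodS_mul h0 h1 x' n' s hy' (p' - leftLabel s n')
        ((isUnitFamily_rightFamily h0 h1 (k + 1) x r n).summable y p) (fun T =>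
        (hC T).coupleLeft h0 h1 (isUnitFamily_rightFamily h0 h1 _ _ _ _)
          (isUnitFamily_leftFamily h0 h1 _ _ _ _) (x - n 0 - rightLabel (Fin.tail r) (Fin.tail n))
          (x' - n' 0 - leftLabel (Fin.init T) (Fin.tail n')) y y' p
          (T (Fin.last k) - n' 0 + (p' - leftLabel s n')))
      rw [add_sub_cancel] at h
      refine hasSum_of_eq h (fun T => ?_) rfl
      congr 2
      show (if _ then _ else _) = (if _ then _ else _)
      rw [show p - p' - (T (Fin.last k) - n' 0 - leftLabel s n') =
        p - (T (Fin.last k) - n' 0 + (p' - leftLabel s n')) by ring]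
    have hb : ∀ u, HasSum (fun T => prodS q x' n' T s * b u T) (∑' T, prodS q x' n' T s * b u T) := by
      intro u
      have h := key 0 0 u 0 le_rfl
      simp only [sub_zero, le_refl, and_self, if_true] at h
      exact h.summable.hasSum
    refine ⟨fun u => ∑' T, prodS q x' n' T s * b u T, fun y y' p p' => ?_, fun hx hn => ?_⟩
    · have uf := (isUnitFamily_rightFamily h0 h1 (k + 1) x r n)
      have ug := (isUnitFamily_leftFamily h0 h1 (k + 1) x' s n')
      have hs := (summable_mul_of_sq (uf.summable y p) (ug.summable y' p')).hasSum
      by_cases hy' : 0 ≤ y'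
      · refine hasSum_of_eq hs (fun _ => rfl) ((key y y' p p' hy').unique ?_)
        split_ifs with h
        · exact hb (p - p')
        · simp only [mul_zero]
          exact hasSum_zero
      -- At negative levels the left family vanishes, while the expansion in mixed trees is
      -- available only at levels $y'\ge0$.
      · refine hasSum_of_eq hasSum_zero (fun m => ?_) ?_
        · rw [ug.eq_zero (by omega), mul_zero]
        · rw [if_neg (by omega)]
    · subst hx hn
      refine HasSum.tsum_eq ?_
      rw [← hasSum_init_snoc_iff]
      have h := hasSum_prodS_mul_prodR h0 h1 x n r s
      have hinj : Function.Injective fun t : Fin k → ℤ => (t, r 0) :=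
        fun t t' h => congrArg Prod.fst h
      -- The sum over `T` collapses to $\tau=$ `r 0`; by the induction hypothesis what is left is
      -- the expansion of `prodR` already proved for products.
      refine (hinj.hasSum_iff fun tτ htτ => ?_).1 (hasSum_of_eq h (fun t => ?_) rfl)
      · have hne : tτ.2 ≠ r 0 := fun h => htτ ⟨tτ.1, by rw [← h]⟩
        show _ * (if _ then _ else _) = _
        rw [if_neg, mul_zero]
        rw [Fin.snoc_last, rightLabel_succ]
        omega
      · show _ * (if _ then _ else _) = _
        rw [if_pos]
        · show _ * C _ _ = _
          have hv' := hv (Fin.snoc t (r 0) : Fin (k + 1) → ℤ) (by rw [Fin.snoc_last]) rfl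
          rw [Fin.init_snoc] at hv'
          dsimp only
          rw [Fin.init_snoc, sub_sub_sub_cancel_left, hv']
        · rw [Fin.snoc_last, rightLabel_succ]
          ring

lemma symbolR_eq (h0 : 0 < q) (h1 : q < 1) {k : ℕ} (x : ℤ) (n : Fin (k + 2) → ℤ)
    (r s : Fin k → ℤ) : symbolR q x n r s = prodR q x n r s := by
  obtain ⟨c, hc, hv⟩ := exists_isCoupled_right_left h0 h1 k x x r s n n
  have h := hc (max x 0) (max x 0) (rightLabel r n) (leftLabel s n)
  rw [if_pos ⟨rfl, le_max_right _ _⟩, hv rfl rfl] at h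
  exact h.tsum_eq

lemma symbolS_eq (h0 : 0 < q) (h1 : q < 1) {k : ℕ} (x : ℤ) (n : Fin (k + 3) → ℤ)
    (T s : Fin (k + 1) → ℤ) : symbolS q x n T s = prodS q x n T s := by
  have h := hasSum_mixed_mul_left h0 h1 x n T s (le_max_right x 0) 0
  rw [add_zero, add_zero] at h
  exact h.tsum_eq

/-! ### Multivariate `q`-Bessel functions -/

lemma sum_succ_sub_castSucc {m : ℕ} (X : Fin (m + 1) → ℤ) :
    ∑ j : Fin m, (X j.succ - X j.castSucc) = X (Fin.last m) - X 0 := by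
  have h1 := Fin.sum_univ_succ X
  have h2 := Fin.sum_univ_castSucc X
  rw [Finset.sum_sub_distrib]
  omega

lemma prod_recCoeff_sqrt (h0 : 0 < q) {m : ℕ} (a u : Fin m → ℤ) :
    ∏ j, recCoeff (√q) (a j) (u j) = (-√q) ^ (∑ j, u j) * ∏ j, besselJ (a j) (q ^ u j) q := by
  have hne : -√q ≠ 0 := neg_ne_zero.2 (Real.sqrt_pos.2 h0).ne'
  have hz : (-√q) ^ (∑ j, u j) = ∏ j, (-√q) ^ u j := by
    have : ∀ s : Finset (Fin m), (-√q) ^ (∑ j ∈ s, u j) = ∏ j ∈ s, (-√q) ^ u j := by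
      intro s
      induction s using Finset.cons_induction with
      | empty => simp
      | cons i s hi ih => rw [Finset.sum_cons, Finset.prod_cons, zpow_add₀ hne, ih]
    exact this _
  rw [hz, ← Finset.prod_mul_distrib]
  simp only [recCoeff, Real.sq_sqrt h0.le]

/-- At $\sqrt q$ the base of the Bessel functions becomes $q$. The exponents of $-\sqrt q$ telescope
along both chains of nodes, which leaves only the labels at the root. -/
lemma prodR_sqrt (h0 : 0 < q) {k : ℕ} (x : ℤ) (n : Fin (k + 2) → ℤ) (r s : Fin k → ℤ) :
    prodR (√q) x n r s =
      (-√q) ^ (rightLabel r n - leftLabel s n) * besselJMulti (nuVec x n) r s q := by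
  have hl : nuVec x n (Fin.last (k + 1)) = n (Fin.last (k + 1)) := by simp [nuVec]
  have hz : nuVec x n 0 = n 0 := by simp [nuVec]
  have hm : ∀ j : Fin k, nuVec x n j.succ.castSucc = x + n j.succ.castSucc := by
    intro j
    rw [nuVec, if_neg]
    rintro (h | h)
    · exact Fin.succ_ne_zero j (Fin.castSucc_injective _ h)
    · exact (Fin.castSucc_lt_last _).ne h
  rw [prodR, prod_recCoeff_sqrt h0, besselJMulti]
  simp only [hl, hz, hm, Fin.snoc_castSucc, Fin.cons_succ]
  congr 2
  have e1 := sum_succ_sub_castSucc (Fin.snoc r (n (Fin.last (k + 1))) : Fin (k + 1) → ℤ)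
  have e2 := sum_succ_sub_castSucc (Fin.cons (n 0) s : Fin (k + 1) → ℤ)
  simp only [Fin.snoc_castSucc, Fin.cons_succ, Fin.snoc_last, Fin.cons_zero,
    Finset.sum_sub_distrib, Finset.sum_add_distrib] at e1 e2 ⊢
  rw [rightLabel, leftLabel]
  linarith

/-- The exponent in `coeffA` is the sum of the second arguments in `prodS`, corrected by the powers
of $-\sqrt q$ that `prodR_sqrt` produces on the two sides of the expansion. -/
lemma coeffA_eq (h0 : 0 < q) {d : ℕ} (x : ℤ) (n : Fin (d + 4) → ℤ) (r s : Fin (d + 2) → ℤ)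
    (t : Fin (d + 1) → ℤ) :
    (-√q) ^ (rightLabel r n - leftLabel s n) * coeffA q x n r s t =
      prodS (√q) x n (Fin.snoc t (r 0) : Fin (d + 2) → ℤ) s *
        (-√q) ^ (rightLabel (Fin.tail r) (Fin.tail n) - leftLabel t (Fin.tail n)) := by
  have hne : -√q ≠ 0 := neg_ne_zero.2 (Real.sqrt_pos.2 h0).ne'
  rw [prodS, prod_recCoeff_sqrt h0, coeffA]
  simp only [Fin.snoc_castSucc, Fin.cons_succ]
  rw [mul_right_comm, ← zpow_add₀ hne, ← mul_assoc, ← zpow_add₀ hne]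
  congr 2
  have e1 : ∑ i, n i = n 0 + (n 1 + ∑ j : Fin (d + 2), n j.succ.succ) := by
    rw [Fin.sum_univ_succ, Fin.sum_univ_succ]
    rfl
  have e2 := Fin.sum_univ_castSucc (Fin.snoc t (r 0) : Fin (d + 2) → ℤ)
  simp only [Fin.snoc_castSucc, Fin.snoc_last] at e2
  rw [rightLabel_succ, rightLabel_succ, leftLabel_succ, leftLabel_succ]
  simp only [Finset.sum_sub_distrib, Finset.sum_add_distrib, e2, Finset.sum_const,
    Finset.card_univ, Fintype.card_fin, nsmul_eq_mul, Nat.cast_add, Nat.cast_ofNat]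
  show r 0 - n 0 - (n (Fin.last (d + 3)) - s (Fin.last (d + 1))) + _ =
    _ + (r 1 - n 1 - (n (Fin.last (d + 3)) - t (Fin.last d)))
  rw [e1]
  ring

end

end QBessel

theorem mainTheorem3 (q : ℝ) (hq0 : 0 < q) (hq1 : q < 1) (d : ℕ) (x : ℤ)
    (n : Fin (d + 4) → ℤ) (r s : Fin (d + 2) → ℤ) :
    HasSum
      (fun t : Fin (d + 1) → ℤ =>
        QBessel.symbolS q x n (Fin.snoc t (r 0) : Fin (d + 2) → ℤ) s *
          QBessel.symbolR q (r 0) (Fin.tail n) (Fin.tail r) t)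
      (QBessel.symbolR q x n r s) ∧
    HasSum
      (fun t : Fin (d + 1) → ℤ =>
        QBessel.coeffA q x n r s t *
          QBessel.besselJMulti (QBessel.nuVec (r 0) (Fin.tail n)) (Fin.tail r) t q)
      (QBessel.besselJMulti (QBessel.nuVec x n) r s q) := by
  constructor
  · simp only [QBessel.symbolS_eq hq0 hq1, QBessel.symbolR_eq hq0 hq1]
    exact QBessel.hasSum_prodS_mul_prodR hq0 hq1 x n r s
  · have hs0 : 0 < √q := Real.sqrt_pos.2 hq0
    have hs1 : √q < 1 := by
      rw [Real.sqrt_lt' one_pos]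
      simpa using hq1
    have hne : (-√q) ^ (QBessel.rightLabel r n - QBessel.leftLabel s n) ≠ 0 :=
      zpow_ne_zero _ (neg_ne_zero.2 hs0.ne')
    -- The building blocks have base $q^2$, so the Bessel identity in base $q$ is the product
    -- identity at $\sqrt q$.
    have h := QBessel.hasSum_prodS_mul_prodR hs0 hs1 x n r s
    rw [QBessel.prodR_sqrt hq0] at h
    rw [← hasSum_mul_left_iff hne]
    refine QBessel.hasSum_of_eq h (fun t => ?_) rfl
    rw [QBessel.prodR_sqrt hq0, ← mul_assoc, QBessel.coeffA_eq hq0, mul_assoc]
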